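/- **Model.** Let $d,K,T\ge 1$ be integers, $R_{\max},A_{\max}>0$, and $\mathbf b\in\mathbb R^d$ with $b_i>0$ for all $i$; put $b_{\min}=\min_i b_i$ and $P_{\max}=2R_{\max}/b_{\min}$. There are $K$ configurations; configuration $\theta$ has a fixed distribution $\mathcal D_\theta$ of reward–resource pairs $(r,\mathbf a)\in\mathbb R_+\times\mathbb R_+^d$. Assume: (stationarity and independence) if configuration $\theta$ is selected in a round, the request $(r_t,\mathbf a_t)$ of that round is drawn from $\mathcal D_\theta$, independently of the past; (boundedness) $0\le r\le R_{\max}$ and $\|\mathbf a\|_\infty\le A_{\max}$ almost surely under every $\mathcal D_\theta$; (budget scaling) the total budget over the $T$ rounds is $\mathbf B=T\,\mathbf b$; (continuous valuation) under every $\mathcal D_\theta$ the conditional distribution of $r$ given $\mathbf a$ has no atoms, for almost every value of $\mathbf a$. **Benchmark.** With $\Delta_K$ the probability simplex, let $$V^{\mathrm{mix}}(\mathbf b)=\sup\Big\{\sum_\theta w_\theta\,\mathbb E_\theta[r\,x_\theta(r,\mathbf a)]\;:\;\mathbf w\in\Delta_K,\ x_\theta \text{ measurable with values in }[0,1],\ \sum_\theta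 w_\theta\,\mathbb E_\theta[\mathbf a\,x_\theta(r,\mathbf a)]\le\mathbf b\Big\}.$$ **Algorithm (SP-UCB–OLP)** with exploration parameter $\alpha\ge1$, slack $\varepsilon=\sqrt{\log T/T}$, confidence level $\delta=T^{-2}$ and constants $c_g,c_0>0$. In round $t\le K$ select configuration $t$, observe the request and do not admit it. In round $t$ with $K<t\le T$, let $N_\theta$ be the number of requests observed so far under $\theta$ and $\mathcal S_\theta$ the collection of these requests (admitted or not), and put $$\widehat g_{\theta,t}(\mathbf p)=\frac1{N_\theta\vee1}\sum_{(r,\mathbf a)\in\mathcal S_\theta}(r-\langle\mathbf p,\mathbf a\rangle)_+,\qquad \beta_{\alpha,\theta}(t)=\alpha c_gR_{\max}\sqrt{\frac{d\log\big(c_0dP_{\max}A_{\max}T/R_{\max}\big)+\log(KT/\delta)}{N_\theta\vee1}}$$ (where $\sqrt x:=0$ for $x<0$) and $$L_t^{\mathrm{opt}}(\mathbf w,\mathbf p)=\langle\mathbf p,(1-\varepsilon)\mathbf b\rangle+\sum_\theta w_\theta\big(\widehat g_{\theta,t}(\mathbf p)+\beta_{\alpha,\theta}(t)\big).$$ Choose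 any $\mathbf w_t\in\Delta_K$ maximizing $\min_{\mathbf p\ge0}L_t^{\mathrm{opt}}(\mathbf w,\mathbf p)$ over $\Delta_K$ and any $\mathbf p_t\ge0$ minimizing $L_t^{\mathrm{opt}}(\mathbf w_t,\cdot)$ over $\mathbf p\ge 0$ (measurably in the information available before the round); draw $\theta_t\sim\mathbf w_t$; observe $(r_t,\mathbf a_t)\sim\mathcal D_{\theta_t}$; admit the request if and only if $\mathbf a_t$ is componentwise at most the remaining budget and $r_t>\langle\mathbf p_t,\mathbf a_t\rangle$, in which case $\mathbf a_t$ is subtracted from the remaining budget. Let $R_T$ be the sum of the admitted rewards. **Theorem.** If the absolute constants $c_g,c_0$ are chosen sufficiently large, then for all $d,R_{\max},A_{\max},\mathbf b$ as above there are constants $C_1,C_2>0$ that depend only on $(d,R_{\max},A_{\max},\mathbf b)$ (and on the fixed absolute constants $c_g,c_0$) such that, for all $K,T\ge1$, all $\alpha\ge1$, all distributions $\mathcal D_1,\dots,\mathcal D_K$ satisfying the assumptions and every run of SP-UCB–OLP, $$T\,V^{\mathrm{mix}}(\mathbf b)-\mathbb E[R_T]\;\le\;C_1\,\alpha\sqrt{KT\cdot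 d\log T}+C_2\sqrt{T\log T}+K R_{\max}.$$ In particular the regret is $\tilde O(\alpha\sqrt{KT})$: there are $C>0$ and $m\in\mathbb N$, depending only on the same quantities, such that for all $T\ge2$ and all $K,\alpha,\mathcal D_\theta$ as before, $$T\,V^{\mathrm{mix}}(\mathbf b)-\mathbb E[R_T]\le C\,\alpha\sqrt{KT}\,(\log T)^m.$$ -/

import Mathlib

open MeasureTheory ProbabilityTheory
open scoped Matrix

noncomputable section

namespace SPUCB

/-- A request: its reward `z.1 = r` and its resource vector `z.2 = a`. -/
abbrev Request (d : ℕ) := ℝ × (Fin d → ℝ)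

variable {K d : ℕ}

/-! ### The model -/

/-- Boundedness: almost surely `0 ≤ r ≤ Rmax`, `a ∈ ℝ₊ᵈ` and `‖a‖_∞ ≤ Amax`
(the norm of `Fin d → ℝ` is the sup norm). -/
def BoundedRequests (Rmax Amax : ℝ) (D : Measure (Request d)) : Prop :=
  ∀ᵐ z ∂D, 0 ≤ z.1 ∧ z.1 ≤ Rmax ∧ 0 ≤ z.2 ∧ ‖z.2‖ ≤ Amax

/-- Continuous valuation: the conditional distribution of the reward given the resource vector
is continuous, i.e. it charges no single point, for almost every value of the resource vector. -/
def ContinuousValuation (D : Measure (Request d)) [IsFiniteMeasure D] : Prop :=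
  ∀ᵐ a ∂(D.map Prod.snd), ∀ r : ℝ, condDistrib Prod.fst Prod.snd D a {r} = 0

/-- The value of the switching-aware mixed fluid relaxation with per-period budget `b`:
optimize over mixtures `w` of configurations and measurable acceptance rules
`x k : Request d → [0, 1]` subject to the budget constraint in expectation. -/
def mixFluidValue (D : Fin K → Measure (Request d)) (b : Fin d → ℝ) : ℝ :=
  sSup {v : ℝ | ∃ w ∈ stdSimplex ℝ (Fin K), ∃ x : Fin K → Request d → ℝ,
    (∀ k, Measurable (x k)) ∧ (∀ k z, x k z ∈ Set.Icc (0 : ℝ) 1) ∧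
    (∀ i, ∑ k, w k * ∫ z, z.2 i * x k z ∂(D k) ≤ b i) ∧
    v = ∑ k, w k * ∫ z, z.1 * x k z ∂(D k)}

/-! ### Ingredients of the algorithm

Rounds are numbered `0, 1, …, T - 1`. For one realization, `θ t` is the configuration selected in
round `t` and `z t` the request observed in round `t`. -/

/-- The slack `ε = √(log T / T)`. -/
def slack (T : ℕ) : ℝ := Real.sqrt (Real.log T / T)

/-- The conservative per-period budget `(1 - ε) b`. -/
def safeBudget (T : ℕ) (b : Fin d → ℝ) : Fin d → ℝ := (1 - slack T) • b

/-- The price bound `2 Rmax / b_min`, where `b_min` is the smallest component of `b`. -/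
def priceBound (Rmax : ℝ) (b : Fin d → ℝ) : ℝ := 2 * Rmax / ⨅ i, b i

/-- The number of observations of configuration `k` before round `t`. -/
def sampleCount (θ : ℕ → Fin K) (k : Fin K) (t : ℕ) : ℕ :=
  ((Finset.range t).filter fun s => θ s = k).card

/-- The empirical surplus of configuration `k` at price `p`, computed from all requests that were
observed under `k` before round `t`, admitted or not. -/
def empSurplus (θ : ℕ → Fin K) (z : ℕ → Request d) (k : Fin K) (t : ℕ) (p : Fin d → ℝ) : ℝ :=
  (1 / max (sampleCount θ k t : ℝ) 1) *
    ∑ s ∈ (Finset.range t).filter (fun s => θ s = k), max ((z s).1 - p ⬝ᵥ (z s).2) 0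

/-- The confidence radius of a configuration that was observed `n` times, with exploration
parameter `α`, confidence level `δ` and constants `cg`, `c₀`. -/
def confRadius (cg c₀ Rmax Amax : ℝ) (b : Fin d → ℝ) (K T : ℕ) (α δ : ℝ) (n : ℕ) : ℝ :=
  α * cg * Rmax * Real.sqrt
    ((d * Real.log (c₀ * d * priceBound Rmax b * Amax * T / Rmax) + Real.log (K * T / δ)) /
      max (n : ℝ) 1)

/-- The optimistic Lagrangian of round `t`, as a function of the mixture `w` and the price `p`. -/
def optLagrangian (cg c₀ Rmax Amax : ℝ) (b : Fin d → ℝ) (T : ℕ) (α δ : ℝ)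
    (θ : ℕ → Fin K) (z : ℕ → Request d) (t : ℕ) (w : Fin K → ℝ) (p : Fin d → ℝ) : ℝ :=
  p ⬝ᵥ safeBudget T b + ∑ k, w k * (empSurplus θ z k t p +
    confRadius cg c₀ Rmax Amax b K T α δ (sampleCount θ k t))

/-- `(w, p) ∈ argmax_{w ∈ Δ} argmin_{p ≥ 0} L w p`: the mixture `w` maximizes the value
`min_{q ≥ 0} L w q` over the simplex, and the price `p` attains that minimum for `w`. -/
def IsMaxMin (L : (Fin K → ℝ) → (Fin d → ℝ) → ℝ) (w : Fin K → ℝ) (p : Fin d → ℝ) : Prop :=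
  w ∈ stdSimplex ℝ (Fin K) ∧ 0 ≤ p ∧
  IsMaxOn (fun w' => ⨅ q : {q : Fin d → ℝ // 0 ≤ q}, L w' q) (stdSimplex ℝ (Fin K)) w ∧
  IsMinOn (L w) {q | 0 ≤ q} p

/-- The admission decision of round `t` for the request `z`, given the price `p` and the remaining
budget `rem`: no admission in the first `K` rounds, afterwards admit if and only if the request
fits into the remaining budget and its reward exceeds its bid price. -/
def Admits (K t : ℕ) (rem p : Fin d → ℝ) (z : Request d) : Prop :=
  K ≤ t ∧ z.2 ≤ rem ∧ p ⬝ᵥ z.2 < z.1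

open Classical in
/-- The budget that remains at the beginning of round `t`, when the total budget is `B`, the
observed requests are `z` and the prices are `p`. -/
def remBudget (K : ℕ) (B : Fin d → ℝ) (z : ℕ → Request d) (p : ℕ → Fin d → ℝ) :
    ℕ → Fin d → ℝ
  | 0 => B
  | t + 1 => if Admits K t (remBudget K B z p t) (p t) (z t)
      then remBudget K B z p t - (z t).2 else remBudget K B z p t

open Classical in
/-- The total reward of the rounds `0, …, T - 1`. -/
def totalReward (K T : ℕ) (B : Fin d → ℝ) (z : ℕ → Request d) (p : ℕ → Fin d → ℝ) : ℝ :=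
  ∑ t ∈ Finset.range T, if Admits K t (remBudget K B z p t) (p t) (z t) then (z t).1 else 0

/-! ### A run of the algorithm -/

/-- The processes `θ` (configurations), `Z` (requests), `w` (mixtures) and `p` (prices) on the
probability space `(Ω, P)` form a run of SP-UCB-OLP over `T` rounds in the environment `D`.
Here `ℱ t` is the information available before round `t`; it contains everything that was
selected and observed in the earlier rounds, and possibly further randomness that is used to
choose among the solutions of the optimistic saddle point problem. -/
structure IsRun {Ω : Type*} {mΩ : MeasurableSpace Ω} (P : Measure Ω) (ℱ : Filtration ℕ mΩ)
    (D : Fin K → Measure (Request d)) (cg c₀ Rmax Amax : ℝ) (b : Fin d → ℝ) (T : ℕ) (α δ : ℝ)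
    (θ : ℕ → Ω → Fin K) (Z : ℕ → Ω → Request d)
    (w : ℕ → Ω → Fin K → ℝ) (p : ℕ → Ω → Fin d → ℝ) : Prop where
  /-- The selected configuration is known after its round. -/
  measurable_config : ∀ t < T, Measurable[ℱ (t + 1)] (θ t)
  /-- The request is known after its round. -/
  measurable_request : ∀ t < T, Measurable[ℱ (t + 1)] (Z t)
  /-- The mixture is computed from the information available before the round. -/
  measurable_mixture : ∀ t < T, Measurable[ℱ t] (w t)
  /-- The price is computed from the information available before the round. -/
  measurable_price : ∀ t < T, Measurable[ℱ t] (p t)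
  /-- Stationarity and independence: given the past and given that configuration `k` is selected,
  the request is distributed according to `D k`. -/
  observe : ∀ t < T, ∀ E : Set Ω, MeasurableSet[ℱ t] E → ∀ (k : Fin K) (S : Set (Request d)),
    MeasurableSet S →
      P (E ∩ {ω | θ t ω = k} ∩ {ω | Z t ω ∈ S}) = P (E ∩ {ω | θ t ω = k}) * D k S
  /-- Initialization: each configuration is selected once, in order. -/
  warmStart : ∀ t < T, t < K → ∀ᵐ ω ∂P, (θ t ω : ℕ) = t
  /-- After the initialization, the mixture and the price solve the optimistic saddle point
  problem of the round. -/
  saddle : ∀ t < T, K ≤ t → ∀ᵐ ω ∂P,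
    IsMaxMin (optLagrangian cg c₀ Rmax Amax b T α δ (fun s => θ s ω) (fun s => Z s ω) t)
      (w t ω) (p t ω)
  /-- After the initialization, the configuration is drawn from the mixture: given the past, its
  conditional distribution is `w t`. -/
  draw : ∀ t < T, K ≤ t → ∀ E : Set Ω, MeasurableSet[ℱ t] E → ∀ k : Fin K,
    P (E ∩ {ω | θ t ω = k}) = ∫⁻ ω in E, ENNReal.ofReal (w t ω k) ∂P

/-- The switching-aware regret `T * V^mix(b) - E[R_T]` of a run with total budget `B = T b`. -/
def mixRegret {Ω : Type*} {mΩ : MeasurableSpace Ω} (P : Measure Ω)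
    (D : Fin K → Measure (Request d)) (b : Fin d → ℝ) (T : ℕ)
    (Z : ℕ → Ω → Request d) (p : ℕ → Ω → Fin d → ℝ) : ℝ :=
  T * mixFluidValue D b -
    ∫ ω, totalReward K T ((T : ℝ) • b) (fun t => Z t ω) (fun t => p t ω) ∂P

end SPUCB

end

/-!
By weak duality, every feasible point of the relaxation has a value of at most `max_w min_p` of the
Lagrangian `⟨p, b⟩ + ∑ k, w k * E_k (r - ⟨p, a⟩)₊`. The requests accepted at a price form a
halfspace, so that the acceptance frequency, the mean accepted reward and the mean accepted
consumption of each configuration deviate from their expectations by `O(√(log T / n))` after `n`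
observations, uniformly in the price: halfspaces cut out polynomially many subsets of a sample, and
a symmetrization turns the count into a deviation inequality. Adaptive sampling does no harm, since
the observations of one configuration are a random initial segment of an independent sequence.

The surplus `(r - ⟨p, a⟩)₊` is the integral over `s ≥ 0` of the indicator of `⟨p, a⟩ + s < r`. Hence
the empirical surpluses plus the bonuses dominate the expected ones, and the optimistic saddle value
dominates `1 - ε` times the value of the relaxation. The first-order conditions at prices slightly
beside the saddle price bound the empirical consumption and reward there. Since valuations have no
atoms, the expected ones are continuous in the price, so that a round of the algorithm earns this
value and consumes at most `(1 - ε) b` in expectation, up to the deviations. Summed along the run,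
the deviations `1 / √n` cost `O(√(K T))`. Rewards and consumptions fluctuate about their conditional
expectations by `O(√T)`, and the rounds that are lost when the budget is exhausted early are paid
for by the excess consumption, at the rate `Rmax / b_min`. If `T ≤ K`, or if `T` is too short for
the confidence radius to exceed the deviations, the trivial bound `T * Rmax` suffices.
-/

noncomputable section

namespace SPUCB

variable {K d : ℕ}

/-! ### Growth of classes cut out by linear functionals -/

section Growth

variable {κ E : Type*} [AddCommGroup E] [Module ℝ E]

lemma sum_mul_sub_dual_apply {S : Finset κ} {c : κ → ℝ} {φ : κ → E}
    (hc : ∑ j ∈ S, c j • φ j = 0) (g : κ → ℝ) (ℓ : Module.Dual ℝ E) :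
    ∑ j ∈ S, c j * (g j - ℓ (φ j)) = ∑ j ∈ S, c j * g j := by
  have hℓ : ∑ j ∈ S, c j * ℓ (φ j) = 0 := by simpa using congrArg ℓ hc
  simp only [mul_sub, Finset.sum_sub_distrib, hℓ, sub_zero]

variable [FiniteDimensional ℝ E]

lemma exists_sum_smul_eq_zero_of_finrank_lt_card {φ : κ → E} {S : Finset κ}
    (hS : Module.finrank ℝ E < S.card) :
    ∃ c : κ → ℝ, ∑ j ∈ S, c j • φ j = 0 ∧ ∃ j ∈ S, 0 < c j := by
  have hdep : ¬ LinearIndepOn ℝ φ (S : Set κ) := fun h => by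
    have := LinearIndependent.fintype_card_le_finrank h
    simp only [SetLike.coe_sort_coe, Fintype.card_coe] at this
    omega
  simp only [linearIndepOn_finset_iff, not_forall] at hdep
  obtain ⟨c, hc, j, hj, hcj⟩ := hdep
  rcases lt_or_gt_of_ne hcj with h | h
  · exact ⟨-c, by simp [hc], j, hj, by simpa using h⟩
  · exact ⟨c, hc, j, hj, h⟩

/- Pair a linear relation between the `φ j` with the slacks `g j - ℓ (φ j)`: the result does not
depend on `ℓ`, but it is positive if `ℓ` cuts out the positive coefficients of the relation and
nonpositive if `ℓ` cuts out the negative ones. -/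
lemma card_le_finrank_of_forall_exists_dual_lt {φ : κ → E} {g : κ → ℝ} {S : Finset κ}
    (hS : ∀ t ⊆ S, ∃ ℓ : Module.Dual ℝ E, ∀ j ∈ S, j ∈ t ↔ ℓ (φ j) < g j) :
    S.card ≤ Module.finrank ℝ E := by
  by_contra! hlt
  obtain ⟨c, hc, i, hi, hci⟩ := exists_sum_smul_eq_zero_of_finrank_lt_card (φ := φ) hlt
  obtain ⟨ℓ₁, hℓ₁⟩ := hS (S.filter fun j => 0 < c j) (Finset.filter_subset _ _)
  obtain ⟨ℓ₂, hℓ₂⟩ := hS (S.filter fun j => c j < 0) (Finset.filter_subset _ _)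
  have hpos : 0 < ∑ j ∈ S, c j * (g j - ℓ₁ (φ j)) := by
    refine Finset.sum_pos' (fun j hj => ?_)
      ⟨i, hi, mul_pos hci (sub_pos.2 ((hℓ₁ i hi).1 (by simp [hi, hci])))⟩
    have := hℓ₁ j hj
    simp only [Finset.mem_filter, hj, true_and] at this
    rcases lt_or_ge 0 (c j) with h | h
    · exact mul_nonneg h.le (sub_nonneg.2 (this.1 h).le)
    · exact mul_nonneg_of_nonpos_of_nonpos h (sub_nonpos.2 (not_lt.1 (mt this.2 h.not_gt)))
  have hneg : ∑ j ∈ S, c j * (g j - ℓ₂ (φ j)) ≤ 0 := by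
    refine Finset.sum_nonpos fun j hj => ?_
    have := hℓ₂ j hj
    simp only [Finset.mem_filter, hj, true_and] at this
    rcases lt_or_ge (c j) 0 with h | h
    · exact mul_nonpos_of_nonpos_of_nonneg h.le (sub_nonneg.2 (this.1 h).le)
    · exact mul_nonpos_of_nonneg_of_nonpos h (sub_nonpos.2 (not_lt.1 (mt this.2 h.not_gt)))
  rw [sum_mul_sub_dual_apply hc] at hpos hneg
  exact hneg.not_gt hpos

lemma sum_choose_le_pow (m n : ℕ) : ∑ k ∈ Finset.Iic n, m.choose k ≤ (m + 1) ^ n := by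
  rw [add_pow, ← Nat.range_succ_eq_Iic]
  refine Finset.sum_le_sum fun k hk => ?_
  have hpos : 0 < n.choose k := Nat.choose_pos (Nat.lt_succ_iff.1 (Finset.mem_range.1 hk))
  calc m.choose k ≤ m ^ k := Nat.choose_le_pow m k
    _ ≤ m ^ k * 1 ^ (n - k) * n.choose k := by
      rw [one_pow, mul_one]; exact Nat.le_mul_of_pos_right _ hpos

lemma card_le_pow_finrank_of_forall_exists_dual_lt [Fintype κ] {φ : κ → E}
    {g : κ → ℝ} {𝒜 : Finset (Finset κ)}
    (h𝒜 : ∀ A ∈ 𝒜, ∃ ℓ : Module.Dual ℝ E, ∀ j, j ∈ A ↔ ℓ (φ j) < g j) :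
    𝒜.card ≤ (Fintype.card κ + 1) ^ Module.finrank ℝ E := by
  classical
  have hvc : 𝒜.vcDim ≤ Module.finrank ℝ E := by
    refine Finset.sup_le fun S hS => card_le_finrank_of_forall_exists_dual_lt (φ := φ) (g := g) ?_
    intro t ht
    obtain ⟨A, hA, rfl⟩ := Finset.mem_shatterer.1 hS ht
    obtain ⟨ℓ, hℓ⟩ := h𝒜 A hA
    exact ⟨ℓ, fun j hj => by simp [hj, hℓ]⟩
  calc 𝒜.card ≤ 𝒜.shatterer.card := Finset.card_le_card_shatterer 𝒜
    _ ≤ ∑ k ∈ Finset.Iic 𝒜.vcDim, (Fintype.card κ).choose k :=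
      Finset.card_shatterer_le_sum_vcDim
    _ ≤ ∑ k ∈ Finset.Iic (Module.finrank ℝ E), (Fintype.card κ).choose k :=
      Finset.sum_le_sum_of_subset (Finset.Iic_subset_Iic.2 hvc)
    _ ≤ _ := sum_choose_le_pow _ _

end Growth

/-! ### Uniform deviations by symmetrization -/

section Symmetrization

variable {ι : Type*} [Fintype ι]

lemma sum_exp_sum_units_mul_le [DecidableEq ι] (v : ι → ℝ) :
    ∑ σ : ι → ℤˣ, Real.exp (∑ j, ((σ j : ℤ) : ℝ) * v j) ≤
      2 ^ Fintype.card ι * Real.exp (∑ j, v j ^ 2 / 2) := by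
  calc ∑ σ : ι → ℤˣ, Real.exp (∑ j, ((σ j : ℤ) : ℝ) * v j)
      = ∑ σ : ι → ℤˣ, ∏ j, Real.exp (((σ j : ℤ) : ℝ) * v j) := by simp only [Real.exp_sum]
    _ = ∏ j, ∑ e : ℤˣ, Real.exp (((e : ℤ) : ℝ) * v j) := by
      rw [Finset.prod_univ_sum, Fintype.piFinset_univ]
    _ = ∏ j, 2 * Real.cosh (v j) := by
      refine Finset.prod_congr rfl fun j _ => ?_
      rw [UnitsInt.univ, Finset.sum_pair (by decide), Real.cosh_eq]
      push_cast
      ring_nf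
    _ ≤ ∏ j, 2 * Real.exp (v j ^ 2 / 2) :=
      Finset.prod_le_prod (fun j _ => by positivity)
        fun j _ => mul_le_mul_of_nonneg_left (Real.cosh_le_exp_half_sq _) zero_le_two
    _ = _ := by rw [Finset.prod_mul_distrib, Finset.prod_const, Finset.card_univ, ← Real.exp_sum]

lemma sum_ofReal_exp_sum_units_mul_le [DecidableEq ι] {v : ι → ℝ} (hv : ∀ j, |v j| ≤ 1) (l : ℝ) :
    ∑ σ : ι → ℤˣ, ENNReal.ofReal (Real.exp (∑ j, ((σ j : ℤ) : ℝ) * (l * v j))) ≤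
      2 ^ Fintype.card ι * ENNReal.ofReal (Real.exp (Fintype.card ι * (l ^ 2 / 2))) := by
  rw [← ENNReal.ofReal_sum_of_nonneg fun _ _ => (Real.exp_pos _).le]
  refine (ENNReal.ofReal_le_ofReal (sum_exp_sum_units_mul_le _)).trans ?_
  rw [ENNReal.ofReal_mul (by positivity), ENNReal.ofReal_pow zero_le_two, ENNReal.ofReal_ofNat]
  gcongr
  rw [← nsmul_eq_mul]
  refine Finset.sum_le_card_nsmul _ _ _ fun j _ => ?_
  rw [mul_pow]
  gcongr
  exact mul_le_of_le_one_right (sq_nonneg l) ((sq_le_one_iff_abs_le_one _).2 (hv j))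

variable {Q X : Type*}

/-- The supremum over a class of functions of the exponential moment of the signed differences
between two samples. It is `ℝ≥0∞`-valued, so that no boundedness is needed to define it. -/
def symSup (f : Q → X → ℝ) (l : ℝ) (σ : ι → ℤˣ) (u : (ι → X) × (ι → X)) : ENNReal :=
  ⨆ q, ENNReal.ofReal (Real.exp (∑ j, ((σ j : ℤ) : ℝ) * (l * (f q (u.1 j) - f q (u.2 j)))))

/-- Exchanges the entries of two samples at the positions with sign `-1`. -/
def swapSample (σ : ι → ℤˣ) (u : (ι → X) × (ι → X)) : (ι → X) × (ι → X) :=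
  (fun j => if σ j = 1 then u.1 j else u.2 j, fun j => if σ j = 1 then u.2 j else u.1 j)

lemma symSup_one_swapSample (f : Q → X → ℝ) (l : ℝ) (σ : ι → ℤˣ) (u : (ι → X) × (ι → X)) :
    symSup f l 1 (swapSample σ u) = symSup f l σ u := by
  unfold symSup swapSample
  refine iSup_congr fun q => ?_
  congr 2
  refine Finset.sum_congr rfl fun j _ => ?_
  rcases Int.units_eq_one_or (σ j) with h | h
  · simp [h]
  · simp only [h, Pi.one_apply, Units.val_one, Int.cast_one, one_mul, show (-1 : ℤˣ) ≠ 1 by decide,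
      if_false, Units.val_neg, Int.cast_neg]
    ring

lemma sum_symSup_le [DecidableEq ι] {f : Q → X → ℝ} (hf : ∀ q x, f q x ∈ Set.Icc (0 : ℝ) 1) {N : ℕ}
    (hN : ∀ x : ι ⊕ ι → X, (Set.range fun q j => f q (x j)).encard ≤ N) (l : ℝ)
    (u : (ι → X) × (ι → X)) :
    ∑ σ : ι → ℤˣ, symSup f l σ u ≤
      N * (2 ^ Fintype.card ι * ENNReal.ofReal (Real.exp (Fintype.card ι * (l ^ 2 / 2)))) := by
  obtain ⟨hfin, hcard⟩ := Set.encard_le_coe_iff_finite_ncard_le.1 (hN (Sum.elim u.1 u.2))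
  have hdiff : ∀ y ∈ hfin.toFinset, ∀ j, |y (.inl j) - y (.inr j)| ≤ 1 := by
    intro y hy j
    obtain ⟨q, rfl⟩ := hfin.mem_toFinset.1 hy
    exact Real.dist_le_of_mem_Icc_01 (hf q _) (hf q _)
  calc ∑ σ : ι → ℤˣ, symSup f l σ u
      ≤ ∑ σ : ι → ℤˣ, ∑ y ∈ hfin.toFinset, ENNReal.ofReal
          (Real.exp (∑ j, ((σ j : ℤ) : ℝ) * (l * (y (.inl j) - y (.inr j))))) :=
        Finset.sum_le_sum fun σ _ => iSup_le fun q => Finset.single_le_sum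
          (f := fun y : ι ⊕ ι → ℝ => ENNReal.ofReal
            (Real.exp (∑ j, ((σ j : ℤ) : ℝ) * (l * (y (.inl j) - y (.inr j))))))
          (fun _ _ => zero_le) (hfin.mem_toFinset.2 ⟨q, rfl⟩)
    _ = ∑ y ∈ hfin.toFinset, ∑ σ : ι → ℤˣ, ENNReal.ofReal
          (Real.exp (∑ j, ((σ j : ℤ) : ℝ) * (l * (y (.inl j) - y (.inr j))))) := Finset.sum_comm
    _ ≤ hfin.toFinset.card • _ := Finset.sum_le_card_nsmul _ _ _
        fun y hy => sum_ofReal_exp_sum_units_mul_le (hdiff y hy) l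
    _ ≤ _ := by
      rw [nsmul_eq_mul, ← Set.ncard_eq_toFinset_card _ hfin]
      gcongr

variable [MeasurableSpace X]

lemma measurable_symSup [Countable Q] {f : Q → X → ℝ} (hf : ∀ q, Measurable (f q)) (l : ℝ)
    (σ : ι → ℤˣ) : Measurable (symSup f l σ) := by
  unfold symSup
  fun_prop

variable (D : Measure X) [IsProbabilityMeasure D]

lemma measurePreserving_swapSample (σ : ι → ℤˣ) :
    MeasurePreserving (swapSample (X := X) σ)
      ((Measure.pi fun _ : ι => D).prod (Measure.pi fun _ : ι => D))
      ((Measure.pi fun _ : ι => D).prod (Measure.pi fun _ : ι => D)) := by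
  have hzip := measurePreserving_arrowProdEquivProdArrow X X ι (fun _ => D) (fun _ => D)
  have hswap : MeasurePreserving (fun (u : ι → X × X) j =>
      (if σ j = 1 then id else Prod.swap) (u j)) (Measure.pi fun _ : ι => D.prod D)
      (Measure.pi fun _ : ι => D.prod D) := by
    refine measurePreserving_pi _ _ fun j => ?_
    split_ifs
    · exact MeasurePreserving.id _
    · exact Measure.measurePreserving_swap
  convert! (hzip.comp hswap).comp hzip.symm using 1
  funext u
  ext j : 2 <;>
    by_cases hj : σ j = 1 <;>
    simp [swapSample, MeasurableEquiv.arrowProdEquivProdArrow, Equiv.arrowProdEquivProdArrow, hj]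

lemma integrable_pi_const_mul_sub_eval {g : X → ℝ} (hg : Integrable g D) (l c : ℝ) (j : ι) :
    Integrable (fun y : ι → X => l * (c - g (y j))) (Measure.pi fun _ : ι => D) :=
  ((integrable_const c).sub (integrable_comp_eval (μ := fun _ : ι => D) hg)).const_mul l

lemma integral_pi_sum_const_mul_sub_eval {g : X → ℝ} (hg : Integrable g D) (l : ℝ) (c : ι → ℝ) :
    ∫ y : ι → X, ∑ j, l * (c j - g (y j)) ∂(Measure.pi fun _ : ι => D) =
      l * ∑ j, (c j - ∫ z, g z ∂D) := by
  rw [integral_finsetSum _ fun j _ => integrable_pi_const_mul_sub_eval D hg l (c j) j,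
    Finset.mul_sum]
  refine Finset.sum_congr rfl fun j _ => ?_
  rw [integral_const_mul, integral_sub (integrable_const _)
    (integrable_comp_eval (μ := fun _ : ι => D) hg),
    integral_comp_eval (μ := fun _ : ι => D) hg.aestronglyMeasurable]
  simp

variable [Countable Q] {f : Q → X → ℝ} (hm : ∀ q, Measurable (f q))
  (hf : ∀ q x, f q x ∈ Set.Icc (0 : ℝ) 1) {N : ℕ}
  (hN : ∀ x : ι ⊕ ι → X, (Set.range fun q j => f q (x j)).encard ≤ N)

include hm hf hN

lemma lintegral_symSup_one_le (l : ℝ) :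
    ∫⁻ u, symSup f l 1 u ∂((Measure.pi fun _ : ι => D).prod (Measure.pi fun _ : ι => D)) ≤
      N * ENNReal.ofReal (Real.exp (Fintype.card ι * (l ^ 2 / 2))) := by
  classical
  set P := (Measure.pi fun _ : ι => D).prod (Measure.pi fun _ : ι => D)
  have hsymm : ∀ σ : ι → ℤˣ, ∫⁻ u, symSup f l σ u ∂P = ∫⁻ u, symSup f l 1 u ∂P := fun σ => by
    rw [← (measurePreserving_swapSample D σ).lintegral_comp (measurable_symSup hm l 1)]
    simp only [symSup_one_swapSample, P]
  have hsum : 2 ^ Fintype.card ι * ∫⁻ u, symSup f l 1 u ∂P =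
      ∫⁻ u, ∑ σ : ι → ℤˣ, symSup f l σ u ∂P := by
    rw [lintegral_finsetSum _ fun σ _ => measurable_symSup hm l σ]
    simp [hsymm]
  have hbound : ∫⁻ u, ∑ σ : ι → ℤˣ, symSup f l σ u ∂P ≤
      N * (2 ^ Fintype.card ι * ENNReal.ofReal (Real.exp (Fintype.card ι * (l ^ 2 / 2)))) :=
    (lintegral_mono fun u => sum_symSup_le hf hN l u).trans_eq (by simp [P])
  rw [← hsum, mul_left_comm] at hbound
  exact (ENNReal.mul_le_mul_iff_right (by simp) (by finiteness)).1 hbound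

omit hN [Countable Q] in
lemma ofReal_exp_sum_sub_integral_le (l : ℝ) (q : Q) (x : ι → X) :
    ENNReal.ofReal (Real.exp (l * ∑ j, (f q (x j) - ∫ z, f q z ∂D))) ≤
      ∫⁻ y, symSup f l 1 (x, y) ∂(Measure.pi fun _ : ι => D) := by
  have hint : Integrable (f q) D :=
    Integrable.of_mem_Icc 0 1 (hm q).aemeasurable (.of_forall (hf q))
  set g : (ι → X) → ℝ := fun y => ∑ j, l * (f q (x j) - f q (y j)) with hg
  have hgm : Measurable g := by fun_prop
  have hgint : Integrable g (Measure.pi fun _ : ι => D) :=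
    integrable_finsetSum _ fun j _ => integrable_pi_const_mul_sub_eval D hint l _ j
  have hexp : Integrable (fun y => Real.exp (g y)) (Measure.pi fun _ : ι => D) := by
    refine Integrable.of_mem_Icc 0 (Real.exp (∑ _j : ι, |l|)) (by fun_prop)
      (.of_forall fun y => ⟨(Real.exp_pos _).le, Real.exp_le_exp.2 ?_⟩)
    refine Finset.sum_le_sum fun j _ => (le_abs_self _).trans ?_
    rw [abs_mul]
    exact mul_le_of_le_one_right (abs_nonneg l)
      (Real.dist_le_of_mem_Icc_01 (hf q _) (hf q _))
  calc ENNReal.ofReal (Real.exp (l * ∑ j, (f q (x j) - ∫ z, f q z ∂D)))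
      ≤ ENNReal.ofReal (∫ y, Real.exp (g y) ∂(Measure.pi fun _ : ι => D)) := by
        rw [← integral_pi_sum_const_mul_sub_eval D hint]
        exact ENNReal.ofReal_le_ofReal (convexOn_exp.map_integral_le
          Real.continuous_exp.continuousOn
          isClosed_univ (by simp) hgint hexp)
    _ = ∫⁻ y, ENNReal.ofReal (Real.exp (g y)) ∂(Measure.pi fun _ : ι => D) :=
        ofReal_integral_eq_lintegral_ofReal hexp (.of_forall fun y => (Real.exp_pos _).le)
    _ ≤ _ := lintegral_mono fun y => by
        refine (le_of_eq ?_).trans (le_iSup _ q)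
        simp [hg]

lemma measure_exists_card_mul_sq_le_le (l : ℝ) :
    (Measure.pi fun _ : ι => D) {x | ∃ q, Fintype.card ι * l ^ 2 ≤
      l * ∑ j, (f q (x j) - ∫ z, f q z ∂D)} ≤
      N * ENNReal.ofReal (Real.exp (-(Fintype.card ι * (l ^ 2 / 2)))) := by
  set n : ℝ := (Fintype.card ι : ℝ)
  have hmeas : Measurable fun x : ι → X => ∫⁻ y, symSup f l 1 (x, y) ∂(Measure.pi fun _ : ι => D) :=
    (measurable_symSup hm l 1).lintegral_prod_right'
  have hpos : ENNReal.ofReal (Real.exp (n * l ^ 2)) ≠ 0 := by simp [Real.exp_pos]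
  calc (Measure.pi fun _ : ι => D) {x | ∃ q, n * l ^ 2 ≤ l * ∑ j, (f q (x j) - ∫ z, f q z ∂D)}
      ≤ (Measure.pi fun _ : ι => D) {x | ENNReal.ofReal (Real.exp (n * l ^ 2)) ≤
          ∫⁻ y, symSup f l 1 (x, y) ∂(Measure.pi fun _ : ι => D)} := by
        refine measure_mono fun x ⟨q, hq⟩ => ?_
        exact (ENNReal.ofReal_le_ofReal (Real.exp_le_exp.2 hq)).trans
          (ofReal_exp_sum_sub_integral_le D hm hf l q x)
    _ ≤ (∫⁻ u, symSup f l 1 u ∂((Measure.pi fun _ : ι => D).prod (Measure.pi fun _ : ι => D))) /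
          ENNReal.ofReal (Real.exp (n * l ^ 2)) := by
        rw [lintegral_prod _ (measurable_symSup hm l 1).aemeasurable]
        exact meas_ge_le_lintegral_div hmeas.aemeasurable hpos ENNReal.ofReal_ne_top
    _ ≤ N * ENNReal.ofReal (Real.exp (n * (l ^ 2 / 2))) /
          ENNReal.ofReal (Real.exp (n * l ^ 2)) := by
        gcongr
        exact lintegral_symSup_one_le D hm hf hN l
    _ = _ := by
        rw [mul_div_assoc, ← ENNReal.ofReal_div_of_pos (Real.exp_pos _), ← Real.exp_sub]
        ring_nf

theorem measure_exists_sqrt_mul_lt_abs_sum_sub_integral_le {U : ℝ} (hU : 0 ≤ U) :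
    (Measure.pi fun _ : ι => D) {x | ∃ q, √(Fintype.card ι) * U <
      |∑ j, (f q (x j) - ∫ z, f q z ∂D)|} ≤ ENNReal.ofReal (2 * N * Real.exp (-U ^ 2 / 2)) := by
  rcases isEmpty_or_nonempty ι with _ | _
  · simp
  set n : ℝ := (Fintype.card ι : ℝ)
  have hn : 0 < √n := Real.sqrt_pos.2 (Nat.cast_pos.2 Fintype.card_pos)
  have hsq : n = √n ^ 2 := (Real.sq_sqrt (Nat.cast_nonneg _)).symm
  set l : ℝ := U / √n
  have hl : n * l ^ 2 = U ^ 2 := by rw [hsq]; simp only [l]; field_simp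
  have hlU : l * (√n * U) = U ^ 2 := by simp only [l]; field_simp
  have hcover : {x : ι → X | ∃ q, √n * U < |∑ j, (f q (x j) - ∫ z, f q z ∂D)|} ⊆
      {x | ∃ q, n * l ^ 2 ≤ l * ∑ j, (f q (x j) - ∫ z, f q z ∂D)} ∪
        {x | ∃ q, n * (-l) ^ 2 ≤ -l * ∑ j, (f q (x j) - ∫ z, f q z ∂D)} := by
    rintro x ⟨q, hq⟩
    have hle : n * l ^ 2 ≤ l * |∑ j, (f q (x j) - ∫ z, f q z ∂D)| := by
      rw [hl, ← hlU]
      gcongr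
    rcases abs_cases (∑ j, (f q (x j) - ∫ z, f q z ∂D)) with ⟨h, _⟩ | ⟨h, _⟩ <;> rw [h] at hle
    · exact .inl ⟨q, hle⟩
    · exact .inr ⟨q, by rwa [neg_sq, neg_mul_comm]⟩
  have hle : ∀ l', l' ^ 2 = l ^ 2 → (Measure.pi fun _ : ι => D)
      {x | ∃ q, n * l' ^ 2 ≤ l' * ∑ j, (f q (x j) - ∫ z, f q z ∂D)} ≤
        N * ENNReal.ofReal (Real.exp (-U ^ 2 / 2)) := fun l' hl' => by
    convert measure_exists_card_mul_sq_le_le D hm hf hN l' using 4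
    rw [hl']
    linarith
  refine (measure_mono hcover).trans ((measure_union_le _ _).trans ?_)
  refine (add_le_add (hle l rfl) (hle (-l) (neg_sq l))).trans_eq ?_
  rw [ENNReal.ofReal_mul (by positivity), ENNReal.ofReal_mul zero_le_two, ENNReal.ofReal_ofNat,
    ENNReal.ofReal_natCast]
  ring

end Symmetrization

section Sequences

variable {X Q : Type*} [MeasurableSpace X] (D : Measure X) [Countable Q] {f : Q → X → ℝ}

lemma measurableSet_exists_lt_abs_sum_sub_integral {Y ι : Type*} [MeasurableSpace Y]
    (hm : ∀ q, Measurable (f q)) {x : ι → Y → X} (hx : ∀ j, Measurable (x j)) (s : Finset ι)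
    (c : ℝ) :
    MeasurableSet {y | ∃ q, c < |∑ j ∈ s, (f q (x j y) - ∫ z, f q z ∂D)|} := by
  simp only [Set.ofPred_exists]
  exact .iUnion fun q => measurableSet_lt measurable_const (by fun_prop)

variable [IsProbabilityMeasure D]

lemma measure_infinitePi_exists_sqrt_mul_lt_abs_sum_sub_integral_le
    (hm : ∀ q, Measurable (f q)) (hf : ∀ q x, f q x ∈ Set.Icc (0 : ℝ) 1) {n N : ℕ}
    (hN : ∀ x : Finset.range n ⊕ Finset.range n → X,
      (Set.range fun q j => f q (x j)).encard ≤ N) {U : ℝ} (hU : 0 ≤ U) :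
    (Measure.infinitePi fun _ : ℕ => D) {ξ | ∃ q, √n * U <
      |∑ j ∈ Finset.range n, (f q (ξ j) - ∫ z, f q z ∂D)|} ≤
      ENNReal.ofReal (2 * N * Real.exp (-U ^ 2 / 2)) := by
  have h := measure_exists_sqrt_mul_lt_abs_sum_sub_integral_le D hm hf hN hU
  have hset := measurableSet_exists_lt_abs_sum_sub_integral D hm
    (x := fun (j : Finset.range n) (y : Finset.range n → X) => y j) measurable_pi_apply
    Finset.univ (√(Fintype.card (Finset.range n)) * U)
  rw [← Measure.infinitePi_map_restrict (fun _ : ℕ => D), Measure.map_apply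
    (Finset.measurable_restrict _) hset] at h
  convert h using 3
  ext ξ
  refine exists_congr fun q => ?_
  rw [Fintype.card_coe, Finset.card_range,
    ← Finset.sum_coe_sort (Finset.range n) fun j => f q (ξ j) - ∫ z, f q z ∂D]
  rfl

theorem measure_infinitePi_exists_le_sqrt_mul_lt_abs_sum_sub_integral_le
    (hm : ∀ q, Measurable (f q)) (hf : ∀ q x, f q x ∈ Set.Icc (0 : ℝ) 1) {T N : ℕ}
    (hN : ∀ n ≤ T, ∀ x : Finset.range n ⊕ Finset.range n → X,
      (Set.range fun q j => f q (x j)).encard ≤ N) {U : ℝ} (hU : 0 ≤ U) :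
    (Measure.infinitePi fun _ : ℕ => D) {ξ | ∃ n ≤ T, ∃ q, √n * U <
      |∑ j ∈ Finset.range n, (f q (ξ j) - ∫ z, f q z ∂D)|} ≤
      ENNReal.ofReal (T * (2 * N * Real.exp (-U ^ 2 / 2))) := by
  have hsub : {ξ : ℕ → X | ∃ n ≤ T, ∃ q, √n * U <
      |∑ j ∈ Finset.range n, (f q (ξ j) - ∫ z, f q z ∂D)|} ⊆ ⋃ n ∈ Finset.Icc 1 T,
      {ξ | ∃ q, √n * U < |∑ j ∈ Finset.range n, (f q (ξ j) - ∫ z, f q z ∂D)|} := by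
    rintro ξ ⟨n, hn, q, hq⟩
    obtain rfl | hpos := n.eq_zero_or_pos
    · simp at hq
    · exact Set.mem_biUnion (Finset.mem_coe.2 (Finset.mem_Icc.2 ⟨hpos, hn⟩)) ⟨q, hq⟩
  refine (measure_mono hsub).trans ((measure_biUnion_finset_le _ _).trans ?_)
  refine (Finset.sum_le_card_nsmul _ _ _ fun n hn =>
    measure_infinitePi_exists_sqrt_mul_lt_abs_sum_sub_integral_le D hm hf
      (hN n (Finset.mem_Icc.1 hn).2) hU).trans_eq ?_
  rw [Nat.card_Icc, Nat.add_sub_cancel, nsmul_eq_mul, ENNReal.ofReal_mul (p := (T : ℝ))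
    (by positivity), ENNReal.ofReal_natCast]

end Sequences

section Conditioning

variable {Ω Y X : Type*} [MeasurableSpace Ω] [MeasurableSpace Y] [MeasurableSpace X]
  {P : Measure Ω} {D : Measure X} [IsProbabilityMeasure D] {A : Set Ω}
  {φ : Ω → Y} {Z : Ω → X}

lemma map_restrict_prodMk_eq_prod [IsFiniteMeasure P] (hφ : Measurable φ) (hZ : Measurable Z)
    (h : ∀ E, MeasurableSet E → ∀ S, MeasurableSet S →
      P (φ ⁻¹' E ∩ A ∩ Z ⁻¹' S) = P (φ ⁻¹' E ∩ A) * D S) :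
    (P.restrict A).map (fun ω => (φ ω, Z ω)) = ((P.restrict A).map φ).prod D := by
  refine (Measure.prod_eq fun E S hE hS => ?_).symm
  rw [Measure.map_apply (hφ.prodMk hZ) (hE.prod hS), Measure.map_apply hφ hE,
    Measure.restrict_apply (hφ hE), ← h E hE S hS, Set.mk_preimage_prod,
    Measure.restrict_apply ((hφ hE).inter (hZ hS)), Set.inter_right_comm]

lemma setLIntegral_condition [IsFiniteMeasure P] (hφ : Measurable φ) (hZ : Measurable Z)
    (h : ∀ E, MeasurableSet E → ∀ S, MeasurableSet S →
      P (φ ⁻¹' E ∩ A ∩ Z ⁻¹' S) = P (φ ⁻¹' E ∩ A) * D S)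
    {F : Y × X → ENNReal} (hF : Measurable F) :
    ∫⁻ ω in A, F (φ ω, Z ω) ∂P = ∫⁻ ω in A, ∫⁻ x, F (φ ω, x) ∂D ∂P := by
  rw [← lintegral_map hF (hφ.prodMk hZ), map_restrict_prodMk_eq_prod hφ hZ h,
    lintegral_prod _ hF.aemeasurable, lintegral_map hF.lintegral_prod_right' hφ]

end Conditioning

section Stack

variable {X : Type*}

/-- The coupling of the observations of configuration `k` with a sequence `ξ` of independent
requests: whenever `k` is selected, the next unused entry of the sequence is replaced by the
observation. -/
def stack (k : Fin K) (θ : ℕ → Fin K) (z ξ : ℕ → X) : ℕ → ℕ → X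
  | 0 => ξ
  | t + 1 => if θ t = k then Function.update (stack k θ z ξ t) (sampleCount θ k t) (z t)
      else stack k θ z ξ t

lemma sampleCount_succ (k : Fin K) (θ : ℕ → Fin K) (t : ℕ) :
    sampleCount θ k (t + 1) = sampleCount θ k t + if θ t = k then 1 else 0 := by
  unfold sampleCount
  rw [Finset.range_add_one, Finset.filter_insert]
  split_ifs <;> simp

lemma stack_update (k : Fin K) (θ : ℕ → Fin K) (z ξ : ℕ → X) (t n : ℕ) (x : X)
    (hn : sampleCount θ k t ≤ n) :
    stack k θ z (Function.update ξ n x) t = Function.update (stack k θ z ξ t) n x := by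
  induction t with
  | zero => rfl
  | succ t ih =>
    rw [sampleCount_succ] at hn
    simp only [stack]
    split_ifs at hn ⊢
    · rw [ih (by omega), Function.update_comm (by omega)]
    · exact ih hn

lemma sampleCount_mono (θ : ℕ → Fin K) (k : Fin K) : Monotone (sampleCount θ k) := fun _ _ h =>
  Finset.card_le_card (Finset.filter_subset_filter _ (Finset.range_subset_range.2 h))

lemma sampleCount_le (θ : ℕ → Fin K) (k : Fin K) (t : ℕ) : sampleCount θ k t ≤ t :=
  (Finset.card_filter_le _ _).trans (Finset.card_range t).le

lemma stack_apply_of_lt (k : Fin K) (θ : ℕ → Fin K) (z ξ : ℕ → X) {t u j : ℕ} (htu : t ≤ u)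
    (hj : j < sampleCount θ k t) : stack k θ z ξ u j = stack k θ z ξ t j := by
  induction u, htu using Nat.le_induction with
  | base => rfl
  | succ u htu ih =>
    rw [stack, ← ih]
    split_ifs
    · exact Function.update_of_ne (hj.trans_le (sampleCount_mono θ k htu)).ne _ _
    · rfl

lemma sum_stack (k : Fin K) (θ : ℕ → Fin K) (z ξ : ℕ → X) {t u : ℕ} (htu : t ≤ u) (g : X → ℝ) :
    ∑ j ∈ Finset.range (sampleCount θ k t), g (stack k θ z ξ u j) =
      ∑ s ∈ (Finset.range t).filter (fun s => θ s = k), g (z s) := by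
  induction t with
  | zero => simp [sampleCount]
  | succ t ih =>
    rw [Finset.range_add_one, Finset.filter_insert, sampleCount_succ]
    split_ifs with hk
    · have hlast : stack k θ z ξ u (sampleCount θ k t) = z t := by
        rw [stack_apply_of_lt k θ z ξ htu (by simp [sampleCount_succ, hk]), stack, if_pos hk,
          Function.update_self]
      rw [Finset.sum_insert (by simp), Finset.sum_range_succ, ih (by omega), hlast, add_comm]
    · exact ih (by omega)

variable [MeasurableSpace X]

lemma map_update_infinitePi (D : Measure X) [IsProbabilityMeasure D] (n : ℕ) :
    ((Measure.infinitePi fun _ : ℕ => D).prod D).map (fun u => Function.update u.1 n u.2) =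
      Measure.infinitePi fun _ : ℕ => D := by
  refine Measure.eq_infinitePi _ fun s t ht => ?_
  have hpre : (fun u : (ℕ → X) × X => Function.update u.1 n u.2) ⁻¹' Set.pi s t =
      Set.pi (s.erase n) t ×ˢ (if n ∈ s then t n else Set.univ) := by
    ext ⟨ξ, x⟩
    simp only [Set.mem_preimage, Set.mem_pi, Set.mem_prod, Finset.mem_coe, Finset.mem_erase]
    refine ⟨fun h => ⟨fun i hi => by simpa [hi.1] using h i hi.2, ?_⟩, fun h i hi => ?_⟩
    · split_ifs with hn
      · simpa using h n hn
      · trivial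
    · obtain rfl | hin := eq_or_ne i n
      · simpa [hi] using h.2
      · simpa [hin] using h.1 i ⟨hin, hi⟩
  rw [Measure.map_apply (by fun_prop) (.pi s.countable_toSet fun i _ => ht i), hpre,
    Measure.prod_prod, Measure.infinitePi_pi _ fun i _ => ht i]
  split_ifs with hn
  · exact Finset.prod_erase_mul s (fun i => D (t i)) hn
  · rw [measure_univ, mul_one, Finset.erase_eq_of_notMem hn]

lemma lintegral_lintegral_update (D : Measure X) [IsProbabilityMeasure D] (n : ℕ)
    {F : (ℕ → X) → ENNReal} (hF : Measurable F) :
    ∫⁻ ξ, ∫⁻ x, F (Function.update ξ n x) ∂D ∂(Measure.infinitePi fun _ => D) =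
      ∫⁻ ξ, F ξ ∂(Measure.infinitePi fun _ => D) := by
  have hupd : Measurable fun u : (ℕ → X) × X => Function.update u.1 n u.2 := by fun_prop
  rw [← map_update_infinitePi D n, lintegral_map hF hupd, map_update_infinitePi D n,
    lintegral_prod (fun u => F (Function.update u.1 n u.2)) (hF.comp hupd).aemeasurable]

variable {Ω : Type*} {θ : ℕ → Ω → Fin K} {Z : ℕ → Ω → X}

lemma measurable_sampleCount {_ : MeasurableSpace Ω} (k : Fin K) {t : ℕ}
    (hθ : ∀ s < t, Measurable (θ s)) : Measurable fun ω => sampleCount (fun s => θ s ω) k t := by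
  induction t with
  | zero => simp [sampleCount]
  | succ t ih =>
    simp_rw [sampleCount_succ]
    exact (ih fun s hs => hθ s (by omega)).add (Measurable.ite
      (hθ t (by omega) (measurableSet_singleton k)) measurable_const measurable_const)

lemma measurable_update_uncurry :
    Measurable fun u : ((ℕ → X) × ℕ) × X => Function.update u.1.1 u.1.2 u.2 := by
  refine measurable_pi_iff.2 fun j => ?_
  simp only [Function.update_apply]
  exact Measurable.ite (measurableSet_eq_fun measurable_const (by fun_prop)) (by fun_prop)
    (by fun_prop)

lemma measurable_stack {_ : MeasurableSpace Ω} (k : Fin K) {t : ℕ} (hθ : ∀ s < t, Measurable (θ s))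
    (hZ : ∀ s < t, Measurable (Z s)) :
    Measurable fun u : Ω × (ℕ → X) => stack k (fun s => θ s u.1) (fun s => Z s u.1) u.2 t := by
  induction t with
  | zero => exact measurable_snd
  | succ t ih =>
    have ih := ih (fun s hs => hθ s (by omega)) fun s hs => hZ s (by omega)
    have hN := (measurable_sampleCount k (t := t) fun s hs => hθ s (by omega)).comp
      (measurable_fst : Measurable (Prod.fst : Ω × (ℕ → X) → Ω))
    simp only [stack]
    exact Measurable.ite ((hθ t (by omega)).comp measurable_fst (measurableSet_singleton k))
      (measurable_update_uncurry.comp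
        ((ih.prodMk hN).prodMk ((hZ t (by omega)).comp measurable_fst))) ih

lemma measurable_stack_apply {_ : MeasurableSpace Ω} (k : Fin K) {t : ℕ}
    (hθ : ∀ s < t, Measurable (θ s)) (hZ : ∀ s < t, Measurable (Z s)) (ξ : ℕ → X) :
    Measurable fun ω => stack k (fun s => θ s ω) (fun s => Z s ω) ξ t :=
  (measurable_stack k hθ hZ).comp measurable_prodMk_right

end Stack

section Sampling

variable {Ω X : Type*} {mΩ : MeasurableSpace Ω} [MeasurableSpace X] {P : Measure Ω}
  [IsProbabilityMeasure P] {ℱ : Filtration ℕ mΩ} {D : Measure X} [IsProbabilityMeasure D]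
  {θ : ℕ → Ω → Fin K} {Z : ℕ → Ω → X} {k : Fin K} {T : ℕ}

lemma setLIntegral_stack_succ {t : ℕ} (hθ : ∀ s ≤ t, Measurable[ℱ (s + 1)] (θ s))
    (hZ : ∀ s ≤ t, Measurable[ℱ (s + 1)] (Z s))
    (hobs : ∀ E, MeasurableSet[ℱ t] E → ∀ S, MeasurableSet S →
      P (E ∩ {ω | θ t ω = k} ∩ {ω | Z t ω ∈ S}) = P (E ∩ {ω | θ t ω = k}) * D S)
    {F : (ℕ → X) → ENNReal} (hF : Measurable F) :
    ∫⁻ ω in {ω | θ t ω = k}, ∫⁻ ξ, F (stack k (fun s => θ s ω) (fun s => Z s ω) ξ (t + 1))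
        ∂(Measure.infinitePi fun _ => D) ∂P =
      ∫⁻ ω in {ω | θ t ω = k}, ∫⁻ ξ, F (stack k (fun s => θ s ω) (fun s => Z s ω) ξ t)
        ∂(Measure.infinitePi fun _ => D) ∂P := by
  set ν := Measure.infinitePi fun _ : ℕ => D
  set N : Ω → ℕ := fun ω => sampleCount (fun s => θ s ω) k t
  set S : Ω → (ℕ → X) → ℕ → X := fun ω ξ => stack k (fun s => θ s ω) (fun s => Z s ω) ξ t
  have hθt : ∀ s < t, Measurable[ℱ t] (θ s) := fun s hs =>
    (hθ s hs.le).mono (ℱ.mono hs) le_rfl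
  have hZt : ∀ s < t, Measurable[ℱ t] (Z s) := fun s hs =>
    (hZ s hs.le).mono (ℱ.mono hs) le_rfl
  have hA : MeasurableSet {ω | θ t ω = k} :=
    ((hθ t le_rfl).mono (ℱ.le _) le_rfl) (measurableSet_singleton k)
  have hZm : Measurable (Z t) := (hZ t le_rfl).mono (ℱ.le _) le_rfl
  have hN : Measurable[ℱ t] N := measurable_sampleCount k hθt
  have hNm : Measurable N := hN.mono (ℱ.le t) le_rfl
  have hS : ∀ ξ, Measurable[ℱ t] fun ω => S ω ξ := fun ξ =>
    measurable_stack_apply k hθt hZt ξ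
  have hSm : Measurable fun u : Ω × (ℕ → X) => S u.1 u.2 :=
    measurable_stack k (fun s hs => (hθt s hs).mono (ℱ.le t) le_rfl)
      fun s hs => (hZt s hs).mono (ℱ.le t) le_rfl
  have hF₂ := hF.comp (measurable_update_uncurry (X := X))
  calc
    _ = ∫⁻ ω in {ω | θ t ω = k}, ∫⁻ ξ, F (Function.update (S ω ξ) (N ω) (Z t ω)) ∂ν ∂P :=
      setLIntegral_congr_fun hA fun ω hω => by
        simp only [stack, if_pos (show θ t ω = k from hω), S, N]
    _ = ∫⁻ ξ, ∫⁻ ω in {ω | θ t ω = k}, F (Function.update (S ω ξ) (N ω) (Z t ω)) ∂P ∂ν :=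
      lintegral_lintegral_swap (hF₂.comp ((hSm.prodMk (hNm.comp measurable_fst)).prodMk
        (hZm.comp measurable_fst))).aemeasurable
    _ = ∫⁻ ξ, ∫⁻ ω in {ω | θ t ω = k}, ∫⁻ x, F (Function.update (S ω ξ) (N ω) x) ∂D ∂P ∂ν :=
      lintegral_congr fun ξ => setLIntegral_condition (φ := fun ω => (S ω ξ, N ω))
        (((hS ξ).prodMk hN).mono (ℱ.le t) le_rfl) hZm
        (fun E hE => hobs _ (((hS ξ).prodMk hN) hE)) hF₂
    _ = ∫⁻ ω in {ω | θ t ω = k}, ∫⁻ ξ, ∫⁻ x, F (S ω (Function.update ξ (N ω) x)) ∂D ∂ν ∂P := by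
      rw [lintegral_lintegral_swap]
      · simp only [S, N, stack_update _ _ _ _ _ _ _ le_rfl]
      · have h : Measurable fun u : ((ℕ → X) × Ω) × X =>
            F (Function.update (S u.1.2 u.1.1) (N u.1.2) u.2) := by
          refine hF₂.comp (((hSm.comp measurable_swap).prodMk (hNm.comp measurable_snd)).comp
            measurable_fst |>.prodMk measurable_snd)
        exact h.lintegral_prod_right'.aemeasurable
    _ = ∫⁻ ω in {ω | θ t ω = k}, ∫⁻ ξ, F (S ω ξ) ∂ν ∂P := lintegral_congr fun ω =>
      lintegral_lintegral_update D (N ω) (hF.comp (hSm.comp measurable_prodMk_left))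

theorem lintegral_lintegral_stack (hθ : ∀ t < T, Measurable[ℱ (t + 1)] (θ t))
    (hZ : ∀ t < T, Measurable[ℱ (t + 1)] (Z t))
    (hobs : ∀ t < T, ∀ E, MeasurableSet[ℱ t] E → ∀ S, MeasurableSet S →
      P (E ∩ {ω | θ t ω = k} ∩ {ω | Z t ω ∈ S}) = P (E ∩ {ω | θ t ω = k}) * D S)
    {F : (ℕ → X) → ENNReal} (hF : Measurable F) :
    ∫⁻ ω, ∫⁻ ξ, F (stack k (fun s => θ s ω) (fun s => Z s ω) ξ T)
        ∂(Measure.infinitePi fun _ => D) ∂P =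
      ∫⁻ ξ, F ξ ∂(Measure.infinitePi fun _ => D) := by
  induction T with
  | zero => simp [stack]
  | succ t ih =>
    have hA : MeasurableSet {ω | θ t ω = k} :=
      ((hθ t (by omega)).mono (ℱ.le _) le_rfl) (measurableSet_singleton k)
    have ih := ih (fun s hs => hθ s (by omega)) (fun s hs => hZ s (by omega))
      fun s hs => hobs s (by omega)
    rw [← lintegral_add_compl _ hA, setLIntegral_stack_succ (fun s hs => hθ s (by omega))
      (fun s hs => hZ s (by omega)) (hobs t (by omega)) hF, ← ih]
    refine Eq.trans ?_ (lintegral_add_compl _ hA)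
    congr 1
    refine setLIntegral_congr_fun hA.compl fun ω hω => ?_
    simp only [stack, if_neg (show ¬ θ t ω = k from hω)]

theorem measure_exists_sqrt_mul_lt_abs_sum_sampled_le {Q : Type*} [Countable Q] {f : Q → X → ℝ}
    (hθ : ∀ t < T, Measurable[ℱ (t + 1)] (θ t)) (hZ : ∀ t < T, Measurable[ℱ (t + 1)] (Z t))
    (hobs : ∀ t < T, ∀ E, MeasurableSet[ℱ t] E → ∀ S, MeasurableSet S →
      P (E ∩ {ω | θ t ω = k} ∩ {ω | Z t ω ∈ S}) = P (E ∩ {ω | θ t ω = k}) * D S)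
    (hm : ∀ q, Measurable (f q)) (hf : ∀ q x, f q x ∈ Set.Icc (0 : ℝ) 1) {N : ℕ}
    (hN : ∀ n ≤ T, ∀ x : Finset.range n ⊕ Finset.range n → X,
      (Set.range fun q j => f q (x j)).encard ≤ N) {U : ℝ} (hU : 0 ≤ U) :
    P {ω | ∃ t ≤ T, ∃ q, √(sampleCount (fun s => θ s ω) k t) * U <
      |∑ s ∈ (Finset.range t).filter fun s => θ s ω = k, (f q (Z s ω) - ∫ z, f q z ∂D)|} ≤
      ENNReal.ofReal (T * (2 * N * Real.exp (-U ^ 2 / 2))) := by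
  set ν := Measure.infinitePi fun _ : ℕ => D
  set B : Set (ℕ → X) := {ξ | ∃ n ≤ T, ∃ q, √n * U <
    |∑ j ∈ Finset.range n, (f q (ξ j) - ∫ z, f q z ∂D)|} with hB
  have hBm : MeasurableSet B := by
    rw [show B = ⋃ n ≤ T, {ξ | ∃ q, √n * U <
      |∑ j ∈ Finset.range n, (f q (ξ j) - ∫ z, f q z ∂D)|} by ext; simp [hB]]
    exact .biUnion (Set.to_countable _) fun n _ =>
      measurableSet_exists_lt_abs_sum_sub_integral D hm measurable_pi_apply _ _
  have hind : Measurable (B.indicator 1 : (ℕ → X) → ENNReal) := measurable_one.indicator hBm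
  have hstack : Measurable fun u : Ω × (ℕ → X) =>
      stack k (fun s => θ s u.1) (fun s => Z s u.1) u.2 T :=
    measurable_stack k (fun s hs => (hθ s hs).mono (ℱ.le _) le_rfl)
      fun s hs => (hZ s hs).mono (ℱ.le _) le_rfl
  calc
    _ ≤ ∫⁻ ω, ∫⁻ ξ, B.indicator 1 (stack k (fun s => θ s ω) (fun s => Z s ω) ξ T) ∂ν ∂P := by
      refine meas_le_lintegral₀ (hind.comp hstack).lintegral_prod_right'.aemeasurable ?_
      rintro ω ⟨t, ht, q, hq⟩
      have hmem : ∀ ξ, stack k (fun s => θ s ω) (fun s => Z s ω) ξ T ∈ B := fun ξ =>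
        ⟨_, (sampleCount_le _ k t).trans ht, q, by
          rwa [sum_stack k _ _ ξ ht fun z => f q z - ∫ z, f q z ∂D]⟩
      simp [Set.indicator_of_mem (hmem _)]
    _ = ν B := by
      rw [lintegral_lintegral_stack hθ hZ hobs hind, lintegral_indicator_one hBm]
    _ ≤ _ := measure_infinitePi_exists_le_sqrt_mul_lt_abs_sum_sub_integral_le D hm hf hN hU

end Sampling

/-! ### Requests accepted at a price -/

lemma encard_range_indicator_le {X ι κ E : Type*} [Fintype ι] [AddCommGroup E] [Module ℝ E]
    [FiniteDimensional ℝ E] {H : κ → Set X} {φ : X → E} {g : X → ℝ}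
    (hH : ∀ q, ∃ ℓ : Module.Dual ℝ E, ∀ x, x ∈ H q ↔ ℓ (φ x) < g x) (f : X → ℝ) (x : ι → X) :
    (Set.range fun q j => (H q).indicator f (x j)).encard ≤
      ((Fintype.card ι + 1) ^ Module.finrank ℝ E : ℕ) := by
  classical
  set 𝒜 : Finset (Finset ι) := {A | ∃ q, ∀ j, j ∈ A ↔ x j ∈ H q}
  have hsub : (Set.range fun q j => (H q).indicator f (x j)) ⊆
      𝒜.image fun A j => if j ∈ A then f (x j) else 0 := by
    rintro _ ⟨q, rfl⟩
    refine Finset.mem_coe.2 (Finset.mem_image.2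
      ⟨(Finset.univ.filter fun j => x j ∈ H q : Finset ι), ?_, ?_⟩)
    · exact Finset.mem_filter.2 ⟨Finset.mem_univ _, q, by simp⟩
    · ext j
      simp [Set.indicator_apply]
  refine (Set.encard_le_encard hsub).trans ?_
  rw [Set.encard_coe_eq_coe_finsetCard, Nat.cast_le]
  refine Finset.card_image_le.trans
    (card_le_pow_finrank_of_forall_exists_dual_lt (φ := φ ∘ x) (g := g ∘ x) fun A hA => ?_)
  obtain ⟨q, hq⟩ := (Finset.mem_filter.1 hA).2
  obtain ⟨ℓ, hℓ⟩ := hH q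
  exact ⟨ℓ, fun j => (hq j).trans (hℓ (x j))⟩

/-- The requests that are still accepted at the price `q.1` when their reward is lowered
by `q.2`. -/
def halfspace (q : (Fin d → ℝ) × ℝ) : Set (Request d) := {z | q.1 ⬝ᵥ z.2 + q.2 < z.1}

/-- The contribution `f z` of the request `z`, counted only on `halfspace q`. The rewards and
the resource consumptions at the price `p` are the scores of `Prod.fst` and of `fun z => z.2 i`
with `q = (p, 0)`. -/
def scored (f : Request d → ℝ) (q : (Fin d → ℝ) × ℝ) : Request d → ℝ := (halfspace q).indicator f

lemma measurable_dotProduct_snd (p : Fin d → ℝ) : Measurable fun z : Request d => p ⬝ᵥ z.2 := by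
  unfold dotProduct
  fun_prop

lemma measurableSet_halfspace (q : (Fin d → ℝ) × ℝ) : MeasurableSet (halfspace q) :=
  measurableSet_lt ((measurable_dotProduct_snd q.1).add_const _) measurable_fst

section Scored

variable {f g : Request d → ℝ}

lemma measurable_scored (hf : Measurable f) (q : (Fin d → ℝ) × ℝ) : Measurable (scored f q) :=
  hf.indicator (measurableSet_halfspace q)

lemma abs_scored_le (f : Request d → ℝ) (q : (Fin d → ℝ) × ℝ) (z : Request d) :
    |scored f q z| ≤ |f z| :=
  norm_indicator_le_norm_self f z

lemma scored_mem_Icc {c : ℝ} {z : Request d} (hf : f z ∈ Set.Icc 0 c) (q : (Fin d → ℝ) × ℝ) :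
    scored f q z ∈ Set.Icc 0 c :=
  ⟨Set.indicator_apply_nonneg fun _ => hf.1,
    Set.indicator_apply_le' (fun _ => hf.2) fun _ => hf.1.trans hf.2⟩

lemma scored_eq_mul_scored {c : ℝ} {z : Request d} (h : f z = c * g z) (q : (Fin d → ℝ) × ℝ) :
    scored f q z = c * scored g q z := by
  by_cases hz : z ∈ halfspace q <;> simp [scored, hz, h]

lemma encard_range_scored_le {ι κ : Type*} [Fintype ι] (f : Request d → ℝ)
    (q : κ → (Fin d → ℝ) × ℝ) (x : ι → Request d) :
    (Set.range fun m j => scored f (q m) (x j)).encard ≤ ((Fintype.card ι + 1) ^ (d + 1) : ℕ) := by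
  have hdim : Module.finrank ℝ ((Fin d → ℝ) × ℝ) = d + 1 := by simp
  rw [← hdim]
  refine encard_range_indicator_le (φ := fun z => (z.2, (1 : ℝ))) (g := Prod.fst)
    (fun m => ⟨(dotProductBilin ℝ ℝ (q m).1).coprod ((q m).2 • .id), fun z => ?_⟩) f x
  simp [halfspace]

/-- Rational parameters, cast to the reals: they index a countable family of halfspaces. -/
def ratParam (r : (Fin d → ℚ) × ℚ) : (Fin d → ℝ) × ℝ := (fun i => r.1 i, r.2)

-- The rational parameters decrease strictly, so that the open halfspaces increase to `halfspace q`.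
lemma exists_seq_scored_ratParam_eq (q : (Fin d → ℝ) × ℝ) : ∃ r : ℕ → (Fin d → ℚ) × ℚ,
    ∀ (f : Request d → ℝ) (z : Request d), 0 ≤ z.2 →
      ∀ᶠ n in Filter.atTop, scored f (ratParam (r n)) z = scored f q z := by
  choose u _ hlt hu using fun x : ℝ => Real.exists_seq_rat_strictAnti_tendsto x
  refine ⟨fun n => (fun i => u (q.1 i) n, u q.2 n), fun f z hz => ?_⟩
  by_cases hzq : z ∈ halfspace q
  · have hlim : Filter.Tendsto (fun n => (fun i => (u (q.1 i) n : ℝ)) ⬝ᵥ z.2 + u q.2 n)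
        Filter.atTop (nhds (q.1 ⬝ᵥ z.2 + q.2)) :=
      (tendsto_finsetSum _ fun i _ => (hu _).mul_const _).add (hu _)
    filter_upwards [hlim.eventually_lt_const hzq] with n hn
    simp [scored, hzq, show z ∈ halfspace (ratParam (fun i => u (q.1 i) n, u q.2 n)) from hn]
  · refine .of_forall fun n => ?_
    have hle : q.1 ⬝ᵥ z.2 + q.2 ≤ (fun i => (u (q.1 i) n : ℝ)) ⬝ᵥ z.2 + u q.2 n :=
      add_le_add (dotProduct_le_dotProduct_of_nonneg_right (fun i => (hlt _ n).le) hz) (hlt _ n).le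
    have hn : z ∉ halfspace (ratParam (fun i => u (q.1 i) n, u q.2 n)) := fun hn =>
      hzq (hle.trans_lt hn)
    simp [scored, hzq, hn]

lemma abs_sum_scored_sub_integral_le_of_ratParam {κ : Type*} {D : Measure (Request d)}
    (hm : Measurable f) (hf : Integrable f D) (hD : ∀ᵐ z ∂D, 0 ≤ z.2) {s : Finset κ}
    {x : κ → Request d} (hx : ∀ j ∈ s, 0 ≤ (x j).2) {c : ℝ}
    (hc : ∀ r, |∑ j ∈ s, (scored f (ratParam r) (x j) - ∫ z, scored f (ratParam r) z ∂D)| ≤ c)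
    (q : (Fin d → ℝ) × ℝ) :
    |∑ j ∈ s, (scored f q (x j) - ∫ z, scored f q z ∂D)| ≤ c := by
  obtain ⟨r, hr⟩ := exists_seq_scored_ratParam_eq q
  have hlim : ∀ z : Request d, 0 ≤ z.2 →
      Filter.Tendsto (fun n => scored f (ratParam (r n)) z) Filter.atTop (nhds (scored f q z)) :=
    fun z hz => tendsto_const_nhds.congr' ((hr f z hz).mono fun _ h => h.symm)
  have hint : Filter.Tendsto (fun n => ∫ z, scored f (ratParam (r n)) z ∂D) Filter.atTop
      (nhds (∫ z, scored f q z ∂D)) :=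
    tendsto_integral_of_dominated_convergence (fun z => |f z|)
      (fun n => (measurable_scored hm _).aestronglyMeasurable) hf.abs
      (fun n => .of_forall fun z => abs_scored_le f _ z) (hD.mono hlim)
  exact le_of_tendsto' (tendsto_finsetSum _ fun j hj => (hlim _ (hx j hj)).sub hint).abs
    fun n => hc (r n)

end Scored

/-! ### Sample means along a history -/

/-- The mean of `f` over the observations made under configuration `k` before round `t`; it is `0`
when there are none. -/
def sampleMean {X : Type*} (θ : ℕ → Fin K) (z : ℕ → X) (k : Fin K) (t : ℕ) (f : X → ℝ) : ℝ :=
  (1 / max (sampleCount θ k t : ℝ) 1) *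
    ∑ s ∈ (Finset.range t).filter (fun s => θ s = k), f (z s)

/-- The scale `U / √n` of the deviation of a mean of `n` observations; with no observation
it is `U`. -/
def devRadius (U : ℝ) (n : ℕ) : ℝ := U / √(max (n : ℝ) 1)

section SampleMean

variable {X : Type*} {θ : ℕ → Fin K} {z : ℕ → X} {k : Fin K} {t : ℕ} {f g : X → ℝ}

lemma sampleMean_add (f g : X → ℝ) :
    sampleMean θ z k t (fun x => f x + g x) = sampleMean θ z k t f + sampleMean θ z k t g := by
  unfold sampleMean
  rw [Finset.sum_add_distrib, mul_add]

lemma sampleMean_mul_left (c : ℝ) (f : X → ℝ) :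
    sampleMean θ z k t (fun x => c * f x) = c * sampleMean θ z k t f := by
  unfold sampleMean
  rw [← Finset.mul_sum, mul_left_comm]

lemma sampleMean_mono (h : ∀ s < t, θ s = k → f (z s) ≤ g (z s)) :
    sampleMean θ z k t f ≤ sampleMean θ z k t g := by
  unfold sampleMean
  gcongr with s hs
  obtain ⟨hs, hk⟩ := Finset.mem_filter.1 hs
  exact h s (Finset.mem_range.1 hs) hk

lemma sampleMean_congr (h : ∀ s < t, θ s = k → f (z s) = g (z s)) :
    sampleMean θ z k t f = sampleMean θ z k t g :=
  le_antisymm (sampleMean_mono fun s hs hk => (h s hs hk).le)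
    (sampleMean_mono fun s hs hk => (h s hs hk).ge)

lemma abs_sampleMean_sub_le_devRadius {m U : ℝ} (hm : |m| ≤ 1) (hU : 1 ≤ U)
    (h : |∑ s ∈ (Finset.range t).filter fun s => θ s = k, (f (z s) - m)| ≤
      √(sampleCount θ k t) * U) :
    |sampleMean θ z k t f - m| ≤ devRadius U (sampleCount θ k t) := by
  obtain h0 | hpos := (sampleCount θ k t).eq_zero_or_pos
  · have hempty : (Finset.range t).filter (fun s => θ s = k) = ∅ := Finset.card_eq_zero.1 h0
    simpa [sampleMean, devRadius, hempty, h0] using hm.trans hU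
  · have hN : (1 : ℝ) ≤ sampleCount θ k t := by exact_mod_cast hpos
    have hN₀ : (0 : ℝ) < sampleCount θ k t := by linarith
    have hmean : sampleMean θ z k t f - m =
        (∑ s ∈ (Finset.range t).filter (fun s => θ s = k), (f (z s) - m)) / sampleCount θ k t := by
      rw [sampleMean, max_eq_left hN, Finset.sum_sub_distrib, Finset.sum_const, nsmul_eq_mul,
        ← sampleCount]
      field_simp
    rw [hmean, abs_div, abs_of_pos hN₀, devRadius, max_eq_left hN,
      div_le_div_iff₀ hN₀ (Real.sqrt_pos.2 hN₀)]
    calc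
      _ ≤ √(sampleCount θ k t) * U * √(sampleCount θ k t) := by gcongr
      _ = U * sampleCount θ k t := by rw [mul_right_comm, Real.mul_self_sqrt hN₀.le, mul_comm]

end SampleMean

section SampledRequests

variable {Ω : Type*} {mΩ : MeasurableSpace Ω} {P : Measure Ω} {ℱ : Filtration ℕ mΩ}
  {θ : ℕ → Ω → Fin K} {k : Fin K} {T : ℕ}

lemma ae_forall_sampled_of_ae {X : Type*} [MeasurableSpace X] {D : Measure X} {Z : ℕ → Ω → X}
    (hobs : ∀ t < T, ∀ E, MeasurableSet[ℱ t] E → ∀ S, MeasurableSet S →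
      P (E ∩ {ω | θ t ω = k} ∩ {ω | Z t ω ∈ S}) = P (E ∩ {ω | θ t ω = k}) * D S)
    {p : X → Prop} (hp : ∀ᵐ z ∂D, p z) : ∀ᵐ ω ∂P, ∀ t < T, θ t ω = k → p (Z t ω) := by
  refine ae_all_iff.2 fun t => ?_
  by_cases ht : t < T
  · have h := hobs t ht Set.univ .univ _ (measurableSet_toMeasurable D {z | ¬ p z})
    rw [measure_toMeasurable, ae_iff.1 hp, mul_zero, Set.univ_inter] at h
    filter_upwards [measure_eq_zero_iff_ae_notMem.1 h] with ω hω _ hk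
    by_contra hpz
    exact hω ⟨hk, subset_toMeasurable D _ hpz⟩
  · exact .of_forall fun ω h => absurd h ht

variable [IsProbabilityMeasure P] {D : Measure (Request d)} [IsProbabilityMeasure D]
  {Z : ℕ → Ω → Request d} {f : Request d → ℝ}

lemma measure_exists_sqrt_mul_lt_abs_sum_scored_le
    (hθ : ∀ t < T, Measurable[ℱ (t + 1)] (θ t)) (hZ : ∀ t < T, Measurable[ℱ (t + 1)] (Z t))
    (hobs : ∀ t < T, ∀ E, MeasurableSet[ℱ t] E → ∀ S, MeasurableSet S →
      P (E ∩ {ω | θ t ω = k} ∩ {ω | Z t ω ∈ S}) = P (E ∩ {ω | θ t ω = k}) * D S)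
    (hm : Measurable f) (hf : ∀ z, f z ∈ Set.Icc (0 : ℝ) 1) (hD : ∀ᵐ z ∂D, 0 ≤ z.2) {U : ℝ}
    (hU : 0 ≤ U) :
    P {ω | ∃ t ≤ T, ∃ q, √(sampleCount (fun s => θ s ω) k t) * U <
      |∑ s ∈ (Finset.range t).filter fun s => θ s ω = k,
        (scored f q (Z s ω) - ∫ z, scored f q z ∂D)|} ≤
      ENNReal.ofReal (T * (2 * (2 * T + 1) ^ (d + 1) * Real.exp (-U ^ 2 / 2))) := by
  have hN : ∀ n ≤ T, ∀ x : Finset.range n ⊕ Finset.range n → Request d,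
      (Set.range fun r j => scored f (ratParam r) (x j)).encard ≤ ((2 * T + 1) ^ (d + 1) : ℕ) :=
    fun n hn x => (encard_range_scored_le f ratParam x).trans (by
      rw [Nat.cast_le, Fintype.card_sum, Fintype.card_coe, Finset.card_range]
      exact Nat.pow_le_pow_left (by omega) _)
  have hrat := measure_exists_sqrt_mul_lt_abs_sum_sampled_le hθ hZ hobs
    (fun r => measurable_scored hm (ratParam r)) (fun r z => scored_mem_Icc (hf z) (ratParam r))
    hN hU
  push_cast at hrat
  refine (measure_mono_ae ?_).trans hrat
  filter_upwards [ae_forall_sampled_of_ae hobs hD] with ω hω ⟨t, ht, q, hq⟩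
  by_contra hnot
  refine hq.not_ge (abs_sum_scored_sub_integral_le_of_ratParam hm
    (.of_mem_Icc 0 1 hm.aemeasurable (.of_forall hf)) hD (fun s hs => ?_) (fun r => ?_) q)
  · obtain ⟨hs, hk⟩ := Finset.mem_filter.1 hs
    exact hω s ((Finset.mem_range.1 hs).trans_le ht) hk
  · exact not_lt.1 fun h => hnot ⟨t, ht, r, h⟩

theorem measure_exists_mul_devRadius_lt_abs_sampleMean_sub_le
    (hθ : ∀ t < T, Measurable[ℱ (t + 1)] (θ t)) (hZ : ∀ t < T, Measurable[ℱ (t + 1)] (Z t))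
    (hobs : ∀ t < T, ∀ E, MeasurableSet[ℱ t] E → ∀ S, MeasurableSet S →
      P (E ∩ {ω | θ t ω = k} ∩ {ω | Z t ω ∈ S}) = P (E ∩ {ω | θ t ω = k}) * D S)
    (hm : Measurable f) {c : ℝ} (hc : 0 < c) (hf : ∀ᵐ z ∂D, f z ∈ Set.Icc 0 c)
    (hD : ∀ᵐ z ∂D, 0 ≤ z.2) {U : ℝ} (hU : 1 ≤ U) :
    P {ω | ∃ t ≤ T, ∃ q, c * devRadius U (sampleCount (fun s => θ s ω) k t) <
      |sampleMean (fun s => θ s ω) (fun s => Z s ω) k t (scored f q) - ∫ z, scored f q z ∂D|} ≤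
      ENNReal.ofReal (T * (2 * (2 * T + 1) ^ (d + 1) * Real.exp (-U ^ 2 / 2))) := by
  set g : Request d → ℝ := fun z => Set.projIcc 0 1 zero_le_one (f z / c)
  have hg : ∀ z, f z ∈ Set.Icc 0 c → f z = c * g z := fun z hz => by
    simp only [g, Set.projIcc_of_mem zero_le_one
      (show f z / c ∈ Set.Icc 0 1 from ⟨div_nonneg hz.1 hc.le, (div_le_one hc).2 hz.2⟩)]
    rw [mul_div_cancel₀ _ hc.ne']
  have hg01 : ∀ z, g z ∈ Set.Icc (0 : ℝ) 1 := fun z => Subtype.coe_prop _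
  have hgm : Measurable g := measurable_subtype_coe.comp
    (continuous_projIcc.measurable.comp (hm.div_const c))
  refine (measure_mono_ae ?_).trans
    (measure_exists_sqrt_mul_lt_abs_sum_scored_le hθ hZ hobs hgm hg01 hD (by linarith))
  filter_upwards [ae_forall_sampled_of_ae hobs hf] with ω hω ⟨t, ht, q, hq⟩
  refine ⟨t, ht, q, not_le.1 fun hle => hq.not_ge ?_⟩
  have hmean : |∫ z, scored g q z ∂D| ≤ 1 := by
    simpa using norm_integral_le_of_norm_le_const (μ := D) (f := scored g q) (C := 1)
      (.of_forall fun z => by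
        have h := scored_mem_Icc (hg01 z) q
        rw [Real.norm_of_nonneg h.1]
        exact h.2)
  have hint : ∫ z, scored f q z ∂D = c * ∫ z, scored g q z ∂D := by
    rw [← integral_const_mul]
    exact integral_congr_ae (hf.mono fun z hz => scored_eq_mul_scored (hg z hz) q)
  rw [sampleMean_congr (g := fun z => c * scored g q z) fun s hs hk =>
      scored_eq_mul_scored (hg _ (hω s (hs.trans_le ht) hk)) q,
    sampleMean_mul_left, hint, ← mul_sub, abs_mul, abs_of_pos hc]
  exact mul_le_mul_of_nonneg_left (abs_sampleMean_sub_le_devRadius hmean hU hle) hc.le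

end SampledRequests

/-! ### Bounded requests and continuous valuations -/

section Environment

variable {D : Measure (Request d)} {Rmax Amax : ℝ}

/-- A request that satisfies the bounds of `BoundedRequests`. -/
def BoundedRequest (Rmax Amax : ℝ) (z : Request d) : Prop :=
  0 ≤ z.1 ∧ z.1 ≤ Rmax ∧ 0 ≤ z.2 ∧ ‖z.2‖ ≤ Amax

lemma BoundedRequest.fst_mem_Icc {z : Request d} (hz : BoundedRequest Rmax Amax z) :
    z.1 ∈ Set.Icc 0 Rmax :=
  ⟨hz.1, hz.2.1⟩

lemma BoundedRequest.snd_mem_Icc {z : Request d} (hz : BoundedRequest Rmax Amax z) (i : Fin d) :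
    z.2 i ∈ Set.Icc 0 Amax :=
  ⟨hz.2.2.1 i, (le_abs_self _).trans ((norm_le_pi_norm z.2 i).trans hz.2.2.2)⟩

lemma BoundedRequests.ae_fst_mem_Icc (hD : BoundedRequests Rmax Amax D) :
    ∀ᵐ z ∂D, z.1 ∈ Set.Icc 0 Rmax :=
  hD.mono fun _ hz => BoundedRequest.fst_mem_Icc hz

lemma BoundedRequests.ae_snd_mem_Icc (hD : BoundedRequests Rmax Amax D) (i : Fin d) :
    ∀ᵐ z ∂D, z.2 i ∈ Set.Icc 0 Amax :=
  hD.mono fun _ hz => BoundedRequest.snd_mem_Icc hz i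

lemma BoundedRequests.integrable_fst [IsFiniteMeasure D] (hD : BoundedRequests Rmax Amax D) :
    Integrable Prod.fst D :=
  .of_mem_Icc 0 Rmax measurable_fst.aemeasurable hD.ae_fst_mem_Icc

lemma BoundedRequests.integrable_snd [IsFiniteMeasure D] (hD : BoundedRequests Rmax Amax D)
    (i : Fin d) : Integrable (fun z : Request d => z.2 i) D :=
  .of_mem_Icc 0 Amax (by fun_prop) (hD.ae_snd_mem_Icc i)

lemma ContinuousValuation.measure_fst_eq_dotProduct [IsFiniteMeasure D]
    (hD : ContinuousValuation D) (p : Fin d → ℝ) : D {z | z.1 = p ⬝ᵥ z.2} = 0 := by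
  have hset : MeasurableSet {u : (Fin d → ℝ) × ℝ | u.2 = p ⬝ᵥ u.1} := by
    refine measurableSet_eq_fun measurable_snd ?_
    unfold dotProduct
    fun_prop
  have hmap : D {z | z.1 = p ⬝ᵥ z.2} =
      D.map (fun z => (z.2, z.1)) {u : (Fin d → ℝ) × ℝ | u.2 = p ⬝ᵥ u.1} := by
    rw [Measure.map_apply (measurable_snd.prodMk measurable_fst) hset]
    rfl
  rw [hmap, ← compProd_map_condDistrib measurable_fst.aemeasurable, Measure.compProd_apply hset,
    lintegral_eq_zero_iff (Kernel.measurable_kernel_prodMk_left hset)]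
  filter_upwards [hD] with a ha using ha (p ⬝ᵥ a)

lemma continuousAt_scored {z : Request d} {p : Fin d → ℝ} (hz : z.1 ≠ p ⬝ᵥ z.2)
    (f : Request d → ℝ) : ContinuousAt (fun q => scored f (q, 0) z) p := by
  have hdot : ContinuousAt (fun q : Fin d → ℝ => q ⬝ᵥ z.2) p :=
    (continuous_id.dotProduct continuous_const).continuousAt
  rcases hz.lt_or_gt with h | h
  · refine continuousAt_const.congr (f := fun _ => 0) ?_
    filter_upwards [hdot.eventually_const_lt h] with q hq
    simp [scored, halfspace, hq.le]
  · refine continuousAt_const.congr (f := fun _ => f z) ?_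
    filter_upwards [hdot.eventually_lt_const h] with q hq
    simp [scored, halfspace, hq]

lemma ContinuousValuation.continuous_integral_scored [IsFiniteMeasure D]
    (hD : ContinuousValuation D) {f : Request d → ℝ} (hm : Measurable f) (hf : Integrable f D) :
    Continuous fun p => ∫ z, scored f (p, 0) z ∂D := by
  refine continuous_iff_continuousAt.2 fun p => continuousAt_of_dominated
    (.of_forall fun q => (measurable_scored hm _).aestronglyMeasurable)
    (.of_forall fun q => .of_forall fun z => abs_scored_le f (q, 0) z) hf.abs ?_
  have hne : ∀ᵐ z ∂D, z.1 ≠ p ⬝ᵥ z.2 :=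
    measure_eq_zero_iff_ae_notMem.1 (hD.measure_fst_eq_dotProduct p)
  filter_upwards [hne] with z hz using continuousAt_scored hz f

end Environment

/-! ### The surplus and its empirical version -/

section Surplus

variable {Rmax Amax : ℝ} {θ : ℕ → Fin K} {z : ℕ → Request d} {k : Fin K} {t : ℕ} {p : Fin d → ℝ}

/-- The expected surplus of a configuration at the price `p`. -/
def surplus (D : Measure (Request d)) (p : Fin d → ℝ) : ℝ := ∫ z, max (z.1 - p ⬝ᵥ z.2) 0 ∂D

lemma surplus_nonneg (D : Measure (Request d)) (p : Fin d → ℝ) : 0 ≤ surplus D p :=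
  integral_nonneg fun _ => le_max_right _ _

lemma empSurplus_eq_sampleMean (θ : ℕ → Fin K) (z : ℕ → Request d) (k : Fin K) (t : ℕ)
    (p : Fin d → ℝ) :
    empSurplus θ z k t p = sampleMean θ z k t fun z => max (z.1 - p ⬝ᵥ z.2) 0 := rfl

lemma max_sub_dotProduct_eq_setIntegral {x : Request d} (hx : BoundedRequest Rmax Amax x)
    (hp : 0 ≤ p) :
    max (x.1 - p ⬝ᵥ x.2) 0 = ∫ s in Set.Ioc 0 Rmax, scored (fun _ => 1) (p, s) x := by
  have hscored : (fun s => scored (fun _ => (1 : ℝ)) (p, s) x) =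
      (Set.Iio (x.1 - p ⬝ᵥ x.2)).indicator 1 := by
    ext s
    simp only [scored, halfspace, Set.indicator_apply, Set.mem_ofPred_eq, Set.mem_Iio,
      Pi.one_apply, lt_sub_iff_add_lt, add_comm s]
  have hinter : Set.Iio (x.1 - p ⬝ᵥ x.2) ∩ Set.Ioc 0 Rmax = Set.Ioo 0 (x.1 - p ⬝ᵥ x.2) := by
    ext s
    have hle : x.1 - p ⬝ᵥ x.2 ≤ Rmax :=
      (sub_le_self _ (dotProduct_nonneg_of_nonneg hp hx.2.2.1)).trans hx.2.1
    exact ⟨fun h => ⟨h.2.1, h.1⟩, fun h => ⟨h.2, h.1, h.2.le.trans hle⟩⟩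
  rw [hscored, integral_indicator_one measurableSet_Iio,
    measureReal_restrict_apply measurableSet_Iio, hinter, Real.volume_real_Ioo, sub_zero]

lemma measurable_scored_one (p : Fin d → ℝ) :
    Measurable fun u : Request d × ℝ => scored (fun _ => (1 : ℝ)) (p, u.2) u.1 :=
  measurable_const.indicator (measurableSet_lt
    (((measurable_dotProduct_snd p).comp measurable_fst).add measurable_snd)
    measurable_fst.fst)

lemma norm_scored_one_le (q : (Fin d → ℝ) × ℝ) (x : Request d) :
    ‖scored (fun _ => (1 : ℝ)) q x‖ ≤ 1 :=
  (abs_scored_le _ q x).trans_eq abs_one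

lemma integrableOn_scored_one (p : Fin d → ℝ) (x : Request d) :
    IntegrableOn (fun s => scored (fun _ => (1 : ℝ)) (p, s) x) (Set.Ioc 0 Rmax) :=
  .of_bound (by simp) ((measurable_scored_one p).comp measurable_prodMk_left).aestronglyMeasurable 1
    (.of_forall fun _ => norm_scored_one_le _ _)

lemma integrable_uncurry_scored_one (D : Measure (Request d)) [IsFiniteMeasure D] (R : ℝ)
    (p : Fin d → ℝ) :
    Integrable (Function.uncurry fun z s => scored (fun _ => (1 : ℝ)) (p, s) z)
      (D.prod (volume.restrict (Set.Ioc 0 R))) :=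
  .of_bound (measurable_scored_one p).aestronglyMeasurable 1
    (.of_forall fun _ => norm_scored_one_le _ _)

lemma surplus_eq_setIntegral {D : Measure (Request d)} [IsFiniteMeasure D]
    (hD : BoundedRequests Rmax Amax D) (hp : 0 ≤ p) :
    surplus D p = ∫ s in Set.Ioc 0 Rmax, ∫ z, scored (fun _ => 1) (p, s) z ∂D := by
  rw [surplus, ← integral_integral_swap (integrable_uncurry_scored_one D Rmax p)]
  exact integral_congr_ae (hD.mono fun z hz => max_sub_dotProduct_eq_setIntegral hz hp)

lemma empSurplus_eq_setIntegral (hz : ∀ s < t, BoundedRequest Rmax Amax (z s)) (hp : 0 ≤ p) :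
    empSurplus θ z k t p =
      ∫ s in Set.Ioc 0 Rmax, sampleMean θ z k t (scored (fun _ => 1) (p, s)) := by
  unfold sampleMean
  rw [integral_const_mul, integral_finsetSum _ fun _ _ => integrableOn_scored_one p _, empSurplus]
  congr 1
  refine Finset.sum_congr rfl fun s hs => max_sub_dotProduct_eq_setIntegral (hz s ?_) hp
  exact Finset.mem_range.1 (Finset.mem_filter.1 hs).1

end Surplus

/-! ### Typical histories -/

section Typical

variable {D : Fin K → Measure (Request d)} {Rmax Amax U : ℝ} {T : ℕ} {θ : ℕ → Fin K}
  {z : ℕ → Request d} {t : ℕ}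

/-- A history of bounded requests along which, at all prices simultaneously, the observed frequency
of acceptance and the observed mean reward and consumptions deviate little from their expectations.
This is the good event of the concentration argument. -/
structure IsTypical (D : Fin K → Measure (Request d)) (Rmax Amax U : ℝ) (T : ℕ)
    (θ : ℕ → Fin K) (z : ℕ → Request d) : Prop where
  bounded : ∀ t < T, BoundedRequest Rmax Amax (z t)
  abs_count_sub_le : ∀ t ≤ T, ∀ k q, |sampleMean θ z k t (scored (fun _ => 1) q) -
    ∫ z, scored (fun _ => 1) q z ∂(D k)| ≤ devRadius U (sampleCount θ k t)
  abs_reward_sub_le : ∀ t ≤ T, ∀ k q, |sampleMean θ z k t (scored Prod.fst q) -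
    ∫ z, scored Prod.fst q z ∂(D k)| ≤ Rmax * devRadius U (sampleCount θ k t)
  abs_resource_sub_le : ∀ i, ∀ t ≤ T, ∀ k q, |sampleMean θ z k t (scored (fun z => z.2 i) q) -
    ∫ z, scored (fun z => z.2 i) q z ∂(D k)| ≤ Amax * devRadius U (sampleCount θ k t)

/-- Integrating the acceptance frequencies over the reward shift recovers the surpluses, so that
the uniform deviation bound for frequencies passes on to them. -/
lemma IsTypical.surplus_le [∀ k, IsFiniteMeasure (D k)] (h : IsTypical D Rmax Amax U T θ z)
    (hR : 0 ≤ Rmax) (hD : ∀ k, BoundedRequests Rmax Amax (D k)) (ht : t ≤ T) (k : Fin K)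
    {p : Fin d → ℝ} (hp : 0 ≤ p) :
    surplus (D k) p ≤ empSurplus θ z k t p + Rmax * devRadius U (sampleCount θ k t) := by
  have hemp : IntegrableOn (fun s => sampleMean θ z k t (scored (fun _ => 1) (p, s)))
      (Set.Ioc 0 Rmax) :=
    (integrable_finsetSum _ fun s _ => integrableOn_scored_one p (z s)).const_mul _
  have hdev : IntegrableOn (fun _ : ℝ => devRadius U (sampleCount θ k t)) (Set.Ioc 0 Rmax) :=
    integrableOn_const (by simp)
  rw [surplus_eq_setIntegral (hD k) hp,
    empSurplus_eq_setIntegral (fun s hs => h.bounded s (hs.trans_le ht)) hp]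
  calc
    _ ≤ ∫ s in Set.Ioc 0 Rmax, (sampleMean θ z k t (scored (fun _ => 1) (p, s)) +
          devRadius U (sampleCount θ k t)) :=
      integral_mono (integrable_uncurry_scored_one (D k) Rmax p).integral_prod_right
        (hemp.add hdev) fun s => by
          have hle := (abs_le.1 (h.abs_count_sub_le t ht k (p, s))).1
          simp only [Function.uncurry_apply_pair]
          linarith
    _ = _ := by
      rw [integral_add hemp hdev, setIntegral_const, Real.volume_real_Ioc_of_le hR, sub_zero,
        smul_eq_mul]

end Typical

/-! ### Weak duality -/

section Duality

variable {Rmax Amax : ℝ}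

/-- The values attained by the feasible points of the mixed fluid relaxation. -/
def mixFluidValues (D : Fin K → Measure (Request d)) (b : Fin d → ℝ) : Set ℝ :=
  {v : ℝ | ∃ w ∈ stdSimplex ℝ (Fin K), ∃ x : Fin K → Request d → ℝ,
    (∀ k, Measurable (x k)) ∧ (∀ k z, x k z ∈ Set.Icc (0 : ℝ) 1) ∧
    (∀ i, ∑ k, w k * ∫ z, z.2 i * x k z ∂(D k) ≤ b i) ∧
    v = ∑ k, w k * ∫ z, z.1 * x k z ∂(D k)}

lemma BoundedRequests.integrable_max_sub_dotProduct {D : Measure (Request d)} [IsFiniteMeasure D]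
    (hD : BoundedRequests Rmax Amax D) (p : Fin d → ℝ) :
    Integrable (fun z : Request d => max (z.1 - p ⬝ᵥ z.2) 0) D :=
  (hD.integrable_fst.sub
    (integrable_finsetSum _ fun i _ => (hD.integrable_snd i).const_mul (p i))).pos_part

lemma integral_fst_mul_le_add_surplus {D : Measure (Request d)} [IsFiniteMeasure D]
    (hD : BoundedRequests Rmax Amax D) {x : Request d → ℝ} (hx : Measurable x)
    (hx01 : ∀ z, x z ∈ Set.Icc (0 : ℝ) 1) (p : Fin d → ℝ) :
    ∫ z, z.1 * x z ∂D ≤ p ⬝ᵥ (fun i => ∫ z, z.2 i * x z ∂D) + surplus D p := by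
  have hxb : ∀ᵐ z ∂D, ‖x z‖ ≤ 1 := .of_forall fun z => by
    rw [Real.norm_of_nonneg (hx01 z).1]
    exact (hx01 z).2
  have hres : ∀ i, Integrable (fun z : Request d => p i * (z.2 i * x z)) D := fun i =>
    ((hD.integrable_snd i).mul_bdd hx.aestronglyMeasurable hxb).const_mul _
  have hsur := hD.integrable_max_sub_dotProduct p
  calc
    _ ≤ ∫ z, (∑ i, p i * (z.2 i * x z) + max (z.1 - p ⬝ᵥ z.2) 0) ∂D := by
      refine integral_mono (hD.integrable_fst.mul_bdd hx.aestronglyMeasurable hxb)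
        ((integrable_finsetSum _ fun i _ => hres i).add hsur) fun z => ?_
      have hsum : ∑ i, p i * (z.2 i * x z) = (p ⬝ᵥ z.2) * x z := by
        simp only [dotProduct, Finset.sum_mul, mul_assoc]
      have hle : (z.1 - p ⬝ᵥ z.2) * x z ≤ max (z.1 - p ⬝ᵥ z.2) 0 :=
        (mul_le_mul_of_nonneg_right (le_max_left _ _) (hx01 z).1).trans
          (mul_le_of_le_one_right (le_max_right _ _) (hx01 z).2)
      simp only [hsum]
      linarith
    _ = _ := by
      rw [integral_add (integrable_finsetSum _ fun i _ => hres i) hsur,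
        integral_finsetSum _ fun i _ => hres i]
      simp only [integral_const_mul, dotProduct, surplus]

variable {D : Fin K → Measure (Request d)} {b : Fin d → ℝ}

theorem exists_forall_mixFluidValues_le_dual [∀ k, IsFiniteMeasure (D k)]
    (hD : ∀ k, BoundedRequests Rmax Amax (D k)) {v : ℝ} (hv : v ∈ mixFluidValues D b) :
    ∃ w ∈ stdSimplex ℝ (Fin K), ∀ p : Fin d → ℝ, 0 ≤ p →
      v ≤ p ⬝ᵥ b + ∑ k, w k * surplus (D k) p := by
  obtain ⟨w, hw, x, hxm, hx01, hbud, rfl⟩ := hv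
  refine ⟨w, hw, fun p hp => ?_⟩
  calc ∑ k, w k * ∫ z, z.1 * x k z ∂(D k)
      ≤ ∑ k, w k * (p ⬝ᵥ (fun i => ∫ z, z.2 i * x k z ∂(D k)) + surplus (D k) p) :=
        Finset.sum_le_sum fun k _ => mul_le_mul_of_nonneg_left
          (integral_fst_mul_le_add_surplus (hD k) (hxm k) (hx01 k) p) (hw.1 k)
    _ = p ⬝ᵥ (fun i => ∑ k, w k * ∫ z, z.2 i * x k z ∂(D k)) + ∑ k, w k * surplus (D k) p := by
        simp_rw [dotProduct, mul_add, Finset.sum_add_distrib, Finset.mul_sum]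
        rw [Finset.sum_comm]
        simp only [mul_left_comm]
    _ ≤ _ := by
        gcongr
        exact dotProduct_le_dotProduct_of_nonneg_left hbud hp

lemma mixFluidValues_subset_Iic [∀ k, IsProbabilityMeasure (D k)]
    (hD : ∀ k, BoundedRequests Rmax Amax (D k)) : mixFluidValues D b ⊆ Set.Iic Rmax := by
  rintro _ ⟨w, hw, x, -, hx01, -, rfl⟩
  have hle : ∀ k, ∫ z, z.1 * x k z ∂(D k) ≤ Rmax := fun k => by
    have hnorm := norm_integral_le_of_norm_le_const (μ := D k) (f := fun z => z.1 * x k z)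
      (C := Rmax) ((hD k).mono fun z hz => by
        rw [Real.norm_of_nonneg (mul_nonneg hz.1 (hx01 k z).1)]
        exact (mul_le_of_le_one_right hz.1 (hx01 k z).2).trans hz.2.1)
    exact (le_abs_self _).trans (by simpa using hnorm)
  calc
    _ ≤ ∑ k, w k * Rmax := Finset.sum_le_sum fun k _ => mul_le_mul_of_nonneg_left (hle k) (hw.1 k)
    _ = Rmax := by rw [← Finset.sum_mul, hw.2, one_mul]

end Duality

/-! ### The optimistic saddle point -/

lemma IsMaxMin.le_of_forall_le {L : (Fin K → ℝ) → (Fin d → ℝ) → ℝ} {w w' : Fin K → ℝ}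
    {p : Fin d → ℝ} (h : IsMaxMin L w p) (hw' : w' ∈ stdSimplex ℝ (Fin K)) {v : ℝ}
    (hv : ∀ q, 0 ≤ q → v ≤ L w' q) : v ≤ L w p := by
  obtain ⟨-, hp, hmax, hmin⟩ := h
  have : Nonempty {q : Fin d → ℝ // 0 ≤ q} := ⟨⟨p, hp⟩⟩
  have hbdd : BddBelow (Set.range fun q : {q : Fin d → ℝ // 0 ≤ q} => L w q) :=
    ⟨L w p, Set.forall_mem_range.2 fun q => hmin q.2⟩
  calc
    v ≤ ⨅ q : {q : Fin d → ℝ // 0 ≤ q}, L w' q := le_ciInf fun q => hv q q.2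
    _ ≤ ⨅ q : {q : Fin d → ℝ // 0 ≤ q}, L w q := hmax hw'
    _ ≤ L w p := ciInf_le hbdd ⟨p, hp⟩

/-- The empirical Lagrangian with per-period budget `c` and bonuses `β`. `optLagrangian` is the case
where `c` is the safe budget and the bonuses are the confidence radii. -/
def lagrangian (c : Fin d → ℝ) (β : Fin K → ℝ) (θ : ℕ → Fin K) (z : ℕ → Request d) (t : ℕ)
    (w : Fin K → ℝ) (p : Fin d → ℝ) : ℝ :=
  p ⬝ᵥ c + ∑ k, w k * (empSurplus θ z k t p + β k)

/-- The expectation of the score of `f` at the price `p` in a round in which the configuration is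
drawn from `w`. -/
def mixMean (D : Fin K → Measure (Request d)) (f : Request d → ℝ) (w : Fin K → ℝ)
    (p : Fin d → ℝ) : ℝ :=
  ∑ k, w k * ∫ z, scored f (p, 0) z ∂(D k)

section Saddle

variable {D : Fin K → Measure (Request d)} {Rmax Amax U : ℝ} {T : ℕ} {θ : ℕ → Fin K}
  {z : ℕ → Request d} {t : ℕ} {c : Fin d → ℝ} {β : Fin K → ℝ} {w : Fin K → ℝ} {p : Fin d → ℝ}

lemma IsTypical.mul_le_lagrangian [∀ k, IsFiniteMeasure (D k)] (h : IsTypical D Rmax Amax U T θ z)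
    (hR : 0 ≤ Rmax) (hD : ∀ k, BoundedRequests Rmax Amax (D k)) (ht : t ≤ T)
    (hβ : ∀ k, Rmax * devRadius U (sampleCount θ k t) ≤ β k) {ε : ℝ} (hε : ε ∈ Set.Icc (0 : ℝ) 1)
    {b : Fin d → ℝ} (hwp : IsMaxMin (lagrangian ((1 - ε) • b) β θ z t) w p) {v : ℝ}
    (hv : v ∈ mixFluidValues D b) :
    (1 - ε) * v ≤ lagrangian ((1 - ε) • b) β θ z t w p := by
  obtain ⟨w', hw', hdual⟩ := exists_forall_mixFluidValues_le_dual hD hv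
  refine hwp.le_of_forall_le hw' fun q hq => ?_
  calc
    (1 - ε) * v ≤ (1 - ε) * (q ⬝ᵥ b + ∑ k, w' k * surplus (D k) q) :=
      mul_le_mul_of_nonneg_left (hdual q hq) (sub_nonneg.2 hε.2)
    _ ≤ q ⬝ᵥ ((1 - ε) • b) + ∑ k, w' k * surplus (D k) q := by
      rw [mul_add, dotProduct_smul, smul_eq_mul]
      gcongr
      exact mul_le_of_le_one_left (Finset.sum_nonneg fun k _ => mul_nonneg (hw'.1 k)
        (surplus_nonneg _ _)) (by linarith [hε.1])
    _ ≤ lagrangian ((1 - ε) • b) β θ z t w' q := by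
      unfold lagrangian
      gcongr with k
      · exact hw'.1 k
      · exact (h.surplus_le hR hD ht k hq).trans (add_le_add_right (hβ k) _)

/-- The surplus is convex in the price, and `-a` restricted to the accepted requests is a
subgradient. -/
lemma empSurplus_add_sampleMean_le (θ : ℕ → Fin K) (z : ℕ → Request d) (k : Fin K) (t : ℕ)
    (p q : Fin d → ℝ) :
    empSurplus θ z k t q + sampleMean θ z k t (scored (fun x => (q - p) ⬝ᵥ x.2) (q, 0)) ≤
      empSurplus θ z k t p := by
  have hpt : ∀ x : Request d, max (x.1 - q ⬝ᵥ x.2) 0 +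
      scored (fun x => (q - p) ⬝ᵥ x.2) (q, 0) x ≤ max (x.1 - p ⬝ᵥ x.2) 0 := fun x => by
    simp only [scored, halfspace, Set.indicator_apply, Set.mem_ofPred_eq, sub_dotProduct, add_zero]
    split_ifs with hx
    · rw [max_eq_left (by linarith)]
      exact le_trans (by linarith) (le_max_left _ _)
    · rw [max_eq_right (by linarith), add_zero]
      exact le_max_right _ _
  rw [empSurplus_eq_sampleMean, empSurplus_eq_sampleMean, ← sampleMean_add]
  exact sampleMean_mono fun s _ _ => hpt (z s)

lemma IsMaxMin.sum_sampleMean_le (hwp : IsMaxMin (lagrangian c β θ z t) w p) {q : Fin d → ℝ}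
    (hq : 0 ≤ q) :
    ∑ k, w k * sampleMean θ z k t (scored (fun x => (q - p) ⬝ᵥ x.2) (q, 0)) ≤ (q - p) ⬝ᵥ c := by
  obtain ⟨hw, -, -, hmin⟩ := hwp
  have hle : lagrangian c β θ z t w p ≤ lagrangian c β θ z t w q := hmin hq
  have hsub : ∑ k, w k * (empSurplus θ z k t q + β k) +
      ∑ k, w k * sampleMean θ z k t (scored (fun x => (q - p) ⬝ᵥ x.2) (q, 0)) ≤
      ∑ k, w k * (empSurplus θ z k t p + β k) := by
    rw [← Finset.sum_add_distrib]
    refine Finset.sum_le_sum fun k _ => ?_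
    rw [← mul_add]
    exact mul_le_mul_of_nonneg_left
      (by linarith [empSurplus_add_sampleMean_le θ z k t p q]) (hw.1 k)
  unfold lagrangian at hle
  rw [sub_dotProduct]
  linarith

lemma IsMaxMin.sampleMean_resource_le (hwp : IsMaxMin (lagrangian c β θ z t) w p) (i : Fin d)
    {h : ℝ} (hh : 0 < h) :
    ∑ k, w k * sampleMean θ z k t (scored (fun x => x.2 i) (p + Pi.single i h, 0)) ≤ c i := by
  have hle := hwp.sum_sampleMean_le (q := p + Pi.single i h)
    (add_nonneg hwp.2.1 (Pi.single_nonneg.2 hh.le))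
  have hmean : ∀ k, sampleMean θ z k t
      (scored (fun x => (p + Pi.single i h - p) ⬝ᵥ x.2) (p + Pi.single i h, 0)) =
      h * sampleMean θ z k t (scored (fun x => x.2 i) (p + Pi.single i h, 0)) := fun k => by
    rw [← sampleMean_mul_left]
    exact sampleMean_congr fun s _ _ => scored_eq_mul_scored (by simp) _
  simp only [hmean] at hle
  simp only [add_sub_cancel_left, single_dotProduct, mul_left_comm _ h, ← Finset.mul_sum] at hle
  exact le_of_mul_le_mul_left hle hh

lemma sampleMean_add_empSurplus_le (hz : ∀ s < t, 0 ≤ (z s).1) (k : Fin K) {h : ℝ}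
    (hh : h ∈ Set.Ioo (0 : ℝ) 1) :
    sampleMean θ z k t (scored (fun x => p ⬝ᵥ x.2) ((1 - h) • p, 0)) + empSurplus θ z k t p ≤
      (1 - h)⁻¹ * sampleMean θ z k t (scored Prod.fst ((1 - h) • p, 0)) := by
  have hpos : 0 < 1 - h := sub_pos.2 hh.2
  have hpt : ∀ x : Request d, 0 ≤ x.1 → scored (fun x => p ⬝ᵥ x.2) ((1 - h) • p, 0) x +
      max (x.1 - p ⬝ᵥ x.2) 0 ≤ (1 - h)⁻¹ * scored Prod.fst ((1 - h) • p, 0) x := fun x hx => by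
    simp only [scored, halfspace, Set.indicator_apply, Set.mem_ofPred_eq, smul_dotProduct,
      smul_eq_mul, add_zero]
    rw [inv_mul_eq_div, le_div_iff₀ hpos]
    split_ifs with hacc
    · rcases le_total (x.1 - p ⬝ᵥ x.2) 0 with hle | hle
      · rw [max_eq_right hle]
        linarith
      · rw [max_eq_left hle]
        nlinarith [hh.1]
    · have hle : x.1 - p ⬝ᵥ x.2 ≤ 0 := by nlinarith [hh.1]
      simp [max_eq_right hle]
  rw [empSurplus_eq_sampleMean, ← sampleMean_mul_left, ← sampleMean_add]
  exact sampleMean_mono fun s hs _ => hpt (z s) (hz s hs)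

lemma IsMaxMin.lagrangian_le (hwp : IsMaxMin (lagrangian c β θ z t) w p)
    (hz : ∀ s < t, 0 ≤ (z s).1) {h : ℝ} (hh : h ∈ Set.Ioo (0 : ℝ) 1) :
    lagrangian c β θ z t w p ≤
      (1 - h)⁻¹ * ∑ k, w k * sampleMean θ z k t (scored Prod.fst ((1 - h) • p, 0)) +
        ∑ k, w k * β k := by
  set m : Fin K → ℝ := fun k => sampleMean θ z k t (scored (fun x => p ⬝ᵥ x.2) ((1 - h) • p, 0))
  have hbudget : p ⬝ᵥ c ≤ ∑ k, w k * m k := by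
    have hle := hwp.sum_sampleMean_le (smul_nonneg (sub_nonneg.2 hh.2.le) hwp.2.1)
    have hq : (1 - h) • p - p = (-h) • p := by rw [sub_smul, one_smul, neg_smul]; abel
    have hmean : ∀ k, sampleMean θ z k t
        (scored (fun x => ((1 - h) • p - p) ⬝ᵥ x.2) ((1 - h) • p, 0)) = -h * m k := fun k => by
      rw [← sampleMean_mul_left]
      exact sampleMean_congr fun s _ _ => scored_eq_mul_scored (by simp [hq]) _
    simp only [hmean] at hle
    simp only [hq, smul_dotProduct, smul_eq_mul, mul_left_comm _ (-h), ← Finset.mul_sum] at hle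
    nlinarith [hh.1]
  calc
    _ ≤ ∑ k, w k * m k + ∑ k, w k * (empSurplus θ z k t p + β k) := by
      unfold lagrangian
      gcongr
    _ = ∑ k, w k * (m k + empSurplus θ z k t p) + ∑ k, w k * β k := by
      simp only [mul_add, Finset.sum_add_distrib, add_assoc]
    _ ≤ _ := by
      rw [Finset.mul_sum]
      gcongr ?_ + _
      refine Finset.sum_le_sum fun k _ => ?_
      rw [mul_left_comm]
      exact mul_le_mul_of_nonneg_left (sampleMean_add_empSurplus_le hz k hh) (hwp.1.1 k)

section MixMean

variable [∀ k, IsFiniteMeasure (D k)]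

lemma continuous_mixMean (hc : ∀ k, ContinuousValuation (D k)) {f : Request d → ℝ}
    (hm : Measurable f) (hf : ∀ k, Integrable f (D k)) (w : Fin K → ℝ) :
    Continuous (mixMean D f w) :=
  continuous_finsetSum _ fun k _ =>
    continuous_const.mul ((hc k).continuous_integral_scored hm (hf k))

lemma IsTypical.mixMean_resource_le (h : IsTypical D Rmax Amax U T θ z)
    (hD : ∀ k, BoundedRequests Rmax Amax (D k)) (hc : ∀ k, ContinuousValuation (D k)) (ht : t ≤ T)
    (hwp : IsMaxMin (lagrangian c β θ z t) w p) (i : Fin d) :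
    mixMean D (fun x => x.2 i) w p ≤ c i + Amax * ∑ k, w k * devRadius U (sampleCount θ k t) := by
  have hlim : Filter.Tendsto (fun η => mixMean D (fun x => x.2 i) w (p + Pi.single i η))
      (nhdsWithin 0 (Set.Ioi 0)) (nhds (mixMean D (fun x => x.2 i) w p)) :=
    (((continuous_mixMean hc (by fun_prop) (fun k => (hD k).integrable_snd i) w).comp
      (continuous_const.add (continuous_single i))).tendsto' 0 _ (by simp)).mono_left
      nhdsWithin_le_nhds
  refine le_of_tendsto hlim ?_
  filter_upwards [self_mem_nhdsWithin] with η hη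
  refine le_trans ?_ (add_le_add_left (hwp.sampleMean_resource_le i hη) _)
  rw [Finset.mul_sum, ← Finset.sum_add_distrib, mixMean]
  refine Finset.sum_le_sum fun k _ => ?_
  have hdev := (abs_le.1 (h.abs_resource_sub_le i t ht k (p + Pi.single i η, 0))).1
  linarith [mul_le_mul_of_nonneg_left hdev (hwp.1.1 k)]

lemma IsTypical.mul_le_mixMean_reward (h : IsTypical D Rmax Amax U T θ z) (hR : 0 ≤ Rmax)
    (hD : ∀ k, BoundedRequests Rmax Amax (D k)) (hc : ∀ k, ContinuousValuation (D k)) (ht : t ≤ T)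
    (hβ : ∀ k, Rmax * devRadius U (sampleCount θ k t) ≤ β k) {ε : ℝ} (hε : ε ∈ Set.Icc (0 : ℝ) 1)
    {b : Fin d → ℝ} (hwp : IsMaxMin (lagrangian ((1 - ε) • b) β θ z t) w p) {v : ℝ}
    (hv : v ∈ mixFluidValues D b) :
    (1 - ε) * v ≤ mixMean D Prod.fst w p + 2 * ∑ k, w k * β k := by
  have hlim : Filter.Tendsto (fun η => (1 - η)⁻¹ * (mixMean D Prod.fst w ((1 - η) • p) +
      ∑ k, w k * β k) + ∑ k, w k * β k) (nhdsWithin 0 (Set.Ioi 0))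
      (nhds ((1 - 0)⁻¹ * (mixMean D Prod.fst w ((1 - 0 : ℝ) • p) + ∑ k, w k * β k) +
        ∑ k, w k * β k)) := by
    have hone : Filter.Tendsto (fun η : ℝ => 1 - η) (nhdsWithin 0 (Set.Ioi 0)) (nhds (1 - 0)) :=
      (tendsto_const_nhds.sub Filter.tendsto_id).mono_left nhdsWithin_le_nhds
    exact ((hone.inv₀ (by simp)).mul (((((continuous_mixMean hc measurable_fst
      fun k => (hD k).integrable_fst) w).tendsto _).comp
        (hone.smul_const p)).add_const _)).add_const _
  refine (ge_of_tendsto hlim ?_).trans_eq (by rw [sub_zero, one_smul]; ring)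
  filter_upwards [Ioo_mem_nhdsGT one_pos] with η hη
  refine (h.mul_le_lagrangian hR hD ht hβ hε hwp hv).trans ((hwp.lagrangian_le
    (fun s hs => (h.bounded s (hs.trans_le ht)).1) hη).trans ?_)
  refine add_le_add_left (mul_le_mul_of_nonneg_left ?_ (inv_nonneg.2 (sub_nonneg.2 hη.2.le))) _
  rw [mixMean, ← Finset.sum_add_distrib]
  refine Finset.sum_le_sum fun k _ => ?_
  rw [← mul_add]
  have hdev := (abs_le.1 (h.abs_reward_sub_le t ht k ((1 - η) • p, 0))).2
  exact mul_le_mul_of_nonneg_left (by linarith [hβ k]) (hwp.1.1 k)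

end MixMean

end Saddle

/-! ### Budget accounting along a path -/

/-- The total resources requested before round `t` by the requests that exceed their bid price,
whether or not they fit into the budget. -/
def cumDemand (K : ℕ) (z : ℕ → Request d) (p : ℕ → Fin d → ℝ) (t : ℕ) : Fin d → ℝ :=
  ∑ s ∈ Finset.Ico K t, (halfspace (p s, 0)).indicator Prod.snd (z s)

open Classical in
/-- The indicator that the total demand before round `t` fits into the budget. -/
def inBudget (K : ℕ) (B : Fin d → ℝ) (z : ℕ → Request d) (p : ℕ → Fin d → ℝ) (t : ℕ) : ℝ :=
  if cumDemand K z p t ≤ B then 1 else 0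

section Accounting

variable {B : Fin d → ℝ} {z : ℕ → Request d} {p : ℕ → Fin d → ℝ} {T t : ℕ}

lemma cumDemand_apply (K : ℕ) (z : ℕ → Request d) (p : ℕ → Fin d → ℝ) (t : ℕ) (i : Fin d) :
    cumDemand K z p t i = ∑ s ∈ Finset.Ico K t, scored (fun x => x.2 i) (p s, 0) (z s) := by
  rw [cumDemand, Finset.sum_apply]
  refine Finset.sum_congr rfl fun s _ => ?_
  by_cases h : z s ∈ halfspace (p s, 0) <;> simp [scored, h]

lemma cumDemand_of_le (h : t ≤ K) : cumDemand K z p t = 0 := by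
  rw [cumDemand, Finset.Ico_eq_empty_of_le h, Finset.sum_empty]

lemma cumDemand_succ (h : K ≤ t) : cumDemand K z p (t + 1) =
    cumDemand K z p t + (halfspace (p t, 0)).indicator Prod.snd (z t) :=
  Finset.sum_Ico_succ_top h _

lemma cumDemand_mono (hz : ∀ t < T, 0 ≤ (z t).2) {s : ℕ} (hst : s ≤ t) (ht : t ≤ T) :
    cumDemand K z p s ≤ cumDemand K z p t :=
  Finset.sum_le_sum_of_subset_of_nonneg (Finset.Ico_subset_Ico_right hst) fun u hu _ =>
    Set.indicator_apply_nonneg fun _ => hz u ((Finset.mem_Ico.1 hu).2.trans_le ht)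

lemma inBudget_mem_Icc (K : ℕ) (B : Fin d → ℝ) (z : ℕ → Request d) (p : ℕ → Fin d → ℝ) (t : ℕ) :
    inBudget K B z p t ∈ Set.Icc (0 : ℝ) 1 := by
  unfold inBudget
  split_ifs <;> simp

lemma inBudget_succ_le (hz : ∀ t < T, 0 ≤ (z t).2) (ht : t < T) :
    inBudget K B z p (t + 1) ≤ inBudget K B z p t := by
  by_cases h : cumDemand K z p (t + 1) ≤ B
  · exact (inBudget_mem_Icc ..).2.trans_eq
      (if_pos ((cumDemand_mono hz t.le_succ ht).trans h)).symm
  · exact (if_neg h).trans_le (inBudget_mem_Icc ..).1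

lemma admits_sub_cumDemand_iff (hB : cumDemand K z p (t + 1) ≤ B) :
    Admits K t (B - cumDemand K z p t) (p t) (z t) ↔ K ≤ t ∧ z t ∈ halfspace (p t, 0) := by
  refine ⟨fun h => ⟨h.1, by simpa [halfspace] using h.2.2⟩, fun ⟨hK, hacc⟩ => ⟨hK, ?_, ?_⟩⟩
  · rw [cumDemand_succ hK, Set.indicator_of_mem hacc] at hB
    exact le_sub_iff_add_le'.2 hB
  · simpa [halfspace] using hacc

lemma remBudget_eq_sub_cumDemand (hz : ∀ t < T, 0 ≤ (z t).2) (ht : t ≤ T)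
    (hB : cumDemand K z p t ≤ B) : remBudget K B z p t = B - cumDemand K z p t := by
  induction t with
  | zero => rw [cumDemand_of_le (Nat.zero_le K), sub_zero, remBudget]
  | succ t ih =>
    rw [remBudget, ih (by omega) ((cumDemand_mono hz t.le_succ ht).trans hB)]
    by_cases hK : K ≤ t
    · have hadm := admits_sub_cumDemand_iff hB
      rw [cumDemand_succ hK]
      by_cases hacc : z t ∈ halfspace (p t, 0)
      · rw [if_pos (hadm.2 ⟨hK, hacc⟩), Set.indicator_of_mem hacc, sub_sub]
      · rw [if_neg fun h => hacc (hadm.1 h).2, Set.indicator_of_notMem hacc, add_zero]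
    · rw [if_neg fun h => hK h.1, cumDemand_of_le (by omega), cumDemand_of_le (by omega)]

lemma inBudget_succ_mul_scored_le [Decidable (Admits K t (remBudget K B z p t) (p t) (z t))]
    (hz : ∀ t < T, 0 ≤ (z t).2) (hr : 0 ≤ (z t).1) (hKt : K ≤ t) (ht : t < T) :
    inBudget K B z p (t + 1) * scored Prod.fst (p t, 0) (z t) ≤
      if Admits K t (remBudget K B z p t) (p t) (z t) then (z t).1 else 0 := by
  by_cases hB : cumDemand K z p (t + 1) ≤ B
  · have hrem := remBudget_eq_sub_cumDemand hz ht.le ((cumDemand_mono hz t.le_succ ht).trans hB)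
    have hadm := admits_sub_cumDemand_iff hB
    rw [← hrem] at hadm
    rw [inBudget, if_pos hB, one_mul]
    by_cases hacc : z t ∈ halfspace (p t, 0)
    · exact (Set.indicator_of_mem hacc _).trans_le (if_pos (hadm.2 ⟨hKt, hacc⟩)).ge
    · exact (Set.indicator_of_notMem hacc _).trans_le (if_neg fun h => hacc (hadm.1 h).2).ge
  · rw [inBudget, if_neg hB, zero_mul]
    split_ifs
    exacts [hr, le_rfl]

lemma sum_inBudget_succ_mul_scored_le (hz : ∀ t < T, 0 ≤ (z t).2) (hr : ∀ t < T, 0 ≤ (z t).1) :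
    ∑ t ∈ Finset.Ico K T, inBudget K B z p (t + 1) * scored Prod.fst (p t, 0) (z t) ≤
      totalReward K T B z p := by
  classical
  calc
    _ ≤ ∑ t ∈ Finset.Ico K T,
          if Admits K t (remBudget K B z p t) (p t) (z t) then (z t).1 else 0 :=
      Finset.sum_le_sum fun t ht => by
        obtain ⟨hKt, htT⟩ := Finset.mem_Ico.1 ht
        exact inBudget_succ_mul_scored_le hz (hr t htT) hKt htT
    _ ≤ totalReward K T B z p := by
      refine (Finset.sum_le_sum_of_subset_of_nonneg (t := Finset.range T)
        (fun t ht => Finset.mem_range.2 (Finset.mem_Ico.1 ht).2) fun t ht _ => ?_).trans_eq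
        (Finset.sum_congr rfl fun t _ => by congr)
      split_ifs
      exacts [hr t (Finset.mem_range.1 ht), le_rfl]

lemma sum_inBudget_sub_mul_scored_le {Rmax : ℝ} (hR : 0 ≤ Rmax) (hz : ∀ t < T, 0 ≤ (z t).2)
    (hr : ∀ t < T, (z t).1 ∈ Set.Icc 0 Rmax) :
    ∑ t ∈ Finset.Ico K T, (inBudget K B z p t - inBudget K B z p (t + 1)) *
      scored Prod.fst (p t, 0) (z t) ≤ Rmax := by
  rcases le_or_gt T K with hTK | hKT
  · simpa [Finset.Ico_eq_empty_of_le hTK] using hR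
  calc
    _ ≤ ∑ t ∈ Finset.Ico K T, (inBudget K B z p t - inBudget K B z p (t + 1)) * Rmax :=
      Finset.sum_le_sum fun t ht => by
        have htT := (Finset.mem_Ico.1 ht).2
        exact mul_le_mul_of_nonneg_left (scored_mem_Icc (f := Prod.fst) (hr t htT) _).2
          (sub_nonneg.2 (inBudget_succ_le hz htT))
    _ = (inBudget K B z p K - inBudget K B z p T) * Rmax := by
      rw [← Finset.sum_mul, Finset.sum_sub_distrib, ← neg_sub (inBudget K B z p T),
        ← Finset.sum_Ico_sub (inBudget K B z p) hKT.le, Finset.sum_sub_distrib, neg_sub]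
    _ ≤ 1 * Rmax := by
      gcongr
      linarith [(inBudget_mem_Icc K B z p K).2, (inBudget_mem_Icc K B z p T).1]
    _ = Rmax := one_mul _

/-- As long as the total demand fits into the budget, every request above its bid price is
admitted. At most one reward is lost, in the round in which the demand exceeds the budget. -/
lemma sum_inBudget_mul_scored_le {Rmax : ℝ} (hR : 0 ≤ Rmax) (hz : ∀ t < T, 0 ≤ (z t).2)
    (hr : ∀ t < T, (z t).1 ∈ Set.Icc 0 Rmax) :
    ∑ t ∈ Finset.Ico K T, inBudget K B z p t * scored Prod.fst (p t, 0) (z t) ≤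
      totalReward K T B z p + Rmax :=
  calc
    _ = ∑ t ∈ Finset.Ico K T, inBudget K B z p (t + 1) * scored Prod.fst (p t, 0) (z t) +
        ∑ t ∈ Finset.Ico K T, (inBudget K B z p t - inBudget K B z p (t + 1)) *
          scored Prod.fst (p t, 0) (z t) := by
      rw [← Finset.sum_add_distrib]
      exact Finset.sum_congr rfl fun t _ => by ring
    _ ≤ _ := add_le_add (sum_inBudget_succ_mul_scored_le hz fun t ht => (hr t ht).1)
      (sum_inBudget_sub_mul_scored_le hR hz hr)

lemma exists_lt_sum_inBudget_mul_scored (hz : ∀ t < T, 0 ≤ (z t).2) (hB₀ : 0 ≤ B)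
    (hB : ¬ cumDemand K z p T ≤ B) :
    ∃ i, B i < ∑ t ∈ Finset.Ico K T,
      inBudget K B z p t * scored (fun x => x.2 i) (p t, 0) (z t) := by
  classical
  have hex : ∃ t, ¬ cumDemand K z p t ≤ B := ⟨T, hB⟩
  have hpos : Nat.find hex ≠ 0 := fun h => Nat.find_spec hex (by
    rwa [h, cumDemand_of_le (Nat.zero_le K)])
  obtain ⟨τ, hτ⟩ := Nat.exists_eq_succ_of_ne_zero hpos
  have hτT : τ + 1 ≤ T := hτ.symm.trans_le (Nat.find_min' hex hB)
  obtain ⟨i, hi⟩ : ∃ i, B i < cumDemand K z p (τ + 1) i := by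
    have hfind := Nat.find_spec hex
    rw [hτ, Pi.le_def] at hfind
    push Not at hfind
    exact hfind
  have hfits : ∀ t ∈ Finset.Ico K (τ + 1), inBudget K B z p t = 1 := fun t ht =>
    if_pos (not_not.1 (Nat.find_min hex ((Finset.mem_Ico.1 ht).2.trans_eq hτ.symm)))
  refine ⟨i, hi.trans_le ?_⟩
  rw [cumDemand_apply]
  calc
    _ = ∑ t ∈ Finset.Ico K (τ + 1),
          inBudget K B z p t * scored (fun x => x.2 i) (p t, 0) (z t) :=
      Finset.sum_congr rfl fun t ht => by rw [hfits t ht, one_mul]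
    _ ≤ _ := Finset.sum_le_sum_of_subset_of_nonneg (Finset.Ico_subset_Ico_right hτT)
      fun t ht _ => mul_nonneg (inBudget_mem_Icc ..).1
        (Set.indicator_apply_nonneg fun _ => hz t (Finset.mem_Ico.1 ht).2 i)

lemma mul_sum_one_sub_le {ι : Type*} {s : Finset ι} {J x c e : ι → ℝ} {b : ℝ}
    (hJ : ∀ t ∈ s, J t ∈ Set.Icc (0 : ℝ) 1) (he : ∀ t ∈ s, 0 ≤ e t) (hc : ∀ t ∈ s, c t ≤ b + e t)
    (hx : s.card * b ≤ ∑ t ∈ s, J t * x t) :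
    b * ∑ t ∈ s, (1 - J t) ≤ ∑ t ∈ s, J t * (x t - c t) + ∑ t ∈ s, e t := by
  have hle : ∑ t ∈ s, (J t * c t - J t * b) ≤ ∑ t ∈ s, e t := Finset.sum_le_sum fun t ht => by
    rw [← mul_sub]
    exact (mul_le_mul_of_nonneg_left (sub_le_iff_le_add'.2 (hc t ht)) (hJ t ht).1).trans
      (mul_le_of_le_one_left (he t ht) (hJ t ht).2)
  simp only [mul_sub, Finset.sum_sub_distrib, ← Finset.sum_mul, Finset.sum_const, nsmul_eq_mul,
    mul_one] at hle ⊢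
  linarith

/-- If the demand exceeds the budget before the last round, then the rounds that remain were bought
by an excess of the demand over its expectations `c`, or by an excess of these over `b`. -/
lemma mul_sum_one_sub_inBudget_le {b : Fin d → ℝ} {m : ℝ} (hb : ∀ i, 0 ≤ b i)
    (hm : ∀ i, m ≤ b i) (hz : ∀ t < T, 0 ≤ (z t).2) {c : ℕ → Fin d → ℝ} {e : ℕ → ℝ}
    (he : ∀ t ∈ Finset.Ico K T, 0 ≤ e t) (hc : ∀ t ∈ Finset.Ico K T, ∀ i, c t i ≤ b i + e t) :
    m * ∑ t ∈ Finset.Ico K T, (1 - inBudget K ((T : ℝ) • b) z p t) ≤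
      ∑ i, |∑ t ∈ Finset.Ico K T, inBudget K ((T : ℝ) • b) z p t *
        (scored (fun x => x.2 i) (p t, 0) (z t) - c t i)| + ∑ t ∈ Finset.Ico K T, e t := by
  set J := inBudget K ((T : ℝ) • b) z p
  have hJ : ∀ t, J t ∈ Set.Icc (0 : ℝ) 1 := inBudget_mem_Icc K _ z p
  by_cases hB : cumDemand K z p T ≤ (T : ℝ) • b
  · have hone : ∀ t ∈ Finset.Ico K T, 1 - J t = 0 := fun t ht =>
      sub_eq_zero.2 (if_pos ((cumDemand_mono hz (Finset.mem_Ico.1 ht).2.le le_rfl).trans hB)).symm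
    rw [Finset.sum_eq_zero hone, mul_zero]
    exact add_nonneg (Finset.sum_nonneg fun i _ => abs_nonneg _) (Finset.sum_nonneg he)
  obtain ⟨i, hi⟩ := exists_lt_sum_inBudget_mul_scored hz (smul_nonneg T.cast_nonneg hb) hB
  have hcard : ((Finset.Ico K T).card : ℝ) * b i ≤ T * b i :=
    mul_le_mul_of_nonneg_right (by simp) (hb i)
  calc
    _ ≤ b i * ∑ t ∈ Finset.Ico K T, (1 - J t) :=
      mul_le_mul_of_nonneg_right (hm i) (Finset.sum_nonneg fun t _ => sub_nonneg.2 (hJ t).2)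
    _ ≤ ∑ t ∈ Finset.Ico K T, J t * (scored (fun x => x.2 i) (p t, 0) (z t) - c t i) +
        ∑ t ∈ Finset.Ico K T, e t :=
      mul_sum_one_sub_le (fun t _ => hJ t) he (fun t ht => hc t ht i) (hcard.trans hi.le)
    _ ≤ _ := by
      gcongr
      exact (le_abs_self _).trans (Finset.single_le_sum (f := fun i => |∑ t ∈ Finset.Ico K T,
        J t * (scored (fun x => x.2 i) (p t, 0) (z t) - c t i)|) (fun _ _ => abs_nonneg _)
        (Finset.mem_univ i))

end Accounting

/-! ### The regret along a typical path -/

section Radii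

lemma devRadius_eq_mul (U : ℝ) (n : ℕ) : devRadius U n = U * devRadius 1 n := by
  rw [devRadius, devRadius, mul_one_div]

lemma devRadius_one_le (n : ℕ) : devRadius 1 n ≤ 3 * (√(n + 1 : ℕ) - √n) := by
  obtain rfl | hn := n.eq_zero_or_pos
  · simp [devRadius]
  have hn' : (1 : ℝ) ≤ n := Nat.one_le_cast.2 hn
  rw [devRadius, max_eq_left hn', div_le_iff₀ (Real.sqrt_pos.2 (by linarith))]
  have hle : √(n + 1 : ℕ) ≤ 2 * √n := by
    rw [Real.sqrt_le_left (by positivity), mul_pow, Real.sq_sqrt (by positivity)]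
    push_cast
    linarith
  have hmul : (√(n + 1 : ℕ) - √n) * (√(n + 1 : ℕ) + √n) = 1 := by
    rw [mul_comm, ← sq_sub_sq, Real.sq_sqrt (by positivity), Real.sq_sqrt (by positivity)]
    push_cast
    ring
  have hmono : √n ≤ √(n + 1 : ℕ) := Real.sqrt_le_sqrt (by simp)
  nlinarith

variable (θ : ℕ → Fin K) (t : ℕ)

lemma sum_sampleCount : ∑ k, sampleCount θ k t = t := by
  simp only [sampleCount]
  rw [← Finset.card_eq_sum_card_fiberwise fun _ _ => Finset.mem_coe.2 (Finset.mem_univ _),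
    Finset.card_range]

lemma sum_sqrt_sampleCount_le : ∑ k, √(sampleCount θ k t) ≤ √(K * t) := by
  refine Real.le_sqrt_of_sq_le (sq_sum_le_card_mul_sum_sq.trans_eq ?_)
  simp only [Real.sq_sqrt, Nat.cast_nonneg]
  rw [← Nat.cast_sum, sum_sampleCount, Finset.card_univ, Fintype.card_fin]

lemma sum_sqrt_sampleCount_succ : ∑ k, √(sampleCount θ k (t + 1)) =
    ∑ k, √(sampleCount θ k t) +
      (√(sampleCount θ (θ t) t + 1 : ℕ) - √(sampleCount θ (θ t) t)) := by
  rw [← sub_eq_iff_eq_add', ← Finset.sum_sub_distrib, Finset.sum_eq_single (θ t)]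
  · rw [sampleCount_succ, if_pos rfl]
  · intro k _ hk
    rw [sampleCount_succ, if_neg hk.symm, add_zero, sub_self]
  · simp

/-- The sum of the square roots of the sample counts serves as a potential. -/
theorem sum_devRadius_one_le :
    ∑ s ∈ Finset.range t, devRadius 1 (sampleCount θ (θ s) s) ≤ 3 * √(K * t) := by
  suffices h : ∑ s ∈ Finset.range t, devRadius 1 (sampleCount θ (θ s) s) ≤
      3 * ∑ k, √(sampleCount θ k t) from
    h.trans (mul_le_mul_of_nonneg_left (sum_sqrt_sampleCount_le θ t) zero_le_three)
  induction t with
  | zero => simp [sampleCount]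
  | succ t ih =>
    rw [Finset.sum_range_succ, sum_sqrt_sampleCount_succ, mul_add]
    exact add_le_add ih (devRadius_one_le _)

/-- The average over the mixture `w` of the deviation scales `1 / √(max n 1)` of the
configurations. -/
def mixRadius (w : Fin K → ℝ) : ℝ := ∑ k, w k * devRadius 1 (sampleCount θ k t)

lemma mixRadius_nonneg {w : Fin K → ℝ} (hw : 0 ≤ w) : 0 ≤ mixRadius θ t w :=
  Finset.sum_nonneg fun k _ => mul_nonneg (hw k) (by unfold devRadius; positivity)

lemma sum_mul_devRadius (U : ℝ) (w : Fin K → ℝ) :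
    ∑ k, w k * devRadius U (sampleCount θ k t) = U * mixRadius θ t w := by
  rw [mixRadius, Finset.mul_sum]
  exact Finset.sum_congr rfl fun k _ => by rw [devRadius_eq_mul, mul_left_comm]

end Radii

section Path

variable {D : Fin K → Measure (Request d)} {Rmax Amax U W m ε : ℝ} {b : Fin d → ℝ} {T : ℕ}
  {θ : ℕ → Fin K} {z : ℕ → Request d} {w : ℕ → Fin K → ℝ} {p : ℕ → Fin d → ℝ}

lemma IsTypical.mul_sum_one_sub_inBudget_le [∀ k, IsFiniteMeasure (D k)]
    (h : IsTypical D Rmax Amax U T θ z) (hA : 0 ≤ Amax) (hU : 0 ≤ U) (hb : ∀ i, 0 ≤ b i)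
    (hm : ∀ i, m ≤ b i) (hε : 0 ≤ ε) (hD : ∀ k, BoundedRequests Rmax Amax (D k))
    (hc : ∀ k, ContinuousValuation (D k))
    (hwp : ∀ t ∈ Finset.Ico K T, IsMaxMin (lagrangian ((1 - ε) • b)
      (fun k => devRadius W (sampleCount θ k t)) θ z t) (w t) (p t)) :
    m * ∑ t ∈ Finset.Ico K T, (1 - inBudget K ((T : ℝ) • b) z p t) ≤
      ∑ i, |∑ t ∈ Finset.Ico K T, inBudget K ((T : ℝ) • b) z p t *
        (scored (fun x => x.2 i) (p t, 0) (z t) - mixMean D (fun x => x.2 i) (w t) (p t))| +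
      Amax * U * ∑ t ∈ Finset.Ico K T, mixRadius θ t (w t) := by
  rw [Finset.mul_sum _ _ (Amax * U)]
  refine SPUCB.mul_sum_one_sub_inBudget_le hb hm (fun t ht => (h.bounded t ht).2.2.1)
    (fun t ht => mul_nonneg (mul_nonneg hA hU) (mixRadius_nonneg θ t (hwp t ht).1.1))
    fun t ht i => ?_
  have hle := h.mixMean_resource_le hD hc (Finset.mem_Ico.1 ht).2.le (hwp t ht) i
  rw [sum_mul_devRadius, ← mul_assoc] at hle
  exact hle.trans (add_le_add_left (mul_le_of_le_one_left (hb i) (by linarith)) _)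

lemma IsTypical.sum_inBudget_mul_le [∀ k, IsFiniteMeasure (D k)]
    (h : IsTypical D Rmax Amax U T θ z) (hR : 0 ≤ Rmax) (hW : 0 ≤ W) (hUW : Rmax * U ≤ W)
    (hε : ε ∈ Set.Icc (0 : ℝ) 1) (hD : ∀ k, BoundedRequests Rmax Amax (D k))
    (hc : ∀ k, ContinuousValuation (D k))
    (hwp : ∀ t ∈ Finset.Ico K T, IsMaxMin (lagrangian ((1 - ε) • b)
      (fun k => devRadius W (sampleCount θ k t)) θ z t) (w t) (p t))
    {v : ℝ} (hv : v ∈ mixFluidValues D b) :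
    (∑ t ∈ Finset.Ico K T, inBudget K ((T : ℝ) • b) z p t) * ((1 - ε) * v) ≤
      ∑ t ∈ Finset.Ico K T, inBudget K ((T : ℝ) • b) z p t * mixMean D Prod.fst (w t) (p t) +
        2 * W * ∑ t ∈ Finset.Ico K T, mixRadius θ t (w t) := by
  rw [Finset.sum_mul, Finset.mul_sum, ← Finset.sum_add_distrib]
  refine Finset.sum_le_sum fun t ht => ?_
  have hJ := inBudget_mem_Icc K ((T : ℝ) • b) z p t
  have hle := h.mul_le_mixMean_reward hR hD hc (Finset.mem_Ico.1 ht).2.le (fun k => by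
    rw [devRadius, devRadius, ← mul_div_assoc]
    gcongr) hε (hwp t ht) hv
  rw [sum_mul_devRadius, ← mul_assoc] at hle
  calc
    _ ≤ _ := mul_le_mul_of_nonneg_left hle hJ.1
    _ ≤ _ := by
      rw [mul_add]
      exact add_le_add_right (mul_le_of_le_one_left (mul_nonneg (by positivity)
        (mixRadius_nonneg θ t (hwp t ht).1.1)) hJ.2) _

/-- The value of the relaxation is collected in the rounds in which the demand fits into the budget;
the other rounds are those of the initialization and those lost to an early exhaustion. -/
theorem IsTypical.mul_le_sum_inBudget_mul_mixMean [∀ k, IsProbabilityMeasure (D k)]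
    (h : IsTypical D Rmax Amax U T θ z) (hR : 0 ≤ Rmax) (hA : 0 ≤ Amax) (hU : 0 ≤ U)
    (hUW : Rmax * U ≤ W) (hm₀ : 0 < m) (hm : ∀ i, m ≤ b i) (hε : ε ∈ Set.Icc (0 : ℝ) 1)
    (hD : ∀ k, BoundedRequests Rmax Amax (D k)) (hc : ∀ k, ContinuousValuation (D k)) (hKT : K ≤ T)
    (hwp : ∀ t ∈ Finset.Ico K T, IsMaxMin (lagrangian ((1 - ε) • b)
      (fun k => devRadius W (sampleCount θ k t)) θ z t) (w t) (p t))
    {v : ℝ} (hv : v ∈ mixFluidValues D b) :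
    T * v ≤
      ∑ t ∈ Finset.Ico K T, inBudget K ((T : ℝ) • b) z p t * mixMean D Prod.fst (w t) (p t) +
      2 * W * ∑ t ∈ Finset.Ico K T, mixRadius θ t (w t) +
      Rmax / m * (∑ i, |∑ t ∈ Finset.Ico K T, inBudget K ((T : ℝ) • b) z p t *
        (scored (fun x => x.2 i) (p t, 0) (z t) - mixMean D (fun x => x.2 i) (w t) (p t))| +
        Amax * U * ∑ t ∈ Finset.Ico K T, mixRadius θ t (w t)) + K * Rmax + ε * T * Rmax := by
  have hreward := h.sum_inBudget_mul_le hR ((mul_nonneg hR hU).trans hUW) hUW hε hD hc hwp hv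
  have hlost := h.mul_sum_one_sub_inBudget_le hA hU (fun i => hm₀.le.trans (hm i)) hm hε.1 hD hc hwp
  set J := inBudget K ((T : ℝ) • b) z p
  set L := ∑ t ∈ Finset.Ico K T, (1 - J t) with hL
  have hL₀ : 0 ≤ L := Finset.sum_nonneg fun t _ => sub_nonneg.2 (inBudget_mem_Icc ..).2
  have hsum : ∑ t ∈ Finset.Ico K T, J t = T - K - L := by
    rw [hL, Finset.sum_sub_distrib, Finset.sum_const, Nat.card_Ico, nsmul_eq_mul, mul_one,
      Nat.cast_sub hKT]
    ring
  have hvR : v ≤ Rmax := mixFluidValues_subset_Iic hD hv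
  have hlost' := mul_le_mul_of_nonneg_left hlost (div_nonneg hR hm₀.le)
  rw [← mul_assoc, div_mul_cancel₀ _ hm₀.ne'] at hlost'
  have hround : (1 - ε) * v ≤ Rmax := by nlinarith [hε.1, hε.2]
  calc
    T * v = (∑ t ∈ Finset.Ico K T, J t) * ((1 - ε) * v) + L * ((1 - ε) * v) +
        K * ((1 - ε) * v) + ε * T * v := by
      rw [hsum]
      ring
    _ ≤ _ := add_le_add (add_le_add (add_le_add hreward
        ((mul_le_mul_of_nonneg_left hround hL₀).trans (by rwa [mul_comm])))
        (mul_le_mul_of_nonneg_left hround K.cast_nonneg))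
        (mul_le_mul_of_nonneg_left hvR (mul_nonneg hε.1 T.cast_nonneg))

end Path

/-! ### Conditional expectations along a run -/

section MartingaleDifferences

variable {Ω : Type*} {mΩ : MeasurableSpace Ω} {P : Measure Ω} {ℱ : Filtration ℕ mΩ}
  {X : ℕ → Ω → ℝ} {c : ℝ} {m n : ℕ}

lemma integral_sq_add_of_condExp_eq_zero {m : MeasurableSpace Ω} (hm : m ≤ mΩ) [IsFiniteMeasure P]
    {S Y : Ω → ℝ} (hS : Measurable[m] S) (hS₂ : MemLp S 2 P) (hY : MemLp Y 2 P)
    (h : P[Y | m] =ᵐ[P] 0) : ∫ ω, (S ω + Y ω) ^ 2 ∂P = ∫ ω, S ω ^ 2 ∂P + ∫ ω, Y ω ^ 2 ∂P := by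
  have hSY : Integrable (S * Y) P := hS₂.integrable_mul hY
  have hcross : ∫ ω, (S * Y) ω ∂P = 0 := by
    rw [← integral_condExp hm]
    refine integral_eq_zero_of_ae ?_
    filter_upwards [condExp_mul_of_stronglyMeasurable_left hS.stronglyMeasurable hSY
      (hY.integrable one_le_two), h] with ω hpull hzero
    rw [hpull, Pi.mul_apply, hzero, Pi.zero_apply, mul_zero]
  calc
    _ = ∫ ω, (S ω ^ 2 + Y ω ^ 2 + 2 * (S * Y) ω) ∂P := by
      refine integral_congr_ae (.of_forall fun ω => ?_)
      simp only [Pi.mul_apply]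
      ring
    _ = _ := by
      rw [integral_add (by exact hS₂.integrable_sq.add hY.integrable_sq) (hSY.const_mul 2),
        integral_add hS₂.integrable_sq hY.integrable_sq, integral_const_mul, hcross, mul_zero,
        add_zero]

lemma ae_abs_sum_Ico_le (hc : ∀ t ∈ Finset.Ico m n, ∀ᵐ ω ∂P, |X t ω| ≤ c) :
    ∀ᵐ ω ∂P, |∑ t ∈ Finset.Ico m n, X t ω| ≤ (n - m : ℕ) * c := by
  filter_upwards [(Finset.eventually_all _).2 hc] with ω hω
  refine (Finset.abs_sum_le_sum_abs _ _).trans ((Finset.sum_le_card_nsmul _ _ c hω).trans_eq ?_)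
  rw [Nat.card_Ico, nsmul_eq_mul]

variable [IsProbabilityMeasure P]

lemma integral_sq_le_of_ae_abs_le {Y : Ω → ℝ} (hY : MemLp Y 2 P) (hc : ∀ᵐ ω ∂P, |Y ω| ≤ c) :
    ∫ ω, Y ω ^ 2 ∂P ≤ c ^ 2 := by
  refine (integral_mono_ae hY.integrable_sq (integrable_const (c ^ 2))
    (hc.mono fun ω hω => ?_)).trans_eq (by simp)
  exact sq_le_sq' (neg_le_of_abs_le hω) (le_of_abs_le hω)

lemma integral_sq_sum_le_of_condExp_eq_zero
    (hX : ∀ t ∈ Finset.Ico m n, Measurable[ℱ (t + 1)] (X t))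
    (hc : ∀ t ∈ Finset.Ico m n, ∀ᵐ ω ∂P, |X t ω| ≤ c)
    (hzero : ∀ t ∈ Finset.Ico m n, P[X t | ℱ t] =ᵐ[P] 0) :
    ∫ ω, (∑ t ∈ Finset.Ico m n, X t ω) ^ 2 ∂P ≤ (n - m : ℕ) * c ^ 2 := by
  obtain hnm | hmn := le_total n m
  · simp [Finset.Ico_eq_empty_of_le hnm, Nat.sub_eq_zero_of_le hnm]
  induction n, hmn using Nat.le_induction with
  | base => simp
  | succ n hmn ih =>
    have hsub : ∀ t ∈ Finset.Ico m n, t ∈ Finset.Ico m (n + 1) := fun t ht =>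
      Finset.Ico_subset_Ico_right n.le_succ ht
    have hlast : n ∈ Finset.Ico m (n + 1) := Finset.mem_Ico.2 ⟨hmn, n.lt_succ_self⟩
    set S : Ω → ℝ := fun ω => ∑ t ∈ Finset.Ico m n, X t ω
    have hS : Measurable[ℱ n] S := Finset.measurable_fun_sum _ fun t ht =>
      (hX t (hsub t ht)).mono (ℱ.mono (Finset.mem_Ico.1 ht).2) le_rfl
    have hS₂ : MemLp S 2 P := .of_bound (hS.mono (ℱ.le _) le_rfl).aestronglyMeasurable _
      (ae_abs_sum_Ico_le fun t ht => hc t (hsub t ht))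
    have hX₂ : MemLp (X n) 2 P :=
      .of_bound ((hX n hlast).mono (ℱ.le _) le_rfl).aestronglyMeasurable c (hc n hlast)
    simp_rw [Finset.sum_Ico_succ_top hmn]
    rw [integral_sq_add_of_condExp_eq_zero (ℱ.le n) hS hS₂ hX₂ (hzero n hlast), Nat.succ_sub hmn,
      Nat.cast_succ, add_one_mul]
    exact add_le_add (ih (fun t ht => hX t (hsub t ht)) (fun t ht => hc t (hsub t ht))
      fun t ht => hzero t (hsub t ht)) (integral_sq_le_of_ae_abs_le hX₂ (hc n hlast))

lemma integral_abs_sum_le_of_condExp_eq_zero (hc₀ : 0 ≤ c)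
    (hX : ∀ t ∈ Finset.Ico m n, Measurable[ℱ (t + 1)] (X t))
    (hc : ∀ t ∈ Finset.Ico m n, ∀ᵐ ω ∂P, |X t ω| ≤ c)
    (hzero : ∀ t ∈ Finset.Ico m n, P[X t | ℱ t] =ᵐ[P] 0) :
    ∫ ω, |∑ t ∈ Finset.Ico m n, X t ω| ∂P ≤ c * √(n - m : ℕ) := by
  have hS : Measurable fun ω => ∑ t ∈ Finset.Ico m n, X t ω :=
    Finset.measurable_fun_sum _ fun t ht => (hX t ht).mono (ℱ.le _) le_rfl
  have hL : MemLp (fun ω => |∑ t ∈ Finset.Ico m n, X t ω|) 2 P :=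
    .of_bound hS.norm.aestronglyMeasurable _
      ((ae_abs_sum_Ico_le hc).mono fun ω hω => by rwa [Real.norm_eq_abs, abs_abs])
  have hvar := variance_nonneg (fun ω => |∑ t ∈ Finset.Ico m n, X t ω|) P
  rw [variance_eq_sub hL] at hvar
  simp only [Pi.pow_apply, sq_abs] at hvar
  have hsq := integral_sq_sum_le_of_condExp_eq_zero hX hc hzero
  refine abs_le_of_sq_le_sq' ?_ (by positivity) |>.2
  rw [mul_pow, Real.sq_sqrt (Nat.cast_nonneg _)]
  linarith

end MartingaleDifferences

section Measurability

lemma measurable_scored_pair {f : Request d → ℝ} (hf : Measurable f) :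
    Measurable fun u : (Fin d → ℝ) × Request d => scored f (u.1, 0) u.2 := by
  refine (hf.comp measurable_snd).indicator
    (s := {u : (Fin d → ℝ) × Request d | u.1 ⬝ᵥ u.2.2 + 0 < u.2.1}) (measurableSet_lt ?_ ?_)
  · unfold dotProduct
    fun_prop
  · fun_prop

lemma measurable_mixMean (D : Fin K → Measure (Request d)) [∀ k, SFinite (D k)]
    {f : Request d → ℝ} (hf : Measurable f) :
    Measurable fun u : (Fin K → ℝ) × (Fin d → ℝ) => mixMean D f u.1 u.2 :=
  Finset.measurable_fun_sum _ fun k _ => ((measurable_pi_apply k).comp measurable_fst).mul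
    ((measurable_scored_pair hf).stronglyMeasurable.integral_prod_right' (ν := D k)
      |>.measurable.comp measurable_snd)

variable {Ω : Type*} {_ : MeasurableSpace Ω} {Z : ℕ → Ω → Request d} {p : ℕ → Ω → Fin d → ℝ}
  {t : ℕ}

lemma measurable_scored_comp {f : Request d → ℝ} (hf : Measurable f) {Z : Ω → Request d}
    (hZ : Measurable Z) {p : Ω → Fin d → ℝ} (hp : Measurable p) :
    Measurable fun ω => scored f (p ω, 0) (Z ω) := by
  have h := (measurable_scored_pair hf).comp (hp.prodMk hZ)
  exact h

lemma measurable_cumDemand (hZ : ∀ s < t, Measurable (Z s)) (hp : ∀ s < t, Measurable (p s)) :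
    Measurable fun ω => cumDemand K (fun s => Z s ω) (fun s => p s ω) t := by
  refine measurable_pi_iff.2 fun i => ?_
  simp_rw [cumDemand_apply]
  refine Finset.measurable_fun_sum _ fun s hs => measurable_scored_comp ?_
    (hZ s (Finset.mem_Ico.1 hs).2) (hp s (Finset.mem_Ico.1 hs).2)
  exact (measurable_pi_apply i).comp measurable_snd

lemma measurable_inBudget (B : Fin d → ℝ) (hZ : ∀ s < t, Measurable (Z s))
    (hp : ∀ s < t, Measurable (p s)) :
    Measurable fun ω => inBudget K B (fun s => Z s ω) (fun s => p s ω) t :=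
  Measurable.ite (measurableSet_le (measurable_cumDemand hZ hp) measurable_const)
    measurable_const measurable_const

end Measurability

section ConditionalLaw

variable {Ω Y X : Type*} {m mΩ : MeasurableSpace Ω} [MeasurableSpace Y] [MeasurableSpace X]
  {P : Measure Ω} [IsFiniteMeasure P] {A : Set Ω}

lemma condExp_indicator_comp_prodMk {D : Measure X} [IsProbabilityMeasure D] (hm : m ≤ mΩ)
    (hA : MeasurableSet A) {φ : Ω → Y} (hφ : Measurable[m] φ) {Z : Ω → X} (hZ : Measurable Z)
    (h : ∀ E, MeasurableSet[m] E → ∀ S, MeasurableSet S →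
      P (E ∩ A ∩ Z ⁻¹' S) = P (E ∩ A) * D S)
    {G : Y × X → ℝ} (hG : Measurable G) (hint : IntegrableOn (fun ω => G (φ ω, Z ω)) A P) :
    P[A.indicator fun ω => G (φ ω, Z ω)|m] =ᵐ[P]
      fun ω => (∫ x, G (φ ω, x) ∂D) * P[A.indicator 1|m] ω := by
  have hφm : Measurable φ := hφ.mono hm le_rfl
  have hpair : Measurable fun ω => (φ ω, Z ω) := hφm.prodMk hZ
  set g : Y → ℝ := fun y => ∫ x, G (y, x) ∂D
  have hgm : StronglyMeasurable g := hG.stronglyMeasurable.integral_prod_right'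
  have hlaw : ∀ E, MeasurableSet[m] E → (P.restrict (E ∩ A)).map (fun ω => (φ ω, Z ω)) =
      ((P.restrict (E ∩ A)).map φ).prod D := fun E hE =>
    map_restrict_prodMk_eq_prod hφm hZ fun F hF S hS => by
      rw [← Set.inter_assoc, h _ ((hφ hF).inter hE) S hS]
  have hprod : ∀ E, MeasurableSet[m] E →
      Integrable G (((P.restrict (E ∩ A)).map φ).prod D) := fun E hE => by
    rw [← hlaw E hE, integrable_map_measure hG.aestronglyMeasurable hpair.aemeasurable]
    exact hint.mono_set Set.inter_subset_right
  have hgint : IntegrableOn (fun ω => g (φ ω)) A P := by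
    have := (hprod Set.univ .univ).integral_prod_left
    rwa [Set.univ_inter, integrable_map_measure hgm.aestronglyMeasurable hφm.aemeasurable] at this
  have hmean : P[A.indicator fun ω => G (φ ω, Z ω)|m] =ᵐ[P] P[A.indicator fun ω => g (φ ω)|m] := by
    refine (ae_eq_condExp_of_forall_setIntegral_eq hm (hint.integrable_indicator hA)
      (fun _ _ _ => integrable_condExp.integrableOn) (fun E hE _ => ?_)
      stronglyMeasurable_condExp.aestronglyMeasurable).symm
    rw [setIntegral_condExp hm (hgint.integrable_indicator hA) hE, setIntegral_indicator hA,
      setIntegral_indicator hA, ← integral_map hφm.aemeasurable hgm.aestronglyMeasurable,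
      ← integral_map hpair.aemeasurable hG.aestronglyMeasurable, hlaw E hE,
      integral_prod _ (hprod E hE)]
  have hmul : (A.indicator fun ω => g (φ ω)) = (fun ω => g (φ ω)) * A.indicator 1 := by
    ext ω
    by_cases hω : ω ∈ A <;> simp [hω]
  rw [hmul] at hmean
  refine hmean.trans (condExp_mul_of_stronglyMeasurable_left
    (hgm.comp_measurable hφ) ?_ ((integrable_const 1).indicator hA))
  exact hmul ▸ hgint.integrable_indicator hA

lemma condExp_indicator_one_eq_of_lintegral (hm : m ≤ mΩ) (hA : MeasurableSet A) {w : Ω → ℝ}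
    (hw : Measurable[m] w) (hw₀ : 0 ≤ᵐ[P] w)
    (h : ∀ E, MeasurableSet[m] E → P (E ∩ A) = ∫⁻ ω in E, ENNReal.ofReal (w ω) ∂P) :
    P[A.indicator 1|m] =ᵐ[P] w := by
  have hwm : Measurable w := hw.mono hm le_rfl
  refine (ae_eq_condExp_of_forall_setIntegral_eq hm ((integrable_const 1).indicator hA)
    (fun E hE _ => ⟨hwm.aestronglyMeasurable, ?_⟩) (fun E hE _ => ?_)
    hw.aestronglyMeasurable).symm
  · rw [hasFiniteIntegral_iff_ofReal (ae_restrict_of_ae hw₀), ← h E hE]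
    exact measure_lt_top _ _
  · rw [integral_eq_lintegral_of_nonneg_ae (ae_restrict_of_ae hw₀) hwm.aestronglyMeasurable,
      ← h E hE, integral_indicator_one hA, measureReal_restrict_apply hA, Set.inter_comm,
      measureReal_def]

end ConditionalLaw

section Run

variable {Ω : Type*} {mΩ : MeasurableSpace Ω} {P : Measure Ω} {ℱ : Filtration ℕ mΩ}
  {D : Fin K → Measure (Request d)} {cg c₀ Rmax Amax : ℝ} {b : Fin d → ℝ} {T : ℕ} {α δ : ℝ}
  {θ : ℕ → Ω → Fin K} {Z : ℕ → Ω → Request d} {w : ℕ → Ω → Fin K → ℝ}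
  {p : ℕ → Ω → Fin d → ℝ} {t : ℕ} {f : Request d → ℝ} {c : ℝ} {B : Fin d → ℝ}

lemma IsRun.mixture_mem_stdSimplex (hrun : IsRun P ℱ D cg c₀ Rmax Amax b T α δ θ Z w p)
    (ht : t ∈ Finset.Ico K T) : ∀ᵐ ω ∂P, w t ω ∈ stdSimplex ℝ (Fin K) := by
  filter_upwards [hrun.saddle t (Finset.mem_Ico.1 ht).2 (Finset.mem_Ico.1 ht).1] with ω hω
    using hω.1

lemma IsRun.ae_forall_request (hrun : IsRun P ℱ D cg c₀ Rmax Amax b T α δ θ Z w p)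
    {q : Request d → Prop} (hq : ∀ k, ∀ᵐ z ∂(D k), q z) : ∀ᵐ ω ∂P, ∀ t < T, q (Z t ω) := by
  filter_upwards [ae_all_iff.2 fun k => ae_forall_sampled_of_ae
    (fun t ht E hE S hS => hrun.observe t ht E hE k S hS) (hq k)] with ω hω t ht
    using hω (θ t ω) t ht rfl

lemma IsRun.measurable_sampleCount (hrun : IsRun P ℱ D cg c₀ Rmax Amax b T α δ θ Z w p)
    (k : Fin K) (ht : t ≤ T) : Measurable[ℱ t] fun ω => sampleCount (fun s => θ s ω) k t :=
  SPUCB.measurable_sampleCount k fun s hs =>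
    (hrun.measurable_config s (hs.trans_le ht)).mono (ℱ.mono hs) le_rfl

lemma IsRun.measurable_inBudget (hrun : IsRun P ℱ D cg c₀ Rmax Amax b T α δ θ Z w p)
    (B : Fin d → ℝ) (ht : t ≤ T) :
    Measurable[ℱ t] fun ω => inBudget K B (fun s => Z s ω) (fun s => p s ω) t :=
  SPUCB.measurable_inBudget B
    (fun s hs => (hrun.measurable_request s (hs.trans_le ht)).mono (ℱ.mono hs) le_rfl)
    fun s hs => (hrun.measurable_price s (hs.trans_le ht)).mono (ℱ.mono hs.le) le_rfl

lemma IsRun.measurable_scored (hrun : IsRun P ℱ D cg c₀ Rmax Amax b T α δ θ Z w p)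
    (hf : Measurable f) (ht : t < T) :
    Measurable[ℱ (t + 1)] fun ω => scored f (p t ω, 0) (Z t ω) :=
  measurable_scored_comp hf (hrun.measurable_request t ht)
    ((hrun.measurable_price t ht).mono (ℱ.mono t.le_succ) le_rfl)

lemma IsRun.measurable_mixMean [∀ k, SFinite (D k)]
    (hrun : IsRun P ℱ D cg c₀ Rmax Amax b T α δ θ Z w p) (hf : Measurable f) (ht : t < T) :
    Measurable[ℱ t] fun ω => mixMean D f (w t ω) (p t ω) := by
  have h := (SPUCB.measurable_mixMean D hf).comp
    ((hrun.measurable_mixture t ht).prodMk (hrun.measurable_price t ht))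
  exact h

lemma IsRun.condExp_round [IsFiniteMeasure P] [∀ k, IsProbabilityMeasure (D k)]
    (hrun : IsRun P ℱ D cg c₀ Rmax Amax b T α δ θ Z w p) (ht : t ∈ Finset.Ico K T) {Y : Type*}
    [MeasurableSpace Y] {φ : Ω → Y} (hφ : Measurable[ℱ t] φ) {G : Fin K → Y × Request d → ℝ}
    (hG : ∀ k, Measurable (G k)) (hint : Integrable (fun ω => G (θ t ω) (φ ω, Z t ω)) P) :
    P[fun ω => G (θ t ω) (φ ω, Z t ω) | ℱ t] =ᵐ[P]
      fun ω => ∑ k, w t ω k * ∫ z, G k (φ ω, z) ∂(D k) := by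
  obtain ⟨hKt, htT⟩ := Finset.mem_Ico.1 ht
  have hA : ∀ k, MeasurableSet {ω | θ t ω = k} := fun k =>
    (hrun.measurable_config t htT).mono (ℱ.le _) le_rfl (measurableSet_singleton k)
  have hsum : (fun ω => G (θ t ω) (φ ω, Z t ω)) =
      ∑ k, {ω | θ t ω = k}.indicator fun ω => G k (φ ω, Z t ω) := by
    ext ω
    simp [Finset.sum_apply, Set.indicator_apply]
  have hintk : ∀ k, IntegrableOn (fun ω => G k (φ ω, Z t ω)) {ω | θ t ω = k} P := fun k =>
    hint.integrableOn.congr_fun (fun ω (hω : θ t ω = k) => by simp only [hω]) (hA k)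
  have hcond := fun k => condExp_indicator_comp_prodMk (ℱ.le t) (hA k) hφ
    ((hrun.measurable_request t htT).mono (ℱ.le _) le_rfl)
    (fun E hE => hrun.observe t htT E hE k) (hG k) (hintk k)
  have hdraw := fun k => condExp_indicator_one_eq_of_lintegral (ℱ.le t) (hA k)
    ((measurable_pi_apply k).comp (hrun.measurable_mixture t htT))
    ((hrun.mixture_mem_stdSimplex ht).mono fun ω hω => hω.1 k)
    fun E hE => hrun.draw t htT hKt E hE k
  rw [hsum]
  filter_upwards [condExp_finsetSum (s := Finset.univ)
    (fun k _ => (hintk k).integrable_indicator (hA k)) (ℱ t), ae_all_iff.2 hcond,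
    ae_all_iff.2 hdraw] with ω hω hcond hdraw
  rw [hω, Finset.sum_apply]
  exact Finset.sum_congr rfl fun k _ => by rw [hcond, hdraw, mul_comm]; rfl

lemma mixMean_mem_Icc [∀ k, IsProbabilityMeasure (D k)] (hf : ∀ k, ∀ᵐ z ∂(D k), f z ∈ Set.Icc 0 c)
    {w : Fin K → ℝ} (hw : w ∈ stdSimplex ℝ (Fin K)) (p : Fin d → ℝ) :
    mixMean D f w p ∈ Set.Icc 0 c := by
  have hmean : ∀ k, ∫ z, scored f (p, 0) z ∂(D k) ∈ Set.Icc 0 c := fun k => by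
    have hsc := (hf k).mono fun z hz => scored_mem_Icc hz (p, 0)
    refine ⟨integral_nonneg_of_ae (hsc.mono fun z hz => hz.1), ?_⟩
    exact (integral_mono_of_nonneg (hsc.mono fun z hz => hz.1) (integrable_const c)
      (hsc.mono fun z hz => hz.2)).trans_eq (by simp)
  exact (convex_Icc 0 c).sum_mem (fun k _ => hw.1 k) hw.2 fun k _ => hmean k

/-- The amount by which the score of round `t` deviates from its conditional expectation, counted
while the demand fits into the budget: the increments of a martingale. -/
def fluctuation (D : Fin K → Measure (Request d)) (f : Request d → ℝ) (B : Fin d → ℝ)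
    (Z : ℕ → Ω → Request d) (w : ℕ → Ω → Fin K → ℝ) (p : ℕ → Ω → Fin d → ℝ) (t : ℕ) (ω : Ω) : ℝ :=
  inBudget K B (fun s => Z s ω) (fun s => p s ω) t *
    (scored f (p t ω, 0) (Z t ω) - mixMean D f (w t ω) (p t ω))

section Fluctuation

variable [∀ k, IsProbabilityMeasure (D k)]

lemma IsRun.measurable_fluctuation (hrun : IsRun P ℱ D cg c₀ Rmax Amax b T α δ θ Z w p)
    (hf : Measurable f) (ht : t ∈ Finset.Ico K T) :
    Measurable[ℱ (t + 1)] (fluctuation D f B Z w p t) := by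
  have htT := (Finset.mem_Ico.1 ht).2
  exact ((hrun.measurable_inBudget B htT.le).mono (ℱ.mono t.le_succ) le_rfl).mul
    ((hrun.measurable_scored hf htT).sub
      ((hrun.measurable_mixMean hf htT).mono (ℱ.mono t.le_succ) le_rfl))

lemma IsRun.abs_fluctuation_le (hrun : IsRun P ℱ D cg c₀ Rmax Amax b T α δ θ Z w p)
    (hfc : ∀ k, ∀ᵐ z ∂(D k), f z ∈ Set.Icc 0 c) (ht : t ∈ Finset.Ico K T) :
    ∀ᵐ ω ∂P, |fluctuation D f B Z w p t ω| ≤ c := by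
  filter_upwards [hrun.ae_forall_request hfc, hrun.mixture_mem_stdSimplex ht] with ω hZ hw
  have hJ := inBudget_mem_Icc K B (fun s => Z s ω) (fun s => p s ω) t
  have hsub : |scored f (p t ω, 0) (Z t ω) - mixMean D f (w t ω) (p t ω)| ≤ c := by
    have hs := scored_mem_Icc (hZ t (Finset.mem_Ico.1 ht).2) (p t ω, 0)
    have hm := mixMean_mem_Icc hfc hw (p t ω)
    exact abs_sub_le_of_nonneg_of_le hs.1 hs.2 hm.1 hm.2
  rw [fluctuation, abs_mul, abs_of_nonneg hJ.1]
  exact (mul_le_of_le_one_left (abs_nonneg _) hJ.2).trans hsub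

variable [IsProbabilityMeasure P]

lemma IsRun.integrable_fluctuation (hrun : IsRun P ℱ D cg c₀ Rmax Amax b T α δ θ Z w p)
    (hf : Measurable f) (hfc : ∀ k, ∀ᵐ z ∂(D k), f z ∈ Set.Icc 0 c) (ht : t ∈ Finset.Ico K T) :
    Integrable (fluctuation D f B Z w p t) P :=
  .of_bound ((hrun.measurable_fluctuation hf ht).mono (ℱ.le _) le_rfl).aestronglyMeasurable c
    (hrun.abs_fluctuation_le hfc ht)

lemma IsRun.condExp_scored (hrun : IsRun P ℱ D cg c₀ Rmax Amax b T α δ θ Z w p)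
    (hf : Measurable f) (hint : Integrable (fun ω => scored f (p t ω, 0) (Z t ω)) P)
    (ht : t ∈ Finset.Ico K T) :
    P[fun ω => scored f (p t ω, 0) (Z t ω) | ℱ t] =ᵐ[P]
      fun ω => mixMean D f (w t ω) (p t ω) :=
  hrun.condExp_round ht (hrun.measurable_price t (Finset.mem_Ico.1 ht).2)
    (G := fun _ u => scored f (u.1, 0) u.2) (fun _ => measurable_scored_pair hf) hint

lemma IsRun.condExp_fluctuation (hrun : IsRun P ℱ D cg c₀ Rmax Amax b T α δ θ Z w p)
    (hf : Measurable f) (hfc : ∀ k, ∀ᵐ z ∂(D k), f z ∈ Set.Icc 0 c) (ht : t ∈ Finset.Ico K T) :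
    P[fluctuation D f B Z w p t | ℱ t] =ᵐ[P] 0 := by
  have htT := (Finset.mem_Ico.1 ht).2
  have hscored : Integrable (fun ω => scored f (p t ω, 0) (Z t ω)) P :=
    .of_mem_Icc 0 c ((hrun.measurable_scored hf htT).mono (ℱ.le _) le_rfl).aemeasurable
      ((hrun.ae_forall_request hfc).mono fun ω hω => scored_mem_Icc (hω t htT) (p t ω, 0))
  have hmean : Integrable (fun ω => mixMean D f (w t ω) (p t ω)) P :=
    .of_mem_Icc 0 c ((hrun.measurable_mixMean hf htT).mono (ℱ.le _) le_rfl).aemeasurable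
      ((hrun.mixture_mem_stdSimplex ht).mono fun ω hω => mixMean_mem_Icc hfc hω (p t ω))
  filter_upwards [condExp_mul_of_stronglyMeasurable_left
      (hrun.measurable_inBudget B htT.le).stronglyMeasurable
      (hrun.integrable_fluctuation (B := B) hf hfc ht) (hscored.sub hmean),
    condExp_sub hscored hmean (ℱ t), hrun.condExp_scored hf hscored ht] with ω hpull hsub hsc
  refine hpull.trans ((congrArg (_ * ·) (hsub.trans ?_)).trans (mul_zero _))
  rw [Pi.sub_apply, hsc, condExp_of_stronglyMeasurable (ℱ.le t)
    (hrun.measurable_mixMean hf htT).stronglyMeasurable hmean, sub_self]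

lemma IsRun.integral_fluctuation (hrun : IsRun P ℱ D cg c₀ Rmax Amax b T α δ θ Z w p)
    (hf : Measurable f) (hfc : ∀ k, ∀ᵐ z ∂(D k), f z ∈ Set.Icc 0 c) (ht : t ∈ Finset.Ico K T) :
    ∫ ω, fluctuation D f B Z w p t ω ∂P = 0 := by
  rw [← integral_condExp (ℱ.le t)]
  exact integral_eq_zero_of_ae (hrun.condExp_fluctuation hf hfc ht)

lemma IsRun.integral_abs_sum_fluctuation_le
    (hrun : IsRun P ℱ D cg c₀ Rmax Amax b T α δ θ Z w p) (hf : Measurable f) (hc₀ : 0 ≤ c)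
    (hfc : ∀ k, ∀ᵐ z ∂(D k), f z ∈ Set.Icc 0 c) :
    ∫ ω, |∑ t ∈ Finset.Ico K T, fluctuation D f B Z w p t ω| ∂P ≤ c * √T := by
  refine (integral_abs_sum_le_of_condExp_eq_zero hc₀ (fun t => hrun.measurable_fluctuation hf)
    (fun t => hrun.abs_fluctuation_le hfc) fun t => hrun.condExp_fluctuation hf hfc).trans ?_
  gcongr
  exact T.sub_le K

end Fluctuation

lemma devRadius_one_mem_Icc (n : ℕ) : devRadius 1 n ∈ Set.Icc (0 : ℝ) 1 :=
  ⟨by unfold devRadius; positivity,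
    div_le_one_of_le₀ (Real.one_le_sqrt.2 (le_max_right _ _)) (Real.sqrt_nonneg _)⟩

lemma IsRun.measurable_devRadius (hrun : IsRun P ℱ D cg c₀ Rmax Amax b T α δ θ Z w p)
    (U : ℝ) (k : Fin K) (ht : t ≤ T) :
    Measurable[ℱ t] fun ω => devRadius U (sampleCount (fun s => θ s ω) k t) :=
  (measurable_from_top (f := devRadius U)).comp (hrun.measurable_sampleCount k ht)

lemma IsRun.integrable_mixRadius [IsProbabilityMeasure P]
    (hrun : IsRun P ℱ D cg c₀ Rmax Amax b T α δ θ Z w p)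
    (ht : t ∈ Finset.Ico K T) :
    Integrable (fun ω => mixRadius (fun s => θ s ω) t (w t ω)) P := by
  have htT := (Finset.mem_Ico.1 ht).2
  refine .of_mem_Icc 0 1 (Finset.measurable_fun_sum _ fun k _ => ?_).aemeasurable
    ((hrun.mixture_mem_stdSimplex ht).mono fun ω hω => (convex_Icc 0 1).sum_mem
      (fun k _ => hω.1 k) hω.2 fun k _ => devRadius_one_mem_Icc _)
  exact ((measurable_pi_apply k).comp ((hrun.measurable_mixture t htT).mono (ℱ.le _) le_rfl)).mul
    ((hrun.measurable_devRadius 1 k htT.le).mono (ℱ.le _) le_rfl)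

lemma IsRun.integrable_devRadius_config [IsProbabilityMeasure P]
    (hrun : IsRun P ℱ D cg c₀ Rmax Amax b T α δ θ Z w p)
    (ht : t < T) :
    Integrable (fun ω => devRadius 1 (sampleCount (fun s => θ s ω) (θ t ω) t)) P := by
  have hsum : (fun ω => devRadius 1 (sampleCount (fun s => θ s ω) (θ t ω) t)) = fun ω =>
      ∑ k, {ω | θ t ω = k}.indicator
        (fun ω => devRadius 1 (sampleCount (fun s => θ s ω) k t)) ω := by
    ext ω
    simp [Set.indicator_apply]
  refine .of_mem_Icc 0 1 ?_ (.of_forall fun ω => devRadius_one_mem_Icc _)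
  rw [hsum]
  refine (Finset.measurable_fun_sum _ fun k _ => ?_).aemeasurable
  exact ((hrun.measurable_devRadius 1 k ht.le).mono (ℱ.le _) le_rfl).indicator
    (((hrun.measurable_config t ht).mono (ℱ.le _) le_rfl) (measurableSet_singleton k))

lemma IsRun.integral_mixRadius [IsProbabilityMeasure P] [∀ k, IsProbabilityMeasure (D k)]
    (hrun : IsRun P ℱ D cg c₀ Rmax Amax b T α δ θ Z w p)
    (ht : t ∈ Finset.Ico K T) :
    ∫ ω, mixRadius (fun s => θ s ω) t (w t ω) ∂P =
      ∫ ω, devRadius 1 (sampleCount (fun s => θ s ω) (θ t ω) t) ∂P := by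
  have htT := (Finset.mem_Ico.1 ht).2
  have hφ : Measurable[ℱ t] fun ω k => devRadius 1 (sampleCount (fun s => θ s ω) k t) :=
    @measurable_pi_lambda _ _ _ (ℱ t) _ _ fun k => hrun.measurable_devRadius 1 k htT.le
  have hcond := hrun.condExp_round ht hφ (G := fun k u => u.1 k)
    (fun k => (measurable_pi_apply k).comp measurable_fst) (hrun.integrable_devRadius_config htT)
  rw [← integral_condExp (ℱ.le t)
    (f := fun ω => devRadius 1 (sampleCount (fun s => θ s ω) (θ t ω) t)), integral_congr_ae hcond]
  simp [mixRadius]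

lemma IsRun.integral_sum_mixRadius_le [IsProbabilityMeasure P] [∀ k, IsProbabilityMeasure (D k)]
    (hrun : IsRun P ℱ D cg c₀ Rmax Amax b T α δ θ Z w p) :
    ∫ ω, ∑ t ∈ Finset.Ico K T, mixRadius (fun s => θ s ω) t (w t ω) ∂P ≤ 3 * √(K * T) := by
  rw [integral_finsetSum _ fun t ht => hrun.integrable_mixRadius ht,
    Finset.sum_congr rfl fun t ht => hrun.integral_mixRadius ht]
  calc
    _ ≤ ∑ t ∈ Finset.range T, ∫ ω, devRadius 1 (sampleCount (fun s => θ s ω) (θ t ω) t) ∂P :=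
      Finset.sum_le_sum_of_subset_of_nonneg
        (fun t ht => Finset.mem_range.2 (Finset.mem_Ico.1 ht).2)
        fun t _ _ => integral_nonneg fun ω => (devRadius_one_mem_Icc _).1
    _ = ∫ ω, ∑ t ∈ Finset.range T, devRadius 1 (sampleCount (fun s => θ s ω) (θ t ω) t) ∂P :=
      (integral_finsetSum _ fun t ht =>
        hrun.integrable_devRadius_config (Finset.mem_range.1 ht)).symm
    _ ≤ ∫ _, 3 * √(K * T) ∂P :=
      integral_mono (integrable_finsetSum _ fun t ht =>
        hrun.integrable_devRadius_config (Finset.mem_range.1 ht)) (integrable_const _)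
        fun ω => sum_devRadius_one_le _ T
    _ = 3 * √(K * T) := by simp

/-- The event that, in some round and at some price, the empirical score of `f` under
configuration `k` deviates from its expectation by more than `c` confidence radii. -/
def deviationEvent (D : Fin K → Measure (Request d)) (θ : ℕ → Ω → Fin K) (Z : ℕ → Ω → Request d)
    (U : ℝ) (T : ℕ) (f : Request d → ℝ) (c : ℝ) (k : Fin K) : Set Ω :=
  {ω | ∃ t ≤ T, ∃ q, c * devRadius U (sampleCount (fun s => θ s ω) k t) <
    |sampleMean (fun s => θ s ω) (fun s => Z s ω) k t (scored f q) - ∫ z, scored f q z ∂(D k)|}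

lemma IsRun.measure_deviationEvent_le [IsProbabilityMeasure P] [∀ k, IsProbabilityMeasure (D k)]
    (hrun : IsRun P ℱ D cg c₀ Rmax Amax b T α δ θ Z w p)
    (hD : ∀ k, BoundedRequests Rmax Amax (D k)) {U : ℝ} (hU : 1 ≤ U) (hf : Measurable f)
    (hc : 0 < c) (hfc : ∀ k, ∀ᵐ z ∂(D k), f z ∈ Set.Icc 0 c) (k : Fin K) :
    P (deviationEvent D θ Z U T f c k) ≤
      ENNReal.ofReal (T * (2 * (2 * T + 1) ^ (d + 1) * Real.exp (-U ^ 2 / 2))) :=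
  measure_exists_mul_devRadius_lt_abs_sampleMean_sub_le hrun.measurable_config
    hrun.measurable_request (fun t ht E hE S hS => hrun.observe t ht E hE k S hS) hf hc (hfc k)
    ((hD k).mono fun _ hz => hz.2.2.1) hU

/-- The event that the acceptance frequency, the mean reward or some mean consumption of some
configuration deviates from its expectation: outside of it the history is typical. -/
def atypicalEvent (D : Fin K → Measure (Request d)) (θ : ℕ → Ω → Fin K) (Z : ℕ → Ω → Request d)
    (Rmax Amax U : ℝ) (T : ℕ) : Set Ω :=
  ⋃ k, (deviationEvent D θ Z U T (fun _ => 1) 1 k ∪ deviationEvent D θ Z U T Prod.fst Rmax k) ∪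
    ⋃ i, deviationEvent D θ Z U T (fun z => z.2 i) Amax k

lemma IsRun.measure_atypicalEvent_le [IsProbabilityMeasure P] [∀ k, IsProbabilityMeasure (D k)]
    (hrun : IsRun P ℱ D cg c₀ Rmax Amax b T α δ θ Z w p)
    (hR : 0 < Rmax) (hA : 0 < Amax) (hD : ∀ k, BoundedRequests Rmax Amax (D k))
    {U : ℝ} (hU : 1 ≤ U) :
    P (atypicalEvent D θ Z Rmax Amax U T) ≤ ENNReal.ofReal (K * ((d + 2) *
      (T * (2 * (2 * T + 1) ^ (d + 1) * Real.exp (-U ^ 2 / 2))))) := by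
  set x : ℝ := T * (2 * (2 * T + 1) ^ (d + 1) * Real.exp (-U ^ 2 / 2))
  have hx : 0 ≤ x := by positivity
  have hcount := hrun.measure_deviationEvent_le hD hU measurable_const one_pos
    fun k => .of_forall fun _ => ⟨zero_le_one, le_rfl⟩
  have hreward := hrun.measure_deviationEvent_le hD hU measurable_fst hR
    fun k => (hD k).ae_fst_mem_Icc
  have hresource := fun i => hrun.measure_deviationEvent_le hD hU
    ((measurable_pi_apply i).comp measurable_snd) hA fun k => (hD k).ae_snd_mem_Icc i
  calc
    _ ≤ ∑ _k : Fin K, (ENNReal.ofReal x + ENNReal.ofReal x + ∑ _i : Fin d, ENNReal.ofReal x) :=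
      (measure_iUnion_fintype_le _ _).trans (Finset.sum_le_sum fun k _ =>
        (measure_union_le _ _).trans (add_le_add
          ((measure_union_le _ _).trans (add_le_add (hcount k) (hreward k)))
          ((measure_iUnion_fintype_le _ _).trans (Finset.sum_le_sum fun i _ => hresource i k))))
    _ = _ := by
      clear_value x
      simp only [Finset.sum_const, Finset.card_univ, Fintype.card_fin, nsmul_eq_mul]
      rw [ENNReal.ofReal_mul (Nat.cast_nonneg _), ENNReal.ofReal_mul (by positivity),
        ENNReal.ofReal_add (Nat.cast_nonneg _) zero_le_two, ENNReal.ofReal_natCast,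
        ENNReal.ofReal_natCast, ENNReal.ofReal_ofNat]
      ring

lemma IsRun.ae_isTypical (hrun : IsRun P ℱ D cg c₀ Rmax Amax b T α δ θ Z w p)
    (hD : ∀ k, BoundedRequests Rmax Amax (D k)) (U : ℝ) :
    ∀ᵐ ω ∂P, ω ∉ atypicalEvent D θ Z Rmax Amax U T →
      IsTypical D Rmax Amax U T (fun s => θ s ω) fun s => Z s ω := by
  filter_upwards [hrun.ae_forall_request hD] with ω hZ hω
  simp only [atypicalEvent, Set.mem_iUnion, Set.mem_union, not_exists, not_or] at hω
  have hle : ∀ {f : Request d → ℝ} {c : ℝ} {k}, ω ∉ deviationEvent D θ Z U T f c k →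
      ∀ t ≤ T, ∀ q, |sampleMean (fun s => θ s ω) (fun s => Z s ω) k t (scored f q) -
        ∫ z, scored f q z ∂(D k)| ≤ c * devRadius U (sampleCount (fun s => θ s ω) k t) :=
    fun h t ht q => not_lt.1 fun hlt => h ⟨t, ht, q, hlt⟩
  exact ⟨hZ, fun t ht k q => (hle (hω k).1.1 t ht q).trans_eq (one_mul _),
    fun t ht k q => hle (hω k).1.2 t ht q, fun i t ht k q => hle ((hω k).2 i) t ht q⟩

lemma slack_mem_Icc (T : ℕ) : slack T ∈ Set.Icc (0 : ℝ) 1 :=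
  ⟨Real.sqrt_nonneg _, Real.sqrt_le_one.2 (div_le_one_of_le₀
    (Real.log_le_self T.cast_nonneg) T.cast_nonneg)⟩

/-- The numerator of the confidence radius of the algorithm, as a multiple of `1 / √(n ∨ 1)`. -/
def confScale (cg c₀ Rmax Amax : ℝ) (b : Fin d → ℝ) (K T : ℕ) (α δ : ℝ) : ℝ :=
  α * cg * Rmax * √(d * Real.log (c₀ * d * priceBound Rmax b * Amax * T / Rmax) +
    Real.log (K * T / δ))

lemma confRadius_eq_devRadius (cg c₀ Rmax Amax : ℝ) (b : Fin d → ℝ) (K T : ℕ) (α δ : ℝ) (n : ℕ) :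
    confRadius cg c₀ Rmax Amax b K T α δ n =
      devRadius (confScale cg c₀ Rmax Amax b K T α δ) n := by
  rw [confRadius, Real.sqrt_div' _ (by positivity), devRadius, confScale, ← mul_div_assoc]

lemma optLagrangian_eq (cg c₀ Rmax Amax : ℝ) (b : Fin d → ℝ) (T : ℕ) (α δ : ℝ)
    (θ : ℕ → Fin K) (z : ℕ → Request d) (t : ℕ) :
    optLagrangian cg c₀ Rmax Amax b T α δ θ z t = lagrangian ((1 - slack T) • b)
      (fun k => devRadius (confScale cg c₀ Rmax Amax b K T α δ) (sampleCount θ k t)) θ z t := by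
  simp only [← confRadius_eq_devRadius]
  rfl

lemma mixFluidValues_nonempty {D : Fin K → Measure (Request d)} {b : Fin d → ℝ} (hK : 0 < K)
    (hb : ∀ i, 0 ≤ b i) : (mixFluidValues D b).Nonempty :=
  ⟨0, Pi.single ⟨0, hK⟩ 1, single_mem_stdSimplex ℝ _, fun _ _ => 0, fun _ => measurable_const,
    fun _ _ => by simp, fun i => by simpa using hb i, by simp⟩

lemma totalReward_mem_Icc {Rmax : ℝ} {T : ℕ} {z : ℕ → Request d} {B : Fin d → ℝ}
    {p : ℕ → Fin d → ℝ} (hR : 0 ≤ Rmax) (hz : ∀ t < T, (z t).1 ∈ Set.Icc 0 Rmax) :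
    totalReward K T B z p ∈ Set.Icc 0 (T * Rmax) := by
  classical
  have hround : ∀ t ∈ Finset.range T,
      (if Admits K t (remBudget K B z p t) (p t) (z t) then (z t).1 else 0) ∈ Set.Icc 0 Rmax := by
    intro t ht
    split_ifs
    exacts [hz t (Finset.mem_range.1 ht), ⟨le_rfl, hR⟩]
  exact ⟨Finset.sum_nonneg fun t ht => (hround t ht).1,
    (Finset.sum_le_card_nsmul _ _ _ fun t ht => (hround t ht).2).trans_eq (by simp)⟩

lemma measurableSet_admits {Ω : Type*} {m : MeasurableSpace Ω} {rem p : Ω → Fin d → ℝ}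
    {z : Ω → Request d} {t : ℕ} (hrem : Measurable rem) (hp : Measurable p) (hz : Measurable z) :
    MeasurableSet {ω | Admits K t (rem ω) (p ω) (z ω)} := by
  have hbid : Measurable fun ω => p ω ⬝ᵥ (z ω).2 := by
    unfold dotProduct
    fun_prop
  exact (MeasurableSet.const _).inter ((measurableSet_le hz.snd hrem).inter
    (measurableSet_lt hbid hz.fst))

lemma measurable_remBudget (hZ : ∀ s < t, Measurable (Z s)) (hp : ∀ s < t, Measurable (p s)) :
    Measurable fun ω => remBudget K B (fun s => Z s ω) (fun s => p s ω) t := by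
  induction t with
  | zero => exact measurable_const
  | succ t ih =>
    have hrem := ih (fun s hs => hZ s (hs.trans t.lt_succ_self))
      fun s hs => hp s (hs.trans t.lt_succ_self)
    have hZt := hZ t t.lt_succ_self
    exact .ite (measurableSet_admits hrem (hp t t.lt_succ_self) hZt) (hrem.sub hZt.snd) hrem

lemma measurable_totalReward (hZ : ∀ t < T, Measurable (Z t)) (hp : ∀ t < T, Measurable (p t)) :
    Measurable fun ω => totalReward K T B (fun s => Z s ω) fun s => p s ω := by
  refine Finset.measurable_fun_sum _ fun t ht => ?_
  have htT := Finset.mem_range.1 ht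
  exact .ite (measurableSet_admits (measurable_remBudget (fun s hs => hZ s (hs.trans htT))
    fun s hs => hp s (hs.trans htT)) (hp t htT) (hZ t htT)) (hZ t htT).fst measurable_const

lemma IsRun.integrable_totalReward [IsProbabilityMeasure P]
    (hrun : IsRun P ℱ D cg c₀ Rmax Amax b T α δ θ Z w p)
    (hR : 0 ≤ Rmax) (hD : ∀ k, BoundedRequests Rmax Amax (D k)) :
    Integrable (fun ω => totalReward K T B (fun t => Z t ω) fun t => p t ω) P :=
  .of_mem_Icc 0 (T * Rmax) (measurable_totalReward
      (fun t ht => (hrun.measurable_request t ht).mono (ℱ.le _) le_rfl)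
      fun t ht => (hrun.measurable_price t ht).mono (ℱ.le _) le_rfl).aemeasurable
    ((hrun.ae_forall_request hD).mono fun _ hω =>
      totalReward_mem_Icc hR fun t ht => BoundedRequest.fst_mem_Icc (hω t ht))

lemma mixRegret_le_of_forall (hK : 0 < K) (hT : 0 < T) (hb : ∀ i, 0 ≤ b i) {C : ℝ}
    (h : ∀ v ∈ mixFluidValues D b,
      T * v ≤ ∫ ω, totalReward K T ((T : ℝ) • b) (fun t => Z t ω) (fun t => p t ω) ∂P + C) :
    mixRegret P D b T Z p ≤ C := by
  have hT₀ : (0 : ℝ) < T := Nat.cast_pos.2 hT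
  have hvalue : mixFluidValue D b ≤
      (∫ ω, totalReward K T ((T : ℝ) • b) (fun t => Z t ω) (fun t => p t ω) ∂P + C) / T :=
    csSup_le (mixFluidValues_nonempty hK hb) fun v hv => (le_div_iff₀' hT₀).2 (h v hv)
  exact sub_le_iff_le_add'.2 ((le_div_iff₀' hT₀).1 hvalue)

lemma IsRun.mixRegret_le_mul [∀ k, IsProbabilityMeasure (D k)]
    (hrun : IsRun P ℱ D cg c₀ Rmax Amax b T α δ θ Z w p)
    (hR : 0 ≤ Rmax) (hD : ∀ k, BoundedRequests Rmax Amax (D k)) (hK : 0 < K) (hT : 0 < T)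
    (hb : ∀ i, 0 ≤ b i) : mixRegret P D b T Z p ≤ T * Rmax := by
  refine mixRegret_le_of_forall hK hT hb fun v hv => le_add_of_nonneg_of_le ?_
    (mul_le_mul_of_nonneg_left (mixFluidValues_subset_Iic hD hv) T.cast_nonneg)
  refine integral_nonneg_of_ae ((hrun.ae_forall_request hD).mono fun ω hω => ?_)
  exact (totalReward_mem_Icc hR fun t ht => BoundedRequest.fst_mem_Icc (hω t ht)).1

lemma IsRun.ae_sum_inBudget_mul_mixMean_le
    (hrun : IsRun P ℱ D cg c₀ Rmax Amax b T α δ θ Z w p) (hR : 0 ≤ Rmax)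
    (hD : ∀ k, BoundedRequests Rmax Amax (D k)) :
    ∀ᵐ ω ∂P, ∑ t ∈ Finset.Ico K T, inBudget K B (fun s => Z s ω) (fun s => p s ω) t *
        mixMean D Prod.fst (w t ω) (p t ω) ≤
      totalReward K T B (fun s => Z s ω) (fun s => p s ω) + Rmax -
        ∑ t ∈ Finset.Ico K T, fluctuation D Prod.fst B Z w p t ω := by
  filter_upwards [hrun.ae_forall_request hD] with ω hω
  refine le_sub_iff_add_le.2 ((Finset.sum_add_distrib.symm.trans ?_).trans_le
    (sum_inBudget_mul_scored_le (K := K) (B := B) (p := fun s => p s ω) hR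
      (fun t ht => (hω t ht).2.2.1) fun t ht => BoundedRequest.fst_mem_Icc (hω t ht)))
  exact Finset.sum_congr rfl fun t _ => by rw [fluctuation]; ring

/-- The upper bound for the regret of a typical history, apart from the fluctuation of the reward:
the cost of optimism, the reward lost to an early exhaustion of the budget, the initialization and
the slack. Here `m` is a lower bound for the components of `b`. -/
def typicalError (D : Fin K → Measure (Request d)) (Rmax Amax m U W : ℝ) (b : Fin d → ℝ) (T : ℕ)
    (θ : ℕ → Ω → Fin K) (Z : ℕ → Ω → Request d) (w : ℕ → Ω → Fin K → ℝ) (p : ℕ → Ω → Fin d → ℝ)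
    (ω : Ω) : ℝ :=
  2 * W * ∑ t ∈ Finset.Ico K T, mixRadius (fun s => θ s ω) t (w t ω) +
    Rmax / m * (∑ i, |∑ t ∈ Finset.Ico K T,
      fluctuation D (fun z => z.2 i) ((T : ℝ) • b) Z w p t ω| +
      Amax * U * ∑ t ∈ Finset.Ico K T, mixRadius (fun s => θ s ω) t (w t ω)) +
    (K * Rmax + slack T * T * Rmax)

section TypicalError

variable {m U W v : ℝ}

lemma IsRun.ae_typicalError_nonneg (hrun : IsRun P ℱ D cg c₀ Rmax Amax b T α δ θ Z w p)
    (hR : 0 ≤ Rmax) (hA : 0 ≤ Amax) (hm : 0 ≤ m) (hU : 0 ≤ U) (hW : 0 ≤ W) :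
    ∀ᵐ ω ∂P, 0 ≤ typicalError D Rmax Amax m U W b T θ Z w p ω := by
  filter_upwards [(Finset.eventually_all _).2 fun t => hrun.mixture_mem_stdSimplex (t := t)]
    with ω hω
  have hradius : 0 ≤ ∑ t ∈ Finset.Ico K T, mixRadius (fun s => θ s ω) t (w t ω) :=
    Finset.sum_nonneg fun t ht => mixRadius_nonneg _ _ (hω t ht).1
  have hslack := (slack_mem_Icc T).1
  unfold typicalError
  positivity

lemma IsRun.integrable_typicalError [IsProbabilityMeasure P] [∀ k, IsProbabilityMeasure (D k)]
    (hrun : IsRun P ℱ D cg c₀ Rmax Amax b T α δ θ Z w p)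
    (hD : ∀ k, BoundedRequests Rmax Amax (D k)) :
    Integrable (typicalError D Rmax Amax m U W b T θ Z w p) P := by
  have hradius := integrable_finsetSum _ fun t ht => hrun.integrable_mixRadius ht
  have hfluct := integrable_finsetSum (Finset.univ : Finset (Fin d)) fun i _ =>
    (integrable_finsetSum _ fun t ht => hrun.integrable_fluctuation (B := (T : ℝ) • b)
      ((measurable_pi_apply i).comp measurable_snd) (fun k => (hD k).ae_snd_mem_Icc i) ht).abs
  exact ((hradius.const_mul _).add ((hfluct.add (hradius.const_mul _)).const_mul _)).add
    (integrable_const _)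

lemma IsRun.integral_typicalError_le [IsProbabilityMeasure P] [∀ k, IsProbabilityMeasure (D k)]
    (hrun : IsRun P ℱ D cg c₀ Rmax Amax b T α δ θ Z w p)
    (hR : 0 ≤ Rmax) (hA : 0 ≤ Amax) (hm : 0 ≤ m) (hU : 0 ≤ U) (hW : 0 ≤ W)
    (hD : ∀ k, BoundedRequests Rmax Amax (D k)) :
    ∫ ω, typicalError D Rmax Amax m U W b T θ Z w p ω ∂P ≤ 2 * W * (3 * √(K * T)) +
      Rmax / m * (d * (Amax * √T) + Amax * U * (3 * √(K * T))) +
      (K * Rmax + slack T * T * Rmax) := by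
  have hmeas : ∀ i, Measurable fun z : Request d => z.2 i :=
    fun i => (measurable_pi_apply i).comp measurable_snd
  have hradius := integrable_finsetSum _ fun t ht => hrun.integrable_mixRadius ht
  have hfluct := fun i : Fin d => (integrable_finsetSum _ fun t ht =>
    hrun.integrable_fluctuation (B := (T : ℝ) • b) (hmeas i)
      (fun k => (hD k).ae_snd_mem_Icc i) ht).abs
  have hfluct_sum := integrable_finsetSum Finset.univ fun i _ => hfluct i
  have hfluct_le : ∑ i, ∫ ω, |∑ t ∈ Finset.Ico K T,
      fluctuation D (fun z => z.2 i) ((T : ℝ) • b) Z w p t ω| ∂P ≤ d * (Amax * √T) :=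
    (Finset.sum_le_card_nsmul _ _ _ fun i _ => hrun.integral_abs_sum_fluctuation_le (hmeas i) hA
      fun k => (hD k).ae_snd_mem_Icc i).trans_eq (by simp)
  have hradius_le := hrun.integral_sum_mixRadius_le
  have hlost := (hfluct_sum.fun_add (hradius.const_mul (Amax * U))).const_mul (Rmax / m)
  unfold typicalError
  rw [integral_add ((hradius.const_mul _).fun_add hlost) (integrable_const _),
    integral_add (hradius.const_mul _) hlost, integral_const_mul, integral_const_mul,
    integral_add hfluct_sum (hradius.const_mul _), integral_const_mul,
    integral_finsetSum _ fun i _ => hfluct i, integral_const, probReal_univ, one_smul]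
  gcongr

lemma IsRun.ae_mul_le_of_notMem_atypicalEvent [∀ k, IsProbabilityMeasure (D k)]
    (hrun : IsRun P ℱ D cg c₀ Rmax Amax b T α δ θ Z w p)
    (hR : 0 ≤ Rmax) (hA : 0 ≤ Amax) (hm₀ : 0 < m) (hm : ∀ i, m ≤ b i) (hU : 0 ≤ U)
    (hUW : Rmax * U ≤ confScale cg c₀ Rmax Amax b K T α δ)
    (hD : ∀ k, BoundedRequests Rmax Amax (D k)) (hc : ∀ k, ContinuousValuation (D k)) (hKT : K ≤ T)
    (hv : v ∈ mixFluidValues D b) :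
    ∀ᵐ ω ∂P, ω ∉ atypicalEvent D θ Z Rmax Amax U T → T * v ≤
      ∑ t ∈ Finset.Ico K T, inBudget K ((T : ℝ) • b) (fun s => Z s ω) (fun s => p s ω) t *
        mixMean D Prod.fst (w t ω) (p t ω) +
      typicalError D Rmax Amax m U (confScale cg c₀ Rmax Amax b K T α δ) b T θ Z w p ω := by
  filter_upwards [hrun.ae_isTypical hD U, (Finset.eventually_all (Finset.Ico K T)).2 fun t ht =>
    hrun.saddle t (Finset.mem_Ico.1 ht).2 (Finset.mem_Ico.1 ht).1] with ω htyp hwp hω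
  refine ((htyp hω).mul_le_sum_inBudget_mul_mixMean (p := fun s => p s ω) (w := fun s => w s ω)
    hR hA hU hUW hm₀ hm (slack_mem_Icc T) hD hc hKT (fun t ht => ?_) hv).trans_eq ?_
  · simpa only [optLagrangian_eq] using hwp t ht
  · simp only [typicalError, fluctuation]
    ring

lemma IsRun.ae_mul_le_totalReward_add [∀ k, IsProbabilityMeasure (D k)]
    (hrun : IsRun P ℱ D cg c₀ Rmax Amax b T α δ θ Z w p)
    (hR : 0 ≤ Rmax) (hA : 0 ≤ Amax) (hm₀ : 0 < m) (hm : ∀ i, m ≤ b i) (hU : 0 ≤ U)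
    (hUW : Rmax * U ≤ confScale cg c₀ Rmax Amax b K T α δ)
    (hD : ∀ k, BoundedRequests Rmax Amax (D k)) (hc : ∀ k, ContinuousValuation (D k)) (hKT : K ≤ T)
    (hv : v ∈ mixFluidValues D b) {N : Set Ω} (hN : atypicalEvent D θ Z Rmax Amax U T ⊆ N) :
    ∀ᵐ ω ∂P, T * v ≤
      totalReward K T ((T : ℝ) • b) (fun t => Z t ω) (fun t => p t ω) + Rmax -
        ∑ t ∈ Finset.Ico K T, fluctuation D Prod.fst ((T : ℝ) • b) Z w p t ω +
      typicalError D Rmax Amax m U (confScale cg c₀ Rmax Amax b K T α δ) b T θ Z w p ω +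
      N.indicator (fun _ => (T * Rmax : ℝ)) ω := by
  filter_upwards [hrun.ae_mul_le_of_notMem_atypicalEvent hR hA hm₀ hm hU hUW hD hc hKT hv,
    hrun.ae_sum_inBudget_mul_mixMean_le (B := (T : ℝ) • b) hR hD,
    hrun.ae_typicalError_nonneg hR hA hm₀.le hU ((mul_nonneg hR hU).trans hUW),
    (Finset.eventually_all _).2 fun t => hrun.mixture_mem_stdSimplex (t := t)]
    with ω htyp hsum herror hw
  by_cases hω : ω ∈ N
  · have hmean : 0 ≤ ∑ t ∈ Finset.Ico K T, inBudget K ((T : ℝ) • b) (fun s => Z s ω)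
        (fun s => p s ω) t * mixMean D Prod.fst (w t ω) (p t ω) :=
      Finset.sum_nonneg fun t ht => mul_nonneg (inBudget_mem_Icc ..).1
        (mixMean_mem_Icc (fun k => (hD k).ae_fst_mem_Icc) (hw t ht) _).1
    rw [Set.indicator_of_mem hω]
    exact le_add_of_nonneg_of_le (add_nonneg (hmean.trans hsum) herror)
      (mul_le_mul_of_nonneg_left (mixFluidValues_subset_Iic hD hv) T.cast_nonneg)
  · rw [Set.indicator_of_notMem hω, add_zero]
    exact (htyp fun h => hω (hN h)).trans (by gcongr)

theorem IsRun.mul_le_integral_totalReward_add [IsProbabilityMeasure P]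
    [∀ k, IsProbabilityMeasure (D k)]
    (hrun : IsRun P ℱ D cg c₀ Rmax Amax b T α δ θ Z w p)
    (hR : 0 ≤ Rmax) (hA : 0 ≤ Amax) (hm₀ : 0 < m) (hm : ∀ i, m ≤ b i) (hU : 0 ≤ U)
    (hUW : Rmax * U ≤ confScale cg c₀ Rmax Amax b K T α δ)
    (hD : ∀ k, BoundedRequests Rmax Amax (D k)) (hc : ∀ k, ContinuousValuation (D k)) (hKT : K ≤ T)
    (hv : v ∈ mixFluidValues D b) :
    T * v ≤ ∫ ω, totalReward K T ((T : ℝ) • b) (fun t => Z t ω) (fun t => p t ω) ∂P + Rmax +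
      ∫ ω, typicalError D Rmax Amax m U (confScale cg c₀ Rmax Amax b K T α δ) b T θ Z w p ω ∂P +
      P.real (atypicalEvent D θ Z Rmax Amax U T) * (T * Rmax) := by
  have hN := measurableSet_toMeasurable P (atypicalEvent D θ Z Rmax Amax U T)
  have hreward := hrun.integrable_totalReward (B := (T : ℝ) • b) hR hD
  have hfluct : ∀ t ∈ Finset.Ico K T, Integrable (fluctuation D Prod.fst ((T : ℝ) • b) Z w p t) P :=
    fun t ht => hrun.integrable_fluctuation measurable_fst (fun k => (hD k).ae_fst_mem_Icc) ht
  have hmain : Integrable (fun ω =>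
      totalReward K T ((T : ℝ) • b) (fun t => Z t ω) (fun t => p t ω) + Rmax -
        ∑ t ∈ Finset.Ico K T, fluctuation D Prod.fst ((T : ℝ) • b) Z w p t ω) P :=
    (hreward.add (integrable_const Rmax)).sub (integrable_finsetSum _ hfluct)
  have herror := hrun.integrable_typicalError (m := m) (U := U)
    (W := confScale cg c₀ Rmax Amax b K T α δ) hD
  have hatypical := (integrable_const (μ := P) (T * Rmax : ℝ)).indicator hN
  have hint := integral_mono_ae (integrable_const _) ((hmain.fun_add herror).fun_add hatypical)
    (hrun.ae_mul_le_totalReward_add hR hA hm₀ hm hU hUW hD hc hKT hv (subset_toMeasurable P _))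
  rw [integral_add (hmain.fun_add herror) hatypical, integral_add hmain herror,
    integral_sub (hreward.fun_add (integrable_const _)) (integrable_finsetSum _ hfluct),
    integral_add hreward (integrable_const _), integral_finsetSum _ hfluct,
    Finset.sum_eq_zero fun t ht => hrun.integral_fluctuation measurable_fst
      (fun k => (hD k).ae_fst_mem_Icc) ht, integral_indicator_const _ hN, sub_zero] at hint
  simpa [measureReal_def] using hint

end TypicalError

end Run

section Constants

variable {cg c₀ Rmax Amax α : ℝ} {b : Fin d → ℝ} {T : ℕ}

lemma half_le_log (hT : 2 ≤ T) : (1 / 2 : ℝ) ≤ Real.log T := by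
  have hlog : Real.log 2 ≤ Real.log T := Real.log_le_log two_pos (by exact_mod_cast hT)
  linarith [Real.log_two_gt_d9]

lemma sqrt_le_two_mul_sqrt_mul_log (hT : 2 ≤ T) : √T ≤ 2 * √(T * Real.log T) := by
  have hlog := half_le_log hT
  refine Real.sqrt_le_iff.2 ⟨by positivity, ?_⟩
  rw [mul_pow, Real.sq_sqrt (by positivity)]
  nlinarith [T.cast_nonneg (α := ℝ)]

lemma one_le_two_mul_sqrt_mul_log (hT : 2 ≤ T) : 1 ≤ 2 * √(T * Real.log T) :=
  (Real.one_le_sqrt.2 (by exact_mod_cast one_le_two.trans hT)).trans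
    (sqrt_le_two_mul_sqrt_mul_log hT)

lemma slack_mul_self (T : ℕ) : slack T * T = √(T * Real.log T) := by
  rcases T.eq_zero_or_pos with rfl | hT
  · simp
  · have hT₀ : (T : ℝ) ≠ 0 := by positivity
    calc
      slack T * T = √(Real.log T / T) * √(T * T) := by
        rw [slack, Real.sqrt_mul_self T.cast_nonneg]
      _ = √(T * Real.log T) := by
        rw [← Real.sqrt_mul' _ (by positivity)]
        congr 1
        field_simp

lemma union_bound_mul_horizon_le (hT : 2 ≤ T) (hKT : K ≤ T) (d : ℕ) :
    K * ((d + 2) * (T * (2 * (2 * T + 1) ^ (d + 1) *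
      Real.exp (-√((6 * d + 16) * Real.log T) ^ 2 / 2)))) * T ≤ (d + 2 : ℝ) := by
  have hT₂ : (2 : ℝ) ≤ T := by exact_mod_cast hT
  have hlog := half_le_log hT
  have hexp : Real.exp (-√((6 * d + 16) * Real.log T) ^ 2 / 2) = ((T : ℝ) ^ (3 * d + 8))⁻¹ := by
    rw [Real.sq_sqrt (by positivity), ← Real.exp_log (show (0 : ℝ) < T ^ (3 * d + 8) by positivity),
      ← Real.exp_neg, Real.log_pow]
    congr 1
    push_cast
    ring
  have hcount : (2 * T + 1 : ℝ) ≤ T ^ 3 := by nlinarith [mul_le_mul hT₂ hT₂ (by simp) (by simp)]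
  have hpow : (K * T * T * 2 : ℝ) * (2 * T + 1) ^ (d + 1) ≤ T ^ (3 * d + 8) :=
    calc
      _ ≤ (T * T * T * T : ℝ) * (T ^ 3) ^ (d + 1) := by gcongr
      _ = T ^ (3 * d + 7) := by ring
      _ ≤ T ^ (3 * d + 8) := pow_le_pow_right₀ (by linarith) (by lia)
  calc
    _ = (d + 2) * ((K * T * T * 2) * (2 * T + 1) ^ (d + 1) / T ^ (3 * d + 8) : ℝ) := by
      rw [hexp]
      ring
    _ ≤ (d + 2) * 1 := by
      gcongr
      exact (div_le_one (by positivity)).2 hpow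
    _ = d + 2 := mul_one _

/-- The factor of the horizon in the first logarithm of the confidence radius. -/
def logCoeff (c₀ Rmax Amax : ℝ) (b : Fin d → ℝ) : ℝ := c₀ * d * priceBound Rmax b * Amax / Rmax

/-- The factor of `log T` in the upper bound for the sum of the logarithms under the square root
of the confidence radius. -/
def logFactorConst (c₀ Rmax Amax : ℝ) (b : Fin d → ℝ) : ℝ :=
  d * (2 * |Real.log (logCoeff c₀ Rmax Amax b)| + 1) + 4

/-- The constant `C₁` of the regret bound. -/
def leadingConst (cg c₀ Rmax Amax : ℝ) (b : Fin d → ℝ) : ℝ :=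
  3 * (Rmax / (⨅ i, b i) * Amax * √(6 * d + 16)) +
    6 * (cg * Rmax * √(logFactorConst c₀ Rmax Amax b))

/-- The constant `C₂` of the regret bound. -/
def lowerOrderConst (c₀ Rmax Amax : ℝ) (b : Fin d → ℝ) : ℝ :=
  3 * Rmax + 2 * (Rmax / (⨅ i, b i) * d * Amax) + 2 * (Rmax * (d + 2)) +
    2 * (Rmax * (logCoeff c₀ Rmax Amax b ^ 2)⁻¹)

lemma iInf_pos_of_pos (hd : 0 < d) (hb : ∀ i, 0 < b i) : 0 < ⨅ i, b i := by
  have : Nonempty (Fin d) := ⟨⟨0, hd⟩⟩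
  obtain ⟨i, hi⟩ := exists_eq_ciInf_of_finite (f := b)
  exact hi ▸ hb i

lemma logCoeff_pos (hd : 0 < d) (hc₀ : 0 < c₀) (hR : 0 < Rmax) (hA : 0 < Amax)
    (hb : ∀ i, 0 < b i) : 0 < logCoeff c₀ Rmax Amax b := by
  have hmin := iInf_pos_of_pos hd hb
  unfold logCoeff priceBound
  positivity

lemma leadingConst_pos (hd : 0 < d) (hcg : 0 < cg) (hR : 0 < Rmax) (hA : 0 < Amax)
    (hb : ∀ i, 0 < b i) : 0 < leadingConst cg c₀ Rmax Amax b := by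
  have hmin := iInf_pos_of_pos hd hb
  unfold leadingConst logFactorConst
  positivity

lemma lowerOrderConst_pos (hd : 0 < d) (hR : 0 < Rmax) (hA : 0 < Amax) (hb : ∀ i, 0 < b i) :
    0 < lowerOrderConst c₀ Rmax Amax b := by
  have hmin := iInf_pos_of_pos hd hb
  unfold lowerOrderConst
  positivity

lemma log_mul_div_zpow (hK : 0 < K) (hT : 0 < T) :
    Real.log (K * T / (T : ℝ) ^ (-2 : ℤ)) = Real.log K + 3 * Real.log T := by
  rw [zpow_neg, div_inv_eq_mul, mul_assoc, Real.log_mul (by positivity) (by positivity),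
    Real.log_mul (by positivity) (by positivity), Real.log_zpow]
  push_cast
  ring

/-- The logarithm of `logCoeff` may be negative; for a horizon that is long in terms of it,
it costs at most half of `log T`. -/
lemma le_logFactor (hK : 0 < K) (hT : 0 < T) (hA : logCoeff c₀ Rmax Amax b ≠ 0)
    (hAT : 1 ≤ logCoeff c₀ Rmax Amax b ^ 2 * T) :
    (d / 2 + 3) * Real.log T ≤ d * Real.log (logCoeff c₀ Rmax Amax b * T) +
      Real.log (K * T / (T : ℝ) ^ (-2 : ℤ)) := by
  have hT₀ : (T : ℝ) ≠ 0 := by positivity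
  have hlong := Real.log_nonneg hAT
  rw [Real.log_mul (by positivity) hT₀, Real.log_pow, Nat.cast_ofNat] at hlong
  rw [log_mul_div_zpow hK hT, Real.log_mul hA hT₀]
  nlinarith [mul_nonneg (d.cast_nonneg (α := ℝ)) hlong, Real.log_natCast_nonneg K]

lemma logFactor_le (hK : 0 < K) (hKT : K ≤ T) (hT : 2 ≤ T) (hA : logCoeff c₀ Rmax Amax b ≠ 0) :
    d * Real.log (logCoeff c₀ Rmax Amax b * T) + Real.log (K * T / (T : ℝ) ^ (-2 : ℤ)) ≤
      logFactorConst c₀ Rmax Amax b * Real.log T := by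
  have hlogT := half_le_log hT
  have hlogK : Real.log K ≤ Real.log T :=
    Real.log_le_log (by exact_mod_cast hK) (by exact_mod_cast hKT)
  have hlogA : Real.log (logCoeff c₀ Rmax Amax b) ≤
      2 * |Real.log (logCoeff c₀ Rmax Amax b)| * Real.log T := by
    nlinarith [le_abs_self (Real.log (logCoeff c₀ Rmax Amax b)),
      abs_nonneg (Real.log (logCoeff c₀ Rmax Amax b))]
  rw [log_mul_div_zpow hK (by lia), Real.log_mul hA (by positivity), logFactorConst]
  nlinarith [mul_le_mul_of_nonneg_left hlogA (d.cast_nonneg (α := ℝ))]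

lemma confScale_eq (cg c₀ Rmax Amax : ℝ) (b : Fin d → ℝ) (K T : ℕ) (α δ : ℝ) :
    confScale cg c₀ Rmax Amax b K T α δ =
      α * cg * Rmax * √(d * Real.log (logCoeff c₀ Rmax Amax b * T) + Real.log (K * T / δ)) := by
  rw [confScale, logCoeff, div_mul_eq_mul_div]

lemma mul_sqrt_log_le_confScale (hR : 0 ≤ Rmax) (hcg : 4 ≤ cg) (hα : 1 ≤ α) (hK : 0 < K)
    (hT : 2 ≤ T) (hA : logCoeff c₀ Rmax Amax b ≠ 0)
    (hAT : 1 ≤ logCoeff c₀ Rmax Amax b ^ 2 * T) :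
    Rmax * √((6 * d + 16) * Real.log T) ≤
      confScale cg c₀ Rmax Amax b K T α ((T : ℝ) ^ (-2 : ℤ)) := by
  have hlog := half_le_log hT
  have hfactor := le_logFactor hK (by lia) hA hAT
  rw [confScale_eq, mul_right_comm, mul_comm]
  set L := d * Real.log (logCoeff c₀ Rmax Amax b * T) + Real.log (K * T / (T : ℝ) ^ (-2 : ℤ))
  refine mul_le_mul_of_nonneg_right ?_ hR
  calc
    √((6 * d + 16) * Real.log T) ≤ 4 * √L := by
      refine Real.sqrt_le_iff.2 ⟨by positivity, ?_⟩
      rw [mul_pow, Real.sq_sqrt (le_trans (by positivity) hfactor)]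
      nlinarith [mul_nonneg (d.cast_nonneg (α := ℝ)) (one_half_pos.le.trans hlog)]
    _ ≤ α * cg * √L := by
      gcongr
      nlinarith

lemma confScale_le (hR : 0 ≤ Rmax) (hcg : 0 ≤ cg) (hα : 0 ≤ α) (hK : 0 < K) (hKT : K ≤ T)
    (hT : 2 ≤ T) (hA : logCoeff c₀ Rmax Amax b ≠ 0) :
    confScale cg c₀ Rmax Amax b K T α ((T : ℝ) ^ (-2 : ℤ)) ≤
      α * (cg * Rmax * √(logFactorConst c₀ Rmax Amax b)) * √(Real.log T) := by
  rw [confScale_eq]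
  calc
    _ ≤ α * cg * Rmax * √(logFactorConst c₀ Rmax Amax b * Real.log T) := by
      gcongr
      exact logFactor_le hK hKT hT hA
    _ = _ := by
      rw [Real.sqrt_mul' _ (one_half_pos.le.trans (half_le_log hT))]
      ring

lemma sqrt_log_mul_sqrt_le (hd : 0 < d) (K T : ℕ) :
    √(Real.log T) * √(K * T) ≤ √(K * T * (d * Real.log T)) := by
  have hd₁ : (1 : ℝ) ≤ d := by exact_mod_cast hd
  rw [mul_comm, ← Real.sqrt_mul (by positivity)]
  gcongr
  exact le_mul_of_one_le_left (Real.log_natCast_nonneg T) hd₁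

lemma mul_sqrt_mul_le_leadingConst (hd : 0 < d) (hcg : 0 ≤ cg) (hR : 0 ≤ Rmax) (hA : 0 ≤ Amax)
    (hm : 0 ≤ ⨅ i, b i) (hα : 1 ≤ α) {W : ℝ}
    (hW : W ≤ α * (cg * Rmax * √(logFactorConst c₀ Rmax Amax b)) * √(Real.log T)) :
    2 * W * (3 * √(K * T)) +
        Rmax / (⨅ i, b i) * (Amax * √((6 * d + 16) * Real.log T) * (3 * √(K * T))) ≤
      leadingConst cg c₀ Rmax Amax b * α * √(K * T * (d * Real.log T)) := by
  have hlog := sqrt_log_mul_sqrt_le hd K T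
  set S := √(K * T * (d * Real.log T))
  set κ := cg * Rmax * √(logFactorConst c₀ Rmax Amax b)
  have hradius : W * √(K * T) ≤ κ * (α * S) :=
    calc
      W * √(K * T) ≤ α * κ * √(Real.log T) * √(K * T) := by gcongr
      _ = κ * (α * (√(Real.log T) * √(K * T))) := by ring
      _ ≤ κ * (α * S) := by gcongr
  have hfluctuation : √((6 * d + 16) * Real.log T) * √(K * T) ≤ √(6 * d + 16) * (α * S) := by
    rw [Real.sqrt_mul (by positivity), mul_assoc]
    exact mul_le_mul_of_nonneg_left
      (hlog.trans (le_mul_of_one_le_left (Real.sqrt_nonneg _) hα)) (Real.sqrt_nonneg _)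
  calc
    _ = 6 * (W * √(K * T)) +
        3 * (Rmax / (⨅ i, b i) * Amax * (√((6 * d + 16) * Real.log T) * √(K * T))) := by ring
    _ ≤ 6 * (κ * (α * S)) + 3 * (Rmax / (⨅ i, b i) * Amax * (√(6 * d + 16) * (α * S))) := by gcongr
    _ = leadingConst cg c₀ Rmax Amax b * α * S := by
      rw [leadingConst]
      ring

lemma add_add_add_le_lowerOrderConst (hR : 0 ≤ Rmax) (hA : 0 ≤ Amax) (hm : 0 ≤ ⨅ i, b i)
    (hT : 2 ≤ T) :
    Rmax / (⨅ i, b i) * (d * (Amax * √T)) + slack T * T * Rmax + Rmax + Rmax * (d + 2) ≤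
      lowerOrderConst c₀ Rmax Amax b * √(T * Real.log T) := by
  have hsqrt := sqrt_le_two_mul_sqrt_mul_log hT
  have hone := one_le_two_mul_sqrt_mul_log hT
  rw [slack_mul_self]
  set Q := √(T * Real.log T)
  calc
    _ ≤ Rmax / (⨅ i, b i) * (d * (Amax * (2 * Q))) + Q * Rmax + Rmax * (2 * Q) +
        Rmax * (d + 2) * (2 * Q) := by
      refine add_le_add (add_le_add (add_le_add ?_ le_rfl) ?_) ?_
      · gcongr
      · exact le_mul_of_one_le_right hR hone
      · exact le_mul_of_one_le_right (by positivity) hone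
    _ = (3 * Rmax + 2 * (Rmax / (⨅ i, b i) * d * Amax) + 2 * (Rmax * (d + 2))) * Q := by ring
    _ ≤ lowerOrderConst c₀ Rmax Amax b * Q :=
      mul_le_mul_of_nonneg_right (le_add_of_nonneg_right (by positivity)) (Real.sqrt_nonneg _)

lemma regretBound_le {C₁ C₂ : ℝ} (hC₁ : 0 ≤ C₁) (hC₂ : 0 ≤ C₂) (hR : 0 ≤ Rmax) (hα : 1 ≤ α)
    (hK : 0 < K) (hKT : K ≤ T) (hT : 2 ≤ T) (d : ℕ) :
    C₁ * α * √(K * T * (d * Real.log T)) + C₂ * √(T * Real.log T) + K * Rmax ≤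
      2 * (C₁ * √d + C₂ + Rmax) * (α * √(K * T)) * Real.log T := by
  have hK₁ : (1 : ℝ) ≤ K := by exact_mod_cast hK
  have hKT' : (K : ℝ) ≤ T := by exact_mod_cast hKT
  have hlog := half_le_log hT
  have hsqrt_log : √(Real.log T) ≤ 2 * Real.log T :=
    Real.sqrt_le_iff.2 ⟨by linarith, by nlinarith⟩
  have hαr : √(K * T) ≤ α * √(K * T) := le_mul_of_one_le_left (Real.sqrt_nonneg _) hα
  have hlead : √(K * T * (d * Real.log T)) ≤ √(K * T) * (√d * (2 * Real.log T)) := by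
    rw [Real.sqrt_mul (by positivity), Real.sqrt_mul d.cast_nonneg]
    gcongr
  have hlower : √(T * Real.log T) ≤ α * √(K * T) * (2 * Real.log T) := by
    rw [Real.sqrt_mul T.cast_nonneg]
    refine mul_le_mul (le_trans ?_ hαr) hsqrt_log (Real.sqrt_nonneg _) (by positivity)
    exact Real.sqrt_le_sqrt (le_mul_of_one_le_left T.cast_nonneg hK₁)
  have hinit : (K : ℝ) ≤ α * √(K * T) * (2 * Real.log T) := by
    refine ((Real.le_sqrt_of_sq_le ?_).trans hαr).trans
      (le_mul_of_one_le_right (by positivity) (by linarith))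
    nlinarith
  calc
    _ ≤ C₁ * α * (√(K * T) * (√d * (2 * Real.log T))) +
        C₂ * (α * √(K * T) * (2 * Real.log T)) + α * √(K * T) * (2 * Real.log T) * Rmax := by
      gcongr
    _ = _ := by ring

end Constants

section Regret

variable {Ω : Type*} {mΩ : MeasurableSpace Ω} {P : Measure Ω} {ℱ : Filtration ℕ mΩ}
  {D : Fin K → Measure (Request d)} {cg c₀ Rmax Amax : ℝ} {b : Fin d → ℝ} {T : ℕ} {α : ℝ}
  {θ : ℕ → Ω → Fin K} {Z : ℕ → Ω → Request d} {w : ℕ → Ω → Fin K → ℝ} {p : ℕ → Ω → Fin d → ℝ}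
  [∀ k, IsProbabilityMeasure (D k)] [IsProbabilityMeasure P]

lemma IsRun.measureReal_atypicalEvent_mul_le {δ : ℝ}
    (hrun : IsRun P ℱ D cg c₀ Rmax Amax b T α δ θ Z w p)
    (hR : 0 < Rmax) (hA : 0 < Amax) (hD : ∀ k, BoundedRequests Rmax Amax (D k))
    (hKT : K ≤ T) (hT : 2 ≤ T) :
    P.real (atypicalEvent D θ Z Rmax Amax √((6 * d + 16) * Real.log T) T) * T ≤ d + 2 := by
  have hU : 1 ≤ √((6 * d + 16) * Real.log T) := Real.one_le_sqrt.2 (by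
    nlinarith [half_le_log hT, d.cast_nonneg (α := ℝ)])
  refine (mul_le_mul_of_nonneg_right (ENNReal.toReal_le_of_le_ofReal (by positivity)
    (hrun.measure_atypicalEvent_le hR hA hD hU)) T.cast_nonneg).trans ?_
  exact union_bound_mul_horizon_le hT hKT d

theorem IsRun.mixRegret_le_of_one_le_sq
    (hrun : IsRun P ℱ D cg c₀ Rmax Amax b T α ((T : ℝ) ^ (-2 : ℤ)) θ Z w p)
    (hcg : 4 ≤ cg) (hc₀ : 0 < c₀) (hα : 1 ≤ α) (hd : 0 < d) (hR : 0 < Rmax) (hA : 0 < Amax)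
    (hb : ∀ i, 0 < b i) (hD : ∀ k, BoundedRequests Rmax Amax (D k))
    (hc : ∀ k, ContinuousValuation (D k)) (hK : 0 < K) (hKT : K ≤ T) (hT : 2 ≤ T)
    (hAT : 1 ≤ logCoeff c₀ Rmax Amax b ^ 2 * T) :
    mixRegret P D b T Z p ≤ leadingConst cg c₀ Rmax Amax b * α * √(K * T * (d * Real.log T)) +
      lowerOrderConst c₀ Rmax Amax b * √(T * Real.log T) + K * Rmax := by
  have hm := iInf_pos_of_pos hd hb
  have hcoeff := logCoeff_pos hd hc₀ hR hA hb
  have hUW := mul_sqrt_log_le_confScale (K := K) hR.le hcg hα hK hT hcoeff.ne' hAT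
  have hW := confScale_le (α := α) (cg := cg) hR.le (by linarith) (by linarith) hK hKT hT hcoeff.ne'
  have herror := hrun.integral_typicalError_le hR.le hA.le hm.le
    (Real.sqrt_nonneg ((6 * d + 16) * Real.log T))
    ((mul_nonneg hR.le (Real.sqrt_nonneg _)).trans hUW) hD
  have hatypical := hrun.measureReal_atypicalEvent_mul_le hR hA hD hKT hT
  refine mixRegret_le_of_forall hK (by lia) (fun i => (hb i).le) fun v hv => ?_
  have hmain := hrun.mul_le_integral_totalReward_add hR.le hA.le hm
    (fun i => ciInf_le (Set.finite_range b).bddBelow i) (Real.sqrt_nonneg _) hUW hD hc hKT hv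
  have hlead := mul_sqrt_mul_le_leadingConst (K := K) hd (zero_le_four.trans hcg) hR.le hA.le hm.le
    hα hW
  have hlower := add_add_add_le_lowerOrderConst (c₀ := c₀) hR.le hA.le hm.le hT
  linarith [mul_le_mul_of_nonneg_left hatypical hR.le]

theorem IsRun.mixRegret_le
    (hrun : IsRun P ℱ D cg c₀ Rmax Amax b T α ((T : ℝ) ^ (-2 : ℤ)) θ Z w p)
    (hcg : 4 ≤ cg) (hc₀ : 0 < c₀) (hα : 1 ≤ α) (hd : 0 < d) (hR : 0 < Rmax) (hA : 0 < Amax)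
    (hb : ∀ i, 0 < b i) (hD : ∀ k, BoundedRequests Rmax Amax (D k))
    (hc : ∀ k, ContinuousValuation (D k)) (hK : 0 < K) (hT : 0 < T) :
    mixRegret P D b T Z p ≤ leadingConst cg c₀ Rmax Amax b * α * √(K * T * (d * Real.log T)) +
      lowerOrderConst c₀ Rmax Amax b * √(T * Real.log T) + K * Rmax := by
  have hC₁ := leadingConst_pos (c₀ := c₀) hd (four_pos.trans_le hcg) hR hA hb
  have hC₂ := lowerOrderConst_pos (c₀ := c₀) hd hR hA hb
  have htrivial := hrun.mixRegret_le_mul hR.le hD hK hT fun i => (hb i).le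
  rcases le_or_gt T K with hTK | hKT
  · exact htrivial.trans (le_add_of_nonneg_of_le (by positivity) (by gcongr))
  have hT₂ : 2 ≤ T := by lia
  rcases le_or_gt 1 (logCoeff c₀ Rmax Amax b ^ 2 * T) with hlong | hshort
  · exact hrun.mixRegret_le_of_one_le_sq hcg hc₀ hα hd hR hA hb hD hc hK hKT.le hT₂ hlong
  have hcoeff := logCoeff_pos hd hc₀ hR hA hb
  have hm := iInf_pos_of_pos hd hb
  have hT_le : (T : ℝ) ≤ (logCoeff c₀ Rmax Amax b ^ 2)⁻¹ := by
    rw [← one_div, le_div_iff₀' (by positivity)]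
    exact hshort.le
  have hlower : T * Rmax ≤ lowerOrderConst c₀ Rmax Amax b * √(T * Real.log T) :=
    calc
      T * Rmax ≤ Rmax * (logCoeff c₀ Rmax Amax b ^ 2)⁻¹ * (2 * √(T * Real.log T)) := by
        rw [mul_comm]
        exact (mul_le_mul_of_nonneg_left hT_le hR.le).trans
          (le_mul_of_one_le_right (by positivity) (one_le_two_mul_sqrt_mul_log hT₂))
      _ = 2 * (Rmax * (logCoeff c₀ Rmax Amax b ^ 2)⁻¹) * √(T * Real.log T) := by ring
      _ ≤ lowerOrderConst c₀ Rmax Amax b * √(T * Real.log T) := by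
        unfold lowerOrderConst
        gcongr
        exact le_add_of_nonneg_left (by positivity)
  have hlead : 0 ≤ leadingConst cg c₀ Rmax Amax b * α * √(K * T * (d * Real.log T)) := by positivity
  have hinit : 0 ≤ K * Rmax := by positivity
  linarith

theorem IsRun.mixRegret_le_mul_log
    (hrun : IsRun P ℱ D cg c₀ Rmax Amax b T α ((T : ℝ) ^ (-2 : ℤ)) θ Z w p)
    (hcg : 4 ≤ cg) (hc₀ : 0 < c₀) (hα : 1 ≤ α) (hd : 0 < d) (hR : 0 < Rmax) (hA : 0 < Amax)
    (hb : ∀ i, 0 < b i) (hD : ∀ k, BoundedRequests Rmax Amax (D k))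
    (hc : ∀ k, ContinuousValuation (D k)) (hK : 0 < K) (hT : 2 ≤ T) :
    mixRegret P D b T Z p ≤
      2 * (leadingConst cg c₀ Rmax Amax b * √d + lowerOrderConst c₀ Rmax Amax b + Rmax) *
        (α * √(K * T)) * Real.log T := by
  have hC₁ := leadingConst_pos (c₀ := c₀) hd (four_pos.trans_le hcg) hR hA hb
  have hC₂ := lowerOrderConst_pos (c₀ := c₀) hd hR hA hb
  rcases le_or_gt K T with hKT | hTK
  · exact (hrun.mixRegret_le hcg hc₀ hα hd hR hA hb hD hc hK (by lia)).trans
      (regretBound_le hC₁.le hC₂.le hR.le hα hK hKT hT d)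
  have hlog := half_le_log hT
  have hT_le : (T : ℝ) ≤ α * √(K * T) := by
    refine (Real.le_sqrt_of_sq_le ?_).trans (le_mul_of_one_le_left (Real.sqrt_nonneg _) hα)
    rw [sq]
    gcongr
  calc
    mixRegret P D b T Z p ≤ T * Rmax :=
      hrun.mixRegret_le_mul hR.le hD hK (by lia) fun i => (hb i).le
    _ ≤ α * √(K * T) * Rmax * (2 * Real.log T) :=
      (mul_le_mul_of_nonneg_right hT_le hR.le).trans
        (le_mul_of_one_le_right (by positivity) (by linarith))
    _ = 2 * Rmax * (α * √(K * T)) * Real.log T := by ring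
    _ ≤ _ := by
      gcongr
      exact le_add_of_nonneg_left (by positivity)

end Regret

end SPUCB

end

theorem mainTheorem1 :
    -- `cg`, `c₀`: the absolute constants of the confidence radius, any sufficiently large ones
    ∃ cgMin > (0 : ℝ), ∃ c₀Min > (0 : ℝ), ∀ cg ≥ cgMin, ∀ c₀ ≥ c₀Min,
    ∀ (d : ℕ), 0 < d → ∀ (Rmax Amax : ℝ), 0 < Rmax → 0 < Amax →
    ∀ (b : Fin d → ℝ), (∀ i, 0 < b i) →
      -- the constants depend only on `d`, `Rmax`, `Amax`, `b`
      (∃ C₁ > (0 : ℝ), ∃ C₂ > (0 : ℝ),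
        ∀ (K T : ℕ), 0 < K → 1 ≤ T → ∀ (α : ℝ), 1 ≤ α →
        ∀ (D : Fin K → Measure (SPUCB.Request d)) [∀ k, IsProbabilityMeasure (D k)],
        (∀ k, SPUCB.BoundedRequests Rmax Amax (D k)) →
        (∀ k, SPUCB.ContinuousValuation (D k)) →
        ∀ {Ω : Type*} {mΩ : MeasurableSpace Ω} (P : Measure Ω) [IsProbabilityMeasure P]
          (ℱ : Filtration ℕ mΩ) (θ : ℕ → Ω → Fin K) (Z : ℕ → Ω → SPUCB.Request d)
          (w : ℕ → Ω → Fin K → ℝ) (p : ℕ → Ω → Fin d → ℝ),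
        SPUCB.IsRun P ℱ D cg c₀ Rmax Amax b T α ((T : ℝ) ^ (-2 : ℤ)) θ Z w p →
        SPUCB.mixRegret P D b T Z p ≤
          C₁ * α * Real.sqrt (K * T * (d * Real.log T)) +
            C₂ * Real.sqrt (T * Real.log T) + K * Rmax) ∧
      -- the regret is of order `α √(K T)` up to powers of `log T`
      (∃ C > (0 : ℝ), ∃ m : ℕ,
        ∀ (K T : ℕ), 0 < K → 2 ≤ T → ∀ (α : ℝ), 1 ≤ α →
        ∀ (D : Fin K → Measure (SPUCB.Request d)) [∀ k, IsProbabilityMeasure (D k)],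
        (∀ k, SPUCB.BoundedRequests Rmax Amax (D k)) →
        (∀ k, SPUCB.ContinuousValuation (D k)) →
        ∀ {Ω : Type*} {mΩ : MeasurableSpace Ω} (P : Measure Ω) [IsProbabilityMeasure P]
          (ℱ : Filtration ℕ mΩ) (θ : ℕ → Ω → Fin K) (Z : ℕ → Ω → SPUCB.Request d)
          (w : ℕ → Ω → Fin K → ℝ) (p : ℕ → Ω → Fin d → ℝ),
        SPUCB.IsRun P ℱ D cg c₀ Rmax Amax b T α ((T : ℝ) ^ (-2 : ℤ)) θ Z w p →
        SPUCB.mixRegret P D b T Z p ≤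
          C * (α * Real.sqrt (K * T)) * Real.log T ^ m) := by
  refine ⟨4, four_pos, 1, one_pos, fun cg hcg c₀ hc₀ d hd Rmax Amax hR hA b hb => ?_⟩
  have hc₀' := one_pos.trans_le hc₀
  have hC₁ := SPUCB.leadingConst_pos (c₀ := c₀) hd (four_pos.trans_le hcg) hR hA hb
  have hC₂ := SPUCB.lowerOrderConst_pos (c₀ := c₀) hd hR hA hb
  constructor
  · refine ⟨_, hC₁, _, hC₂, fun K T hK hT α hα D _ hD hc Ω mΩ P _ ℱ θ Z w p hrun => ?_⟩
    exact hrun.mixRegret_le hcg hc₀' hα hd hR hA hb hD hc hK hT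
  · refine ⟨2 * (SPUCB.leadingConst cg c₀ Rmax Amax b * √d + SPUCB.lowerOrderConst c₀ Rmax Amax b +
      Rmax), by positivity, 1, fun K T hK hT α hα D _ hD hc Ω mΩ P _ ℱ θ Z w p hrun => ?_⟩
    rw [pow_one]
    exact hrun.mixRegret_le_mul_log hcg hc₀' hα hd hR hA hb hD hc hK hT
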